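/- Let $M$ be a smooth manifold (Hausdorff, second countable, without boundary), let $V\to M$ be a smooth real vector bundle with typical fibre $\mathbb R^k$, and let $\nabla$ be a smooth connection on $V$, with curvature $\Omega(X,Y)=[\nabla_X,\nabla_Y]-\nabla_{[X,Y]}$; $\nabla$ is flat if $\Omega=0$. For a piecewise smooth path $\gamma:[0,1]\to M$ from $x$ to $y$ and $v\in V_x$ let $P_\gamma v=S(1)\in V_y$, where $S$ is the parallel field along $\gamma$ (continuous, smooth on the intervals of some subdivision of $[0,1]$, with $DS/dt=0$ there) such that $S(0)=v$. Put $$\mathrm{Hol}_x(\nabla)=\{P_\gamma:\gamma\text{ a piecewise smooth loop at }x\},\qquad \mathrm{Hol}^0_x(\nabla)=\{P_\gamma:\gamma\text{ a null-homotopic piecewise smooth loop at }x\}.$$ Homotopies are continuous and fix the end points. Then: 1. $P_\gamma:V_x\to V_y$ is a well-defined linear isomorphism for every piecewise smooth path $\gamma$ from $x$ to $y$. 2. If $\nabla$ is flat and $\gamma_0,\gamma_1$ are homotopic piecewise smooth paths from $x$ to $y$, then $P_{\gamma_0}=P_{\gamma_1}$. 3. $\nabla$ is flat if and only if $P_\gamma=\mathrm{Id}$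 for every null-homotopic piecewise smooth loop $\gamma$ in $M$. 4. For every $x\in M$, $\mathrm{Hol}_x(\nabla)$ and $\mathrm{Hol}^0_x(\nabla)$ are subgroups of $GL(V_x)$. Under every linear identification $V_x\cong\mathbb R^k$, they are Lie subgroups of $GL(k,\mathbb R)$ (images of injective smooth immersive homomorphisms from Lie groups, not necessarily closed); $\mathrm{Hol}^0_x(\nabla)$ is a connected Lie subgroup and, for the Lie group topology of $\mathrm{Hol}_x(\nabla)$, it is the connected component of the identity of $\mathrm{Hol}_x(\nabla)$. 5. For every $x\in M$, $\mathrm{Hol}^0_x(\nabla)$ is a normal subgroup of $\mathrm{Hol}_x(\nabla)$, and there is a unique surjective group homomorphism $$\Phi:\pi_1(M,x)\to\mathrm{Hol}_x(\nabla)/\mathrm{Hol}^0_x(\nabla)$$ such that $\Phi([\gamma])=[P_\gamma]$ for every piecewise smooth loop $\gamma$ at $x$. -/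

import Mathlib

open Set Bundle Manifold
open scoped ContDiff Topology

noncomputable section

namespace FlatTransport

/-! ### Curves, covariant derivatives along curves, parallel transport, curvature -/

section Connection

variable {E : Type*} [NormedAddCommGroup E] [NormedSpace ℝ E]
  {M : Type*} [TopologicalSpace M] [ChartedSpace E M]
  {F : Type*} [NormedAddCommGroup F] [NormedSpace ℝ F]
  {V : M → Type*} [TopologicalSpace (TotalSpace F V)]
  [∀ x, AddCommGroup (V x)] [∀ x, Module ℝ (V x)] [∀ x, TopologicalSpace (V x)]
  [∀ x, IsTopologicalAddGroup (V x)] [∀ x, ContinuousSMul ℝ (V x)]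
  [FiberBundle F V] [VectorBundle ℝ F V]

/-- `0 = τ 0 < τ 1 < ⋯ < τ N = 1` is a subdivision of the unit interval. -/
def IsSubdivision {N : ℕ} (τ : Fin (N + 1) → ℝ) : Prop :=
  StrictMono τ ∧ τ 0 = 0 ∧ τ (Fin.last N) = 1

variable (E) in
/-- A piecewise smooth path: a continuous path that is smooth on every closed interval of some
subdivision of `[0, 1]`. -/
def PiecewiseSmooth {x y : M} (γ : Path x y) : Prop :=
  ∃ (N : ℕ) (τ : Fin (N + 1) → ℝ), IsSubdivision τ ∧
    ∀ i : Fin N, ContMDiffOn 𝓘(ℝ, ℝ) 𝓘(ℝ, E) ∞ γ.extend (Icc (τ i.castSucc) (τ i.succ))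

/-- The covariant derivative `D S / dt` at time `t` of a field `S` along the curve
`σ = proj ∘ S` (the covariant derivative of the pulled back connection on `σ^* V`).
With respect to the local frame `e_i` of a trivialization around `σ t`, for `S = ∑ sⁱ e_i`, it is
`∑ (dsⁱ/dt) e_i + ∑ sⁱ ∇_{σ'} e_i`; the section `∑ sⁱ(t) e_i` with coefficients frozen at time `t`
is `fun y => e.symm y (e (S t)).2`. Derivatives are taken within the time interval `A`. -/
def covDerivAlong (cov : CovariantDerivative 𝓘(ℝ, E) F V) (S : ℝ → TotalSpace F V) (A : Set ℝ)
    (t : ℝ) : V (S t).proj :=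
  let e := trivializationAt F V (S t).proj
  e.symm (S t).proj (derivWithin (fun r => (e (S r)).2) A t) +
    cov (fun y => e.symm y (e (S t)).2) (S t).proj
      (mfderivWithin 𝓘(ℝ, ℝ) 𝓘(ℝ, E) (fun r => (S r).proj) A t (1 : ℝ))

/-- `S` is a parallel field along the path `γ`: a continuous lift of `γ` to the total space which,
on every interval of some subdivision of `[0, 1]`, is smooth and satisfies `D S / dt = 0`. -/
def IsParallelAlong (cov : CovariantDerivative 𝓘(ℝ, E) F V) {x y : M} (γ : Path x y)
    (S : ℝ → TotalSpace F V) : Prop :=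
  ContinuousOn S (Icc 0 1) ∧ (∀ t ∈ Icc (0 : ℝ) 1, (S t).proj = γ.extend t) ∧
    ∃ (N : ℕ) (τ : Fin (N + 1) → ℝ), IsSubdivision τ ∧ ∀ i : Fin N,
      ContMDiffOn 𝓘(ℝ, ℝ) (𝓘(ℝ, E).prod 𝓘(ℝ, F)) ∞ S (Icc (τ i.castSucc) (τ i.succ)) ∧
      ∀ t ∈ Icc (τ i.castSucc) (τ i.succ),
        covDerivAlong cov S (Icc (τ i.castSucc) (τ i.succ)) t = 0

/-- `w` is the value at the end point of a parallel field along `γ` with initial value `v`. -/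
def IsParallelTransport (cov : CovariantDerivative 𝓘(ℝ, E) F V) {x y : M} (γ : Path x y)
    (v : V x) (w : V y) : Prop :=
  ∃ S : ℝ → TotalSpace F V, IsParallelAlong cov γ S ∧ S 0 = ⟨x, v⟩ ∧ S 1 = ⟨y, w⟩

open scoped Classical in
/-- Parallel transport `P_γ : V x → V y` along a path `γ` from `x` to `y`. -/
def parallelTransport (cov : CovariantDerivative 𝓘(ℝ, E) F V) {x y : M} (γ : Path x y)
    (v : V x) : V y :=
  if h : ∃ w, IsParallelTransport cov γ v w then h.choose else 0

/-- The curvature `Ω(X, Y) s = ∇_X ∇_Y s - ∇_Y ∇_X s - ∇_{[X, Y]} s`. -/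
def curvature (cov : CovariantDerivative 𝓘(ℝ, E) F V) (X Y : Π y : M, TangentSpace 𝓘(ℝ, E) y)
    (s : Π y : M, V y) (x : M) : V x :=
  cov (fun y => cov s y (Y y)) x (X x) - cov (fun y => cov s y (X y)) x (Y x) -
    cov s x (VectorField.mlieBracket 𝓘(ℝ, E) X Y x)

/-- A connection is flat if its curvature vanishes. -/
def IsFlat [IsManifold 𝓘(ℝ, E) 1 M] (cov : CovariantDerivative 𝓘(ℝ, E) F V) : Prop :=
  ∀ (X Y : Π y : M, TangentSpace 𝓘(ℝ, E) y) (s : Π y : M, V y),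
    ContMDiff 𝓘(ℝ, E) 𝓘(ℝ, E).tangent ∞ (fun y => (⟨y, X y⟩ : TangentBundle 𝓘(ℝ, E) M)) →
    ContMDiff 𝓘(ℝ, E) 𝓘(ℝ, E).tangent ∞ (fun y => (⟨y, Y y⟩ : TangentBundle 𝓘(ℝ, E) M)) →
    ContMDiff 𝓘(ℝ, E) (𝓘(ℝ, E).prod 𝓘(ℝ, F)) ∞ (fun y => (⟨y, s y⟩ : TotalSpace F V)) →
    ∀ x, curvature cov X Y s x = 0

/-! ### Holonomy -/

/-- The set of all `P_γ`, for `γ` a piecewise smooth loop at `x`. -/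
def holonomySet (cov : CovariantDerivative 𝓘(ℝ, E) F V) (x : M) : Set (V x ≃L[ℝ] V x) :=
  {A | ∃ γ : Path x x, PiecewiseSmooth E γ ∧ ∀ v, A v = parallelTransport cov γ v}

/-- The set of all `P_γ`, for `γ` a null-homotopic piecewise smooth loop at `x`. -/
def restrictedHolonomySet (cov : CovariantDerivative 𝓘(ℝ, E) F V) (x : M) :
    Set (V x ≃L[ℝ] V x) :=
  {A | ∃ γ : Path x x, PiecewiseSmooth E γ ∧ γ.Homotopic (Path.refl x) ∧
    ∀ v, A v = parallelTransport cov γ v}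

/-- The holonomy group at `x`, as a subgroup of `GL(V x)`. (It is part of the main statement that
its elements are exactly those of `holonomySet`.) -/
def holonomyGroup (cov : CovariantDerivative 𝓘(ℝ, E) F V) (x : M) : Subgroup (V x ≃L[ℝ] V x) :=
  Subgroup.closure (holonomySet cov x)

/-- The restricted holonomy group at `x`, as a subgroup of `GL(V x)`. (It is part of the main
statement that its elements are exactly those of `restrictedHolonomySet`.) -/
def restrictedHolonomyGroup (cov : CovariantDerivative 𝓘(ℝ, E) F V) (x : M) :
    Subgroup (V x ≃L[ℝ] V x) :=
  Subgroup.closure (restrictedHolonomySet cov x)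

end Connection

/-! ### Lie subgroups -/

section LieSubgroup

/-- The isomorphism `GL(W) ≃ GL(F)`, `A ↦ φ ∘ A ∘ φ⁻¹`, induced by an identification `φ : W ≃ F`;
`GL(F)` is the Lie group of units of the algebra of endomorphisms of `F`. -/
def conjGL {W F : Type*} [AddCommGroup W] [Module ℝ W] [TopologicalSpace W]
    [NormedAddCommGroup F] [NormedSpace ℝ F] (φ : W ≃L[ℝ] F) :
    (W ≃L[ℝ] W) →* (F →L[ℝ] F)ˣ :=
  (ContinuousLinearEquiv.unitsEquiv ℝ F).symm.toMonoidHom.comp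
    { toFun := fun A => (φ.symm.trans A).trans φ
      map_one' := by ext v; exact φ.apply_symm_apply v
      map_mul' := fun A B => by
        ext v
        exact congrArg (fun z => φ (A z)) (φ.symm_apply_apply (B (φ.symm v))).symm }

theorem conjGL_apply {W F : Type*} [AddCommGroup W] [Module ℝ W] [TopologicalSpace W]
    [NormedAddCommGroup F] [NormedSpace ℝ F] (φ : W ≃L[ℝ] F) (A : W ≃L[ℝ] W) (v : F) :
    (conjGL φ A : F →L[ℝ] F) v = φ (A (φ.symm v)) := rfl

universe u

variable {E' : Type*} [NormedAddCommGroup E'] [NormedSpace ℝ E']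
  {H' : Type*} [TopologicalSpace H'] (J : ModelWithCorners ℝ E' H')
  {𝒢 : Type u} [TopologicalSpace 𝒢] [ChartedSpace H' 𝒢] [Group 𝒢]

/-- `ι : G →* 𝒢` exhibits the subgroup `K` of the Lie group `𝒢` as an (immersed) Lie subgroup:
`G` is a (second countable, Hausdorff) Lie group and `ι` is an injective smooth immersion with
image `K`. -/
structure IsLieSubgroupVia (d : ℕ) {G : Type*} [Group G] [TopologicalSpace G]
    [ChartedSpace (EuclideanSpace ℝ (Fin d)) G] (ι : G →* 𝒢) (K : Subgroup 𝒢) : Prop where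
  lieGroup : LieGroup 𝓘(ℝ, EuclideanSpace ℝ (Fin d)) ∞ G
  t2 : T2Space G
  secondCountable : SecondCountableTopology G
  injective : Function.Injective ι
  smooth : ContMDiff 𝓘(ℝ, EuclideanSpace ℝ (Fin d)) J ∞ ι
  immersion : ∀ g, Function.Injective (mfderiv 𝓘(ℝ, EuclideanSpace ℝ (Fin d)) J ι g)
  range_eq : ι.range = K

/-- `K` is a connected Lie subgroup of the Lie group `𝒢`. -/
def IsConnectedLieSubgroup (K : Subgroup 𝒢) : Prop :=
  ∃ (d : ℕ) (G : Type u) (_ : Group G) (_ : TopologicalSpace G)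
    (_ : ChartedSpace (EuclideanSpace ℝ (Fin d)) G) (ι : G →* 𝒢),
    IsLieSubgroupVia J d ι K ∧ ConnectedSpace G

/-- `K` is a Lie subgroup of the Lie group `𝒢`, and `K₀` is the connected component of the identity
of `K`, with respect to the Lie group topology of `K`. -/
def IsLieSubgroupWithIdentityComponent (K K₀ : Subgroup 𝒢) : Prop :=
  ∃ (d : ℕ) (G : Type u) (_ : Group G) (_ : TopologicalSpace G)
    (_ : ChartedSpace (EuclideanSpace ℝ (Fin d)) G) (ι : G →* 𝒢),
    IsLieSubgroupVia J d ι K ∧ ι '' connectedComponent (1 : G) = K₀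

end LieSubgroup

end FlatTransport

end

open Set Bundle Manifold
open scoped ContDiff Topology

noncomputable section

set_option linter.unusedSectionVars false

namespace FlatTransport

/-! ### Linear differential equations with parameters -/

universe u

section LinearODE

variable {R : Type*} [NormedRing R] [NormedAlgebra ℝ R]

/-! Over a small chart ball the bundle is trivial and the connection is d + A for a smooth one-form
A with values in End F (`exists_isLocalForm`), so a field u is parallel along c exactly when u' =
-A(c')u. Existence and uniqueness for this linear equation, glued along a subdivision, give parallel
transport (`exists_tr`, `Tr.unique`), and the reversed path gives its inverse
(`exists_hasTransport`).

A homotopy is only continuous, so there is no transport along its intermediate curves. All homotopy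
statements therefore rest on one local-to-global principle, `mem_of_homotopic_refl`. Let N x ⊆ GL(V
x) be subgroups that are compatible with transport by conjugation, and call two piecewise smooth
paths congruent if their transports agree modulo N. If the transport along every small loop lies in
N, a ladder of small loops shows that piecewise smooth paths close to a common continuous path are
congruent (`PathCongruence.exists_nhds_related`). Since piecewise smooth paths are dense, the
continuous paths near which every piecewise smooth path is congruent to a given one form a clopen
set, and a homotopy is a connected family of paths (`PathCongruence.related_of_homotopic`).

For flatness, N is trivial. Let U_p be the frame with U_p(p) = 1 that is parallel along the rays
from p. If dA + A∧A = 0, then dU_p = -A U_p in all directions (`IsRadialFrame.fderiv_of_flat`), so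
transport around small loops is trivial. Conversely, trivial transport around triangles says U_p(z)
= U_y(z) U_p(y); differentiating in z at z = y gives dU_p = -A U_p, whose integrability condition is
the vanishing of the curvature (`isFlat_of_parallelTransport_eq_id`).

For the Lie group statements, N x consists of the elements of Hol⁰ joined to 1 by a smooth curve in
Hol⁰. A small loop can be shrunk to its base point by homotheties in a chart, and its transport
depends smoothly on the scale, by smooth dependence of linear equations on parameters
(`exists_linearODE_solution`). Hence every element of Hol⁰ is joined to 1 smoothly
(`restrictedHolSubgroup_le_smoothComponent`).

It remains to make a Lie group out of a matrix group K₀ with this property. The velocities at 1 of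
smooth curves in K₀ form a vector space 𝔨, and a product of curves with independent velocities gives
ψ : ℝ^d → K₀ with differential at 0 an isomorphism onto 𝔨. With a complement 𝔪 of 𝔨, the map (t, m)
↦ ψ(t)(1 + m) is a local diffeomorphism. A smooth curve in K₀ has its velocity at a in 𝔨a, and by a
dimension count this is the tangent space of the slice m = const; so the curve stays in its slice
(`exists_groupChart`). This replaces the theorem of Frobenius. Translates of ψ are charts of K₀ and
of every group K in which K₀ is normal. In Hol the subgroup Hol⁰ is then open and connected, and it
has countably many cosets because π₁ is countable (`exists_countable_cosets`).

Finally, transports along homotopic loops differ by an element of Hol⁰, and every homotopy class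
contains a piecewise smooth loop; this gives Φ (`exists_fundamentalGroup_hom`). -/

/-- The primitive vanishing at `a`, as an operator on continuous functions on `[a, b]`. -/
def primitiveCLM (R : Type*) [NormedRing R] [NormedAlgebra ℝ R] {a b : ℝ} (hab : a ≤ b) :
    C(Icc a b, R) →L[ℝ] C(Icc a b, R) :=
  LinearMap.mkContinuous
    { toFun := fun f => ⟨fun t => ∫ r in a..(t : ℝ), IccExtend hab f r,
        (intervalIntegral.continuous_primitive
          (fun _ _ => (f.continuous.Icc_extend' (h := hab)).intervalIntegrable _ _) a).comp
          continuous_subtype_val⟩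
      map_add' := fun f g => by
        ext t
        exact intervalIntegral.integral_add
          ((f.continuous.Icc_extend' (h := hab)).intervalIntegrable _ _)
          ((g.continuous.Icc_extend' (h := hab)).intervalIntegrable _ _)
      map_smul' := fun c f => by
        ext t
        exact intervalIntegral.integral_smul c _ } (b - a) fun f => by
      refine (ContinuousMap.norm_le _ (by have := sub_nonneg.2 hab; positivity)).2 fun t => ?_
      refine (intervalIntegral.norm_integral_le_of_norm_le_const (C := ‖f‖)
        fun r _ => f.norm_coe_le_norm _).trans ?_
      rw [mul_comm, abs_of_nonneg (sub_nonneg.2 t.2.1)]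
      exact mul_le_mul_of_nonneg_right (by linarith [t.2.2]) (norm_nonneg f)

theorem primitiveCLM_apply {a b : ℝ} (hab : a ≤ b) (f : C(Icc a b, R)) (t : Icc a b) :
    primitiveCLM R hab f t = ∫ r in a..(t : ℝ), IccExtend hab f r := rfl

/-- The exponential weight `exp (l (t - a))` on `[a, b]`. -/
def expWeight (R : Type*) [NormedRing R] [NormedAlgebra ℝ R] (a b l : ℝ) : C(Icc a b, R) :=
  ⟨fun t => algebraMap ℝ R (Real.exp (l * (t - a))), by fun_prop⟩

theorem expWeight_mul_neg (a b l : ℝ) : expWeight R a b l * expWeight R a b (-l) = 1 := by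
  ext t
  simp only [expWeight, ContinuousMap.mul_apply, ContinuousMap.coe_mk, ContinuousMap.one_apply]
  rw [← map_mul, ← Real.exp_add]
  simp

theorem expWeight_neg_mul (a b l : ℝ) : expWeight R a b (-l) * expWeight R a b l = 1 := by
  simpa using expWeight_mul_neg (R := R) a b (-l)

/-- Integrating exp(l(r - a)) gains a factor 1/l. After conjugation by this weight the Volterra
operator is a contraction for large l, whatever the length of the interval. -/
theorem norm_volterra_conj_le [CompleteSpace R] {a b l : ℝ} (hab : a ≤ b) (hl : 0 < l) (B f : C(Icc a b, R)) :
    ‖expWeight R a b (-l) * primitiveCLM R hab (B * (expWeight R a b l * f))‖ ≤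
      ‖B‖ / l * ‖f‖ := by
  refine (ContinuousMap.norm_le _ (by positivity)).2 fun t => ?_
  rw [ContinuousMap.mul_apply, primitiveCLM_apply]
  simp only [expWeight, ContinuousMap.coe_mk]
  rw [← Algebra.smul_def, norm_smul, Real.norm_of_nonneg (Real.exp_pos _).le]
  have hb : ‖∫ r in a..(t : ℝ), IccExtend hab (B * (expWeight R a b l * f)) r‖ ≤
      ∫ r in a..(t : ℝ), ‖B‖ * ‖f‖ * Real.exp (l * (r - a)) := by
    refine intervalIntegral.norm_integral_le_of_norm_le t.2.1 (.of_forall fun r hr => ?_)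
      (Continuous.intervalIntegrable (by fun_prop) _ _)
    have hr' : r ∈ Icc a b := ⟨hr.1.le, hr.2.trans t.2.2⟩
    rw [IccExtend_of_mem hab _ hr']
    simp only [expWeight, ContinuousMap.mul_apply, ContinuousMap.coe_mk]
    rw [← Algebra.smul_def, mul_smul_comm, norm_smul, Real.norm_of_nonneg (Real.exp_pos _).le,
      mul_comm]
    exact mul_le_mul_of_nonneg_right ((norm_mul_le _ _).trans
      (mul_le_mul (B.norm_coe_le_norm _) (f.norm_coe_le_norm _) (norm_nonneg _) (norm_nonneg _)))
      (Real.exp_pos _).le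
  have hi : ∫ r in a..(t : ℝ), ‖B‖ * ‖f‖ * Real.exp (l * (r - a)) =
      ‖B‖ * ‖f‖ * ((Real.exp (l * (t - a)) - 1) / l) := by
    rw [intervalIntegral.integral_const_mul]
    congr 1
    have hd : ∀ r ∈ uIcc a (t : ℝ),
        HasDerivAt (fun r => Real.exp (l * (r - a)) / l) (Real.exp (l * (r - a))) r := by
      intro r _
      have h1 : HasDerivAt (fun r : ℝ => l * (r - a)) (l * 1) r :=
        ((hasDerivAt_id r).sub_const a).const_mul l
      have h2 := (h1.exp).div_const l
      rwa [mul_one, mul_div_assoc, div_self hl.ne', mul_one] at h2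
    rw [intervalIntegral.integral_eq_sub_of_hasDerivAt hd
      (Continuous.intervalIntegrable (by fun_prop) _ _)]
    simp [sub_div]
  rw [hi] at hb
  refine (mul_le_mul_of_nonneg_left hb (Real.exp_pos _).le).trans ?_
  have he : Real.exp (-l * (t - a)) * Real.exp (l * (t - a)) = 1 := by
    rw [← Real.exp_add]; simp
  have : Real.exp (-l * (t - a)) * (‖B‖ * ‖f‖ * ((Real.exp (l * (t - a)) - 1) / l)) =
      ‖B‖ / l * ‖f‖ * (1 - Real.exp (-l * (t - a))) := by
    linear_combination (‖B‖ * ‖f‖ / l) * he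
  rw [this]
  exact mul_le_of_le_one_right (by positivity) (by linarith [Real.exp_pos (-l * (t - a))])

/-- The Volterra operator `f ↦ J (B f)` in a Banach algebra. -/
def volterra {X : Type*} [NormedRing X] [NormedAlgebra ℝ X] (J : X →L[ℝ] X) (B : X) : X →L[ℝ] X :=
  J.comp (ContinuousLinearMap.mul ℝ X B)

/-- Multiplications by `w` and `w'` are mutually inverse operators, so `1 - volterra J B` is
conjugate to an operator that the Neumann series inverts. -/
theorem isUnit_one_sub_volterra {X : Type*} [NormedRing X] [NormedAlgebra ℝ X] [CompleteSpace X]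
    (J : X →L[ℝ] X) (B w w' : X) (hw : w * w' = 1) (hw' : w' * w = 1) {c : ℝ} (hc : c < 1)
    (hc0 : 0 ≤ c) (h : ∀ f, ‖w' * J (B * (w * f))‖ ≤ c * ‖f‖) : IsUnit (1 - volterra J B) := by
  let D : X →L[ℝ] X := ContinuousLinearMap.mul ℝ X w
  let D' : X →L[ℝ] X := ContinuousLinearMap.mul ℝ X w'
  have h1 : D * D' = 1 := by
    ext1 f
    simp [D, D', ← mul_assoc, hw]
  have h2 : D' * D = 1 := by
    ext1 f
    simp [D, D', ← mul_assoc, hw']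
  let u : (X →L[ℝ] X)ˣ := ⟨D, D', h1, h2⟩
  have hK : ‖D' * volterra J B * D‖ < 1 :=
    (ContinuousLinearMap.opNorm_le_bound _ hc0 h).trans_lt hc
  have h3 : IsUnit (1 - D' * volterra J B * D) := isUnit_one_sub_of_norm_lt_one hK
  have h4 : (1 - volterra J B) = u * (1 - D' * volterra J B * D) * (u⁻¹ : _ˣ) := by
    change _ = D * (1 - D' * volterra J B * D) * D'
    rw [mul_sub, sub_mul, mul_one, h1]
    congr 1
    calc volterra J B = (D * D') * volterra J B * (D * D') := by rw [h1, one_mul, mul_one]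
      _ = _ := by simp only [mul_assoc]
  rw [h4]
  exact (u.isUnit.mul h3).mul (u⁻¹).isUnit

/-- Inversion is smooth on the units of a Banach algebra and the operator is affine in `B`. Smooth
dependence of solutions on the coefficient thus needs no estimate on difference quotients. -/
theorem contDiff_inverse_volterra {X : Type*} [NormedRing X] [NormedAlgebra ℝ X] [CompleteSpace X]
    (J : X →L[ℝ] X) (h : ∀ B, IsUnit (1 - volterra J B)) {n : ℕ∞ω} :
    ContDiff ℝ n fun B => Ring.inverse (1 - volterra J B) (1 : X) := by
  have h1 : ContDiff ℝ n (fun B : X => 1 - volterra J B) := by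
    refine contDiff_const.sub ?_
    exact (ContinuousLinearMap.contDiff (ContinuousLinearMap.compL ℝ X X X J)).comp
      (ContinuousLinearMap.contDiff (ContinuousLinearMap.mul ℝ X))
  rw [contDiff_iff_contDiffAt]
  intro B
  obtain ⟨u, hu⟩ := h B
  have h2 : ContDiffAt ℝ n Ring.inverse (1 - volterra J B) := by
    rw [← hu]; exact contDiffAt_ringInverse ℝ u
  exact (h2.comp B h1.contDiffAt).clm_apply contDiffAt_const

theorem isUnit_one_sub_volterra_primitiveCLM [CompleteSpace R] {a b : ℝ} (hab : a ≤ b) (B : C(Icc a b, R)) :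
    IsUnit (1 - volterra (primitiveCLM R hab) B) := by
  -- With this l the contraction constant ‖B‖ / l is less than one half.
  have hl : 0 < 2 * (‖B‖ + 1) := by positivity
  refine isUnit_one_sub_volterra _ B _ _ (expWeight_mul_neg a b _) (expWeight_neg_mul a b _) ?_ ?_
    (norm_volterra_conj_le hab hl B)
  · rw [div_lt_one hl]
    linarith [norm_nonneg B]
  · positivity

/-- The solution of `T' = B T`, `T a = 1`. -/
def volterraSol {a b : ℝ} (hab : a ≤ b) (B : C(Icc a b, R)) : C(Icc a b, R) :=
  Ring.inverse (1 - volterra (primitiveCLM R hab) B) 1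

theorem contDiff_volterraSol [CompleteSpace R] {a b : ℝ} (hab : a ≤ b) {n : ℕ∞ω} :
    ContDiff ℝ n (volterraSol (R := R) hab) :=
  contDiff_inverse_volterra _ (isUnit_one_sub_volterra_primitiveCLM hab)

theorem volterraSol_eq [CompleteSpace R] {a b : ℝ} (hab : a ≤ b) (B : C(Icc a b, R)) :
    volterraSol hab B = 1 + primitiveCLM R hab (B * volterraSol hab B) := by
  have h := Ring.mul_inverse_cancel _ (isUnit_one_sub_volterra_primitiveCLM hab B)
  have h2 := DFunLike.congr_fun h (1 : C(Icc a b, R))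
  have h3 : volterraSol hab B - volterra (primitiveCLM R hab) B (volterraSol hab B) = 1 := h2
  rw [← h3]
  simp [volterra]

theorem volterraSol_left [CompleteSpace R] {a b : ℝ} (hab : a ≤ b) (B : C(Icc a b, R)) :
    volterraSol hab B ⟨a, left_mem_Icc.2 hab⟩ = 1 := by
  rw [volterraSol_eq, ContinuousMap.add_apply, primitiveCLM_apply]
  simp

theorem hasDerivWithinAt_volterraSol [CompleteSpace R] {a b : ℝ} (hab : a ≤ b) (B : C(Icc a b, R)) (t : Icc a b) :
    HasDerivWithinAt (IccExtend hab (volterraSol hab B)) (B t * volterraSol hab B t) (Icc a b)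
      t := by
  have hc := (B * volterraSol hab B).continuous.Icc_extend' (h := hab)
  have h1 : HasDerivAt (fun s => 1 + ∫ r in a..s, IccExtend hab (B * volterraSol hab B) r)
      (IccExtend hab (B * volterraSol hab B) t) t :=
    (intervalIntegral.integral_hasDerivAt_right (hc.intervalIntegrable _ _)
      (hc.stronglyMeasurableAtFilter _ _) hc.continuousAt).const_add _
  rw [IccExtend_val] at h1
  refine h1.hasDerivWithinAt.congr_of_mem (fun s hs => ?_) t.2
  rw [IccExtend_of_mem hab _ hs]
  exact DFunLike.congr_fun (volterraSol_eq hab B) ⟨s, hs⟩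

/-- Compactness of `K` makes a jointly continuous family continuous for the sup norm. It bounds the
remainder of a first order expansion uniformly in `k`. -/
theorem eventually_forall_norm_sub_lt {K P Y : Type*} [TopologicalSpace K] [CompactSpace K]
    [NormedAddCommGroup P] [NormedAddCommGroup Y] {D : P → C(K, Y)}
    (hD : Continuous fun z : P × K => D z.1 z.2) {ε : ℝ} (hε : 0 < ε) (p : P) :
    ∀ᶠ p' in 𝓝 p, ∀ k, ‖D p' k - D p k‖ < ε := by
  have hDcont : Continuous D := ContinuousMap.continuous_of_continuous_uncurry D hD
  have h : Continuous fun p' => ‖D p' - D p‖ := (hDcont.sub continuous_const).norm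
  filter_upwards [(h.tendsto' p 0 (by simp)).eventually_lt_const hε] with p' hp' k
  exact (ContinuousMap.norm_coe_le_norm (D p' - D p) k).trans_lt hp'

set_option synthInstance.maxHeartbeats 200000 in
/-- A smooth family of continuous functions is a smooth function into the space of continuous
functions. -/
theorem hasFDerivAt_continuousMap_comp {K P Q W : Type*} [TopologicalSpace K] [CompactSpace K]
    [NormedAddCommGroup P] [NormedSpace ℝ P] [NormedAddCommGroup Q] [NormedSpace ℝ Q]
    [NormedAddCommGroup W] [NormedSpace ℝ W] (g : P × Q → W) (hg : ContDiff ℝ 1 g)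
    (q : C(K, Q)) (D : P → C(K, P →L[ℝ] W))
    (hD : ∀ p k, D p k = (fderiv ℝ g (p, q k)).comp (ContinuousLinearMap.inl ℝ P Q))
    (f : P → C(K, W)) (hf : ∀ p k, f p k = g (p, q k)) (p : P)
    (L : C(K, P →L[ℝ] W) →L[ℝ] P →L[ℝ] C(K, W)) (hL : ∀ d v k, L d v k = d k v) :
    HasFDerivAt f (L (D p)) p := by
  have hDc : Continuous fun z : P × K => D z.1 z.2 := by
    simp only [hD]
    have := hg.continuous_fderiv (by norm_num)
    exact (this.comp (continuous_fst.prodMk (q.continuous.comp continuous_snd))).clm_comp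
      continuous_const
  rw [hasFDerivAt_iff_isLittleO, Asymptotics.isLittleO_iff]
  intro ε hε
  have hunif := eventually_forall_norm_sub_lt hDc hε p
  obtain ⟨δ, hδ, hball⟩ := Metric.eventually_nhds_iff_ball.1 hunif
  filter_upwards [Metric.ball_mem_nhds p hδ] with p' hp'
  refine (ContinuousMap.norm_le _ (by positivity)).2 fun k => ?_
  have hder : ∀ x ∈ Metric.ball p δ,
      HasFDerivWithinAt (fun x => g (x, q k)) (D x k) (Metric.ball p δ) x := by
    intro x _
    rw [hD]
    have h1 : HasFDerivAt (fun x : P => (x, q k)) (ContinuousLinearMap.inl ℝ P Q) x :=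
      (hasFDerivAt_id x).prodMk (hasFDerivAt_const _ _)
    exact (((hg.differentiable (by norm_num)) (x, q k)).hasFDerivAt.comp x h1).hasFDerivWithinAt
  -- The mean value inequality is applied for each `k` separately, on a ball and with a bound that
  -- do not depend on `k`.
  have := (convex_ball p δ).norm_image_sub_le_of_norm_hasFDerivWithin_le' hder
    (fun x hx => (hball x hx k).le) (Metric.mem_ball_self hδ) hp'
  simpa [hf, hL] using this


set_option synthInstance.maxHeartbeats 200000 in
/-- Evaluation of a continuous family of operators, as an operator. -/
def continuousMapFlip (K P W : Type*) [TopologicalSpace K] [CompactSpace K]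
    [NormedAddCommGroup P] [NormedSpace ℝ P] [NormedAddCommGroup W] [NormedSpace ℝ W] :
    C(K, P →L[ℝ] W) →L[ℝ] P →L[ℝ] C(K, W) :=
  LinearMap.mkContinuous₂ (LinearMap.mk₂ ℝ
    (fun (d : C(K, P →L[ℝ] W)) v => (⟨fun k => d k v, by fun_prop⟩ : C(K, W)))
    (fun _ _ _ => rfl) (fun _ _ _ => rfl) (fun d _ _ => by ext k; exact (d k).map_add _ _)
    (fun c d _ => by ext k; exact (d k).map_smul _ _)) 1 fun d v => by
      rw [one_mul]
      exact (ContinuousMap.norm_le _ (by positivity)).2 fun k =>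
        (d k).le_of_opNorm_le (d.norm_coe_le_norm k) v

set_option synthInstance.maxHeartbeats 200000 in
-- The derivative in the parameter is a family of the same kind, with g replaced by its partial
-- differential. The induction therefore ranges over all targets `W`, which is why `P` and `W` share
-- a universe.
theorem contDiff_continuousMap_comp {K : Type*} {P Q : Type u} [TopologicalSpace K]
    [CompactSpace K] [NormedAddCommGroup P] [NormedSpace ℝ P] [NormedAddCommGroup Q]
    [NormedSpace ℝ Q] (q : C(K, Q)) (n : ℕ) : ∀ {W : Type u} [NormedAddCommGroup W]
    [NormedSpace ℝ W] (g : P × Q → W) (_ : ContDiff ℝ ∞ g) (f : P → C(K, W))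
    (_ : ∀ p k, f p k = g (p, q k)), ContDiff ℝ n f := by
  induction n with
  | zero =>
    intro W _ _ g hg f hf
    refine contDiff_zero.2 (ContinuousMap.continuous_of_continuous_uncurry f ?_)
    change Continuous fun z : P × K => f z.1 z.2
    simp only [hf]
    exact hg.continuous.comp (continuous_fst.prodMk (q.continuous.comp continuous_snd))
  | succ n ih =>
    intro W _ _ g hg f hf
    let g' : P × Q → P →L[ℝ] W := fun z =>
      (fderiv ℝ g z).comp (ContinuousLinearMap.inl ℝ P Q)
    have hg' : ContDiff ℝ ∞ g' :=
      (hg.fderiv_right (m := ∞) (by simp)).clm_comp contDiff_const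
    let D : P → C(K, P →L[ℝ] W) := fun p =>
      ⟨fun k => g' (p, q k), hg'.continuous.comp (continuous_const.prodMk q.continuous)⟩
    have hd := fun p => hasFDerivAt_continuousMap_comp g (hg.of_le (by simp)) q D
      (fun _ _ => rfl) f hf p (continuousMapFlip K P W) fun _ _ _ => rfl
    push_cast
    refine (contDiff_succ_iff_hasFDerivAt (n := n)).2 ⟨_, ?_, hd⟩
    exact (continuousMapFlip K P W).contDiff.comp (ih g' hg' D fun _ _ => rfl)

/-- Linear differential equations with coefficients depending smoothly on a parameter. -/
theorem exists_linearODE_solution {P Q R : Type u} [NormedAddCommGroup P] [NormedSpace ℝ P]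
    [NormedAddCommGroup Q] [NormedSpace ℝ Q] [NormedRing R] [NormedAlgebra ℝ R] [CompleteSpace R]
    {a b : ℝ} (hab : a ≤ b) {q : ℝ → Q} (hq : ContinuousOn q (Icc a b)) {g : P × Q → R}
    (hg : ContDiff ℝ ∞ g) :
    ∃ T : P → ℝ → R, (∀ t ∈ Icc a b, ContDiff ℝ ∞ fun p => T p t) ∧ (∀ p, T p a = 1) ∧
      ∀ p, ∀ t ∈ Icc a b, HasDerivWithinAt (T p) (g (p, q t) * T p t) (Icc a b) t := by
  let q' : C(Icc a b, Q) := ⟨fun t => q t, hq.domRestrict⟩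
  let B : P → C(Icc a b, R) := fun p =>
    ⟨fun k => g (p, q' k), hg.continuous.comp (continuous_const.prodMk q'.continuous)⟩
  have hB : ContDiff ℝ ∞ B :=
    contDiff_infty.2 fun n => contDiff_continuousMap_comp q' n g hg B fun _ _ => rfl
  refine ⟨fun p => IccExtend hab (volterraSol hab (B p)), fun t ht => ?_, fun p => ?_,
    fun p t ht => ?_⟩
  · simp only [IccExtend_of_mem hab _ ht]
    exact (ContinuousMap.evalCLM ℝ (⟨t, ht⟩ : Icc a b)).contDiff.comp
      ((contDiff_volterraSol hab).comp hB)
  · exact (IccExtend_of_mem hab _ (left_mem_Icc.2 hab)).trans (volterraSol_left hab _)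
  · have := hasDerivWithinAt_volterraSol hab (B p) ⟨t, ht⟩
    rwa [← IccExtend_of_mem hab (volterraSol hab (B p)) ht] at this

/-- The coefficients are bounded on the compact interval, so the equation is uniformly Lipschitz. -/
theorem linearODE_unique {F : Type*} [NormedAddCommGroup F] [NormedSpace ℝ F] {a b : ℝ}
    {B : ℝ → F →L[ℝ] F} (hB : ContinuousOn B (Icc a b)) {f g : ℝ → F}
    (hf : ∀ t ∈ Icc a b, HasDerivWithinAt f (B t (f t)) (Icc a b) t)
    (hg : ∀ t ∈ Icc a b, HasDerivWithinAt g (B t (g t)) (Icc a b) t) (ha : f a = g a) :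
    EqOn f g (Icc a b) := by
  obtain ⟨C, hC⟩ := isCompact_Icc.exists_bound_of_continuousOn hB
  have h : ∀ {f : ℝ → F}, (∀ t ∈ Icc a b, HasDerivWithinAt f (B t (f t)) (Icc a b) t) →
      ∀ t ∈ Ico a b, HasDerivWithinAt f (B t (f t)) (Ici t) t := fun hf t ht =>
    (hf t ⟨ht.1, ht.2.le⟩).mono_of_mem_nhdsWithin
      (Filter.mem_of_superset (Icc_mem_nhdsGE ht.2) (Icc_subset_Icc_left ht.1))
  refine ODE_solution_unique_of_mem_Icc_right (v := fun t x => B t x) (s := fun _ => univ)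
    (K := C.toNNReal) (fun t ht => ?_) (fun t ht => (hf t ht).continuousWithinAt) (h hf)
    (fun _ _ => mem_univ _) (fun t ht => (hg t ht).continuousWithinAt) (h hg)
    (fun _ _ => mem_univ _) ha
  refine ((B t).lipschitz.weaken ?_).lipschitzOnWith
  rw [← NNReal.coe_le_coe]
  exact (hC t ⟨ht.1, ht.2.le⟩).trans (Real.le_coe_toNNReal C)

/-- Bootstrapping: the equation makes the derivative as regular as the solution itself. -/
theorem contDiffOn_of_linearODE {F : Type*} [NormedAddCommGroup F] [NormedSpace ℝ F] {a b : ℝ}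
    (hab : a < b) {B : ℝ → F →L[ℝ] F} (hB : ContDiffOn ℝ ∞ B (Icc a b)) {f : ℝ → F}
    (hf : ∀ t ∈ Icc a b, HasDerivWithinAt f (B t (f t)) (Icc a b) t) :
    ContDiffOn ℝ ∞ f (Icc a b) := by
  have hu := uniqueDiffOn_Icc hab
  have hd : EqOn (derivWithin f (Icc a b)) (fun t => B t (f t)) (Icc a b) :=
    fun t ht => (hf t ht).derivWithin (hu t ht)
  refine contDiffOn_infty.2 fun n => ?_
  induction n with
  | zero => exact contDiffOn_zero.2 fun t ht => (hf t ht).continuousWithinAt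
  | succ n ih =>
    push_cast
    refine (contDiffOn_succ_iff_derivWithin hu).2
      ⟨fun t ht => (hf t ht).differentiableWithinAt, by simp, ?_⟩
    exact ((hB.of_le (by exact_mod_cast le_top)).clm_apply ih).congr hd

end LinearODE

/-! ### Connection forms on a vector space -/

section ConnectionForm

variable {E F : Type} [NormedAddCommGroup E] [NormedSpace ℝ E]
  [NormedAddCommGroup F] [NormedSpace ℝ F]

/-- `u` is parallel along `c` on `[a, b]` with respect to the connection form `A`. -/
def FormParallel (A : E → E →L[ℝ] F →L[ℝ] F) (c : ℝ → E) (u : ℝ → F) (a b : ℝ) : Prop :=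
  ∀ t ∈ Icc a b,
    HasDerivWithinAt u ((-(A (c t) (derivWithin c (Icc a b) t))) (u t)) (Icc a b) t

variable {A : E → E →L[ℝ] F →L[ℝ] F} {c : ℝ → E} {a b : ℝ}

theorem contDiffOn_form_apply_derivWithin (hA : ContDiff ℝ ∞ A) (hab : a < b)
    (hc : ContDiffOn ℝ ∞ c (Icc a b)) :
    ContDiffOn ℝ ∞ (fun t => -(A (c t) (derivWithin c (Icc a b) t))) (Icc a b) :=
  ((hA.comp_contDiffOn hc).clm_apply
    ((contDiffOn_infty_iff_derivWithin (uniqueDiffOn_Icc hab)).1 hc).2).neg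

theorem FormParallel.eqOn (hA : ContDiff ℝ ∞ A) (hab : a < b)
    (hc : ContDiffOn ℝ ∞ c (Icc a b)) {u v : ℝ → F} (hu : FormParallel A c u a b)
    (hv : FormParallel A c v a b) (h : u a = v a) : EqOn u v (Icc a b) :=
  linearODE_unique (contDiffOn_form_apply_derivWithin hA hab hc).continuousOn hu hv h

theorem FormParallel.contDiffOn (hA : ContDiff ℝ ∞ A) (hab : a < b)
    (hc : ContDiffOn ℝ ∞ c (Icc a b)) {u : ℝ → F} (hu : FormParallel A c u a b) :
    ContDiffOn ℝ ∞ u (Icc a b) :=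
  contDiffOn_of_linearODE hab (contDiffOn_form_apply_derivWithin hA hab hc) hu

variable [CompleteSpace F]

/-- Transport along the homotheties `p + s (c - p)` of a curve depends smoothly on `s`. -/
theorem exists_contDiff_scaled_transport (hA : ContDiff ℝ ∞ A) (hab : a < b)
    (hc : ContDiffOn ℝ ∞ c (Icc a b)) (p : E) :
    ∃ T : ℝ → F →L[ℝ] F, ContDiff ℝ ∞ T ∧ ∀ s v, ∃ u : ℝ → F, u a = v ∧ u b = T s v ∧
      FormParallel A (fun t => p + s • (c t - p)) u a b := by
  have hu := uniqueDiffOn_Icc hab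
  have hc' := ((contDiffOn_infty_iff_derivWithin hu).1 hc).2
  have hg : ContDiff ℝ ∞ fun z : ℝ × (E × E) => -(A (p + z.1 • (z.2.1 - p)) (z.1 • z.2.2)) := by
    refine ContDiff.neg (ContDiff.clm_apply (hA.comp ?_) ?_) <;> fun_prop
  -- The scale is the parameter, and c enters only through the pair (c, c'), which need only be
  -- continuous in time.
  obtain ⟨T, hT1, hT2, hT3⟩ := exists_linearODE_solution hab.le
    (q := fun t => (c t, derivWithin c (Icc a b) t))
    (hc.continuousOn.prodMk hc'.continuousOn) hg
  refine ⟨fun s => T s b, hT1 b (right_mem_Icc.2 hab.le), fun s v =>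
    ⟨fun t => T s t v, by simp [hT2], rfl, fun t ht => ?_⟩⟩
  have h1 : derivWithin (fun t => p + s • (c t - p)) (Icc a b) t =
      s • derivWithin c (Icc a b) t := by
    refine HasDerivWithinAt.derivWithin ?_ (hu t ht)
    have := ((hc.differentiableOn (by simp)) t ht).hasDerivWithinAt
    exact ((this.sub_const p).const_smul s).const_add p
  rw [h1]
  simpa using (hT3 s t ht).clm_apply (hasDerivWithinAt_const t _ v)

end ConnectionForm

/-! ### Radial frames and the curvature of a connection form -/

section Curvature

variable {E R : Type} [NormedAddCommGroup E] [NormedSpace ℝ E] [NormedRing R] [NormedAlgebra ℝ R]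
  {A : E → E →L[ℝ] R}

/-- `U` is parallel along the rays from `p`. -/
def IsRadialFrame (A : E → E →L[ℝ] R) (p : E) (U : E → R) : Prop :=
  ContDiff ℝ ∞ U ∧ U p = 1 ∧ ∀ x, ∀ t ∈ Icc (0 : ℝ) 1,
    HasDerivWithinAt (fun t : ℝ => U (p + t • (x - p)))
      (-(A (p + t • (x - p)) (x - p)) * U (p + t • (x - p))) (Icc 0 1) t

/-- Solve the equation along the ray to `x` with `x` as a parameter and take the value at time 1. By
uniqueness, the solution for the shorter ray to p + t(x - p) is the one for `x` with rescaled time,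
so these values fit together along rays. -/
theorem exists_isRadialFrame [CompleteSpace R] (hA : ContDiff ℝ ∞ A) (p : E) :
    ∃ U : E → R, IsRadialFrame A p U := by
  have hg : ContDiff ℝ ∞ fun z : E × ℝ => -(A (p + z.2 • (z.1 - p)) (z.1 - p)) := by
    refine ContDiff.neg (ContDiff.clm_apply (hA.comp ?_) ?_) <;> fun_prop
  obtain ⟨T, hT1, hT2, hT3⟩ := exists_linearODE_solution (zero_le_one' ℝ)
    (q := fun t => t) continuousOn_id hg
  have key : ∀ x, ∀ t ∈ Icc (0 : ℝ) 1, T (p + t • (x - p)) 1 = T x t := by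
    intro x t ht
    have hB : ContinuousOn (fun r : ℝ => ContinuousLinearMap.mul ℝ R
        (-(A (p + r • (p + t • (x - p) - p)) (p + t • (x - p) - p)))) (Icc 0 1) := by
      refine Continuous.continuousOn ?_
      refine (ContinuousLinearMap.continuous _).comp (Continuous.neg (Continuous.clm_apply
        (hA.continuous.comp ?_) continuous_const))
      fun_prop
    have := linearODE_unique hB (f := T (p + t • (x - p))) (g := fun r => T x (r * t))
      (fun r hr => hT3 _ r hr) (fun r hr => ?_) (by simp [hT2])
      (right_mem_Icc.2 zero_le_one)
    · simpa using this
    · have hrt : ∀ r ∈ Icc (0 : ℝ) 1, r * t ∈ Icc (0 : ℝ) 1 := fun r hr =>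
        ⟨mul_nonneg hr.1 ht.1, mul_le_one₀ hr.2 ht.1 ht.2⟩
      have h1 := (hT3 x (r * t) (hrt r hr)).scomp r
        ((hasDerivWithinAt_id r (Icc 0 1)).mul_const t) hrt
      convert! h1 using 1
      simp [smul_smul, -map_sub]
  refine ⟨fun x => T x 1, hT1 1 (right_mem_Icc.2 zero_le_one), ?_, fun x t ht => ?_⟩
  · simpa [hT2] using key p 0 (left_mem_Icc.2 zero_le_one)
  · have := hT3 x t ht
    rw [← key x t ht] at this
    exact this.congr (fun r hr => key x r hr) (key x t ht)

/-- The curvature form of a connection form. -/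
def formCurvature (A : E → E →L[ℝ] R) (x v w : E) : R :=
  fderiv ℝ A x v w - fderiv ℝ A x w v + (A x v * A x w - A x w * A x v)

theorem hasDerivAt_ray (p x : E) (t : ℝ) : HasDerivAt (fun t : ℝ => p + t • x) x t := by
  simpa using ((hasDerivAt_id t).smul_const x).const_add p

theorem IsRadialFrame.fderiv_ray {p : E} {U : E → R} (hU : IsRadialFrame A p U) (x : E) {t : ℝ}
    (ht : t ∈ Icc (0 : ℝ) 1) : fderiv ℝ U (p + t • (x - p)) (x - p) =
      -(A (p + t • (x - p)) (x - p)) * U (p + t • (x - p)) :=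
  (uniqueDiffOn_Icc zero_lt_one t ht).eq_deriv _
    ((((hU.1.differentiable (by simp)) (p + t • (x - p))).hasFDerivAt.comp_hasDerivAt t
      (hasDerivAt_ray p (x - p) t)).hasDerivWithinAt) (hU.2.2 x t ht)

theorem IsRadialFrame.fderiv_center {p : E} {U : E → R} (hU : IsRadialFrame A p U) (v : E) :
    fderiv ℝ U p v = -(A p v) := by
  simpa [hU.2.1] using hU.fderiv_ray (p + v) (left_mem_Icc.2 zero_le_one)

theorem IsRadialFrame.fderiv_radial {p : E} {U : E → R} (hU : IsRadialFrame A p U) (x : E) :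
    fderiv ℝ U x (x - p) = -(A x (x - p)) * U x := by
  simpa using hU.fderiv_ray x (right_mem_Icc.2 zero_le_one)

theorem ContDiff.hasFDerivAt_fderiv_apply {W : Type*} [NormedAddCommGroup W] [NormedSpace ℝ W]
    {U : E → W} (hU : ContDiff ℝ ∞ U) (w p : E) :
    HasFDerivAt (fun y => fderiv ℝ U y w) ((fderiv ℝ (fderiv ℝ U) p).flip w) p := by
  have := ((hU.fderiv_right (m := ∞) (by simp)).differentiable
    (by simp) p).hasFDerivAt.clm_apply (hasFDerivAt_const w p)
  simpa using this

theorem ContDiff.hasFDerivAt_clm_apply {W : Type*} [NormedAddCommGroup W] [NormedSpace ℝ W]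
    {A : E → E →L[ℝ] W} (hA : ContDiff ℝ ∞ A) (w p : E) :
    HasFDerivAt (fun y => A y w) ((fderiv ℝ A p).flip w) p := by
  have := (hA.differentiable (by simp) p).hasFDerivAt.clm_apply (hasFDerivAt_const w p)
  simpa using this

theorem fderiv_fderiv_symm {W : Type*} [NormedAddCommGroup W] [NormedSpace ℝ W]
    {U : E → W} (hU : ContDiff ℝ ∞ U) (p v w : E) :
    fderiv ℝ (fderiv ℝ U) p v w = fderiv ℝ (fderiv ℝ U) p w v :=
  (hU.contDiffAt.isSymmSndFDerivAt
    (by simpa using (mod_cast le_top : ((2 : ℕ∞) : ℕ∞ω) ≤ ∞))).eq v w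

/-- The integrability condition of dU = -A U: differentiate once more at p, where U = 1, and use the
symmetry of the second derivative. -/
theorem formCurvature_eq_zero_of_frame (hA : ContDiff ℝ ∞ A) {p : E} {U : E → R}
    (hU : ContDiff ℝ ∞ U) (hp : U p = 1)
    (h : ∀ᶠ y in 𝓝 p, ∀ w, fderiv ℝ U y w = -(A y w) * U y) (v w : E) :
    formCurvature A p v w = 0 := by
  have hd : ∀ v w, fderiv ℝ (fderiv ℝ U) p v w = A p w * A p v - fderiv ℝ A p v w := by
    intro v w
    have h2 := (ContDiff.hasFDerivAt_clm_apply hA w p).neg.mul'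
      (hU.differentiable (by simp) p).hasFDerivAt
    have h3 := (ContDiff.hasFDerivAt_fderiv_apply hU w p).unique
      (h2.congr_of_eventuallyEq (h.mono fun y hy => hy w))
    have h4 := DFunLike.congr_fun h3 v
    have h5 : fderiv ℝ U p v = -(A p v) := by
      rw [h.self_of_nhds v, hp, mul_one]
    simp only [ContinuousLinearMap.flip_apply, Pi.neg_apply, add_apply,
      smul_apply, h5, hp, smul_eq_mul, neg_apply,
      MulOpposite.op_one, one_smul, neg_mul_neg] at h4
    rw [h4]
    abel
  have hs := fderiv_fderiv_symm hU p v w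
  rw [hd, hd, ← sub_eq_zero] at hs
  rw [formCurvature, ← neg_eq_zero, ← hs]
  abel

/-- Varying the end point of a ray in direction v moves its point at time t by tv. The covariant
derivative of U in this direction, t(dU(v) + A(v)U), would satisfy the radial equation up to a
curvature term; when that term vanishes it is a solution starting at 0, hence zero. -/
theorem IsRadialFrame.fderiv_of_flat (hA : ContDiff ℝ ∞ A) {p : E} {U : E → R}
    (hU : IsRadialFrame A p U) {x : E}
    (h0 : ∀ t ∈ Icc (0 : ℝ) 1, ∀ v w, formCurvature A (p + t • (x - p)) v w = 0) (v : E) :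
    fderiv ℝ U x v = -(A x v) * U x := by
  set ξ := x - p with hξ
  have hW : ∀ t ∈ Icc (0 : ℝ) 1, HasDerivWithinAt
      (fun t : ℝ => t • (fderiv ℝ U (p + t • ξ) v + A (p + t • ξ) v * U (p + t • ξ)))
      (ContinuousLinearMap.mul ℝ R (-(A (p + t • ξ) ξ))
        (t • (fderiv ℝ U (p + t • ξ) v + A (p + t • ξ) v * U (p + t • ξ)))) (Icc 0 1) t := by
    intro t ht
    set y := p + t • ξ with hy
    have d0 := hasDerivAt_ray p ξ t
    have d1 := (ContDiff.hasFDerivAt_fderiv_apply hU.1 v y).comp_hasDerivAt t d0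
    have d2 := (ContDiff.hasFDerivAt_clm_apply hA v y).comp_hasDerivAt t d0
    have d3 := ((hU.1.differentiable (by simp)) y).hasFDerivAt.comp_hasDerivAt t d0
    have d4 := ((hasDerivAt_id t).smul (d1.add (d2.mul d3))).hasDerivWithinAt (s := Icc (0 : ℝ) 1)
    have r1 : HasFDerivAt (fun z => z - p) (ContinuousLinearMap.id ℝ E) y :=
      (hasFDerivAt_id y).sub_const p
    have r2 := ((hU.1.fderiv_right (m := ∞) (by simp)).differentiable
      (by simp) y).hasFDerivAt.clm_apply r1
    have r3 := ((hA.differentiable (by simp) y).hasFDerivAt.clm_apply r1).mul'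
      ((hU.1.differentiable (by simp)) y).hasFDerivAt
    -- The radial equation is an identity in the end point z, so it may be differentiated in the
    -- direction v.
    have r4 := (r2.add r3).congr_of_eventuallyEq (f₁ := fun _ => (0 : R))
      (.of_forall fun z => by
        change 0 = fderiv ℝ U z (z - p) + A z (z - p) * U z
        rw [hU.fderiv_radial z]; noncomm_ring)
    have r5 := DFunLike.congr_fun (r4.unique (hasFDerivAt_const 0 y)) v
    have hyp : y - p = t • ξ := by simp [hy]
    have r6 := hU.fderiv_ray x ht
    rw [← hξ, ← hy] at r6
    have r7 := h0 t ht ξ v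
    rw [← hy, formCurvature] at r7
    simp only [hyp, add_apply, ContinuousLinearMap.comp_apply,
      ContinuousLinearMap.flip_apply, ContinuousLinearMap.id_apply, smul_apply,
      zero_apply, map_smul, smul_eq_mul, MulOpposite.smul_eq_mul_unop,
      MulOpposite.unop_op] at r5
    convert! d4 using 1
    simp only [ContinuousLinearMap.mul_apply', ContinuousLinearMap.flip_apply,
      Function.comp_apply, id, one_smul, ← hy, r6]
    rw [fderiv_fderiv_symm hU.1 y ξ v]
    change _ = _ + (fderiv ℝ U y v + A y v * U y)
    generalize fderiv ℝ (fderiv ℝ U) y v ξ = a at *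
    generalize fderiv ℝ U y v = b at *
    generalize fderiv ℝ A y ξ v = c at *
    generalize fderiv ℝ A y v ξ = d at *
    generalize A y ξ = e at *
    generalize A y v = f at *
    generalize U y = u at *
    rw [← sub_eq_zero]
    -- The two sides differ by the differentiated radial equation and t times the curvature F(ξ, v)
    -- applied to U.
    have h : -e * t • (b + f * u) - (t • (a + (c * u + f * (-e * u))) + (b + f * u)) =
        -(b + t • a + (t • e * b + (f + t • d) * u)) - t • ((c - d + (e * f - f * e)) * u) := by
      simp only [mul_add, add_mul, sub_mul, smul_add, smul_sub, neg_mul, mul_neg, smul_neg,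
        smul_mul_assoc, mul_smul_comm, mul_assoc]
      abel
    rw [h, r5, r7]
    simp
  have hB : ContinuousOn (fun t : ℝ => ContinuousLinearMap.mul ℝ R (-(A (p + t • ξ) ξ)))
      (Icc 0 1) := by
    refine Continuous.continuousOn ?_
    refine (ContinuousLinearMap.continuous _).comp (Continuous.neg (Continuous.clm_apply
      (hA.continuous.comp ?_) continuous_const))
    fun_prop
  have h1 := linearODE_unique hB hW (g := fun _ => 0)
    (fun t _ => by simpa using hasDerivWithinAt_const t _ (0 : R)) (by simp)
    (right_mem_Icc.2 zero_le_one)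
  simp only [one_smul, hξ, add_sub_cancel] at h1
  rw [neg_mul]
  exact eq_neg_of_add_eq_zero_left h1

end Curvature

/-! ### Connection forms of a connection in chart balls -/

section LocalForm

variable {E F : Type} [NormedAddCommGroup E] [NormedSpace ℝ E]
  [NormedAddCommGroup F] [NormedSpace ℝ F] [FiniteDimensional ℝ F]
  {M : Type*} [TopologicalSpace M] [ChartedSpace E M]
  [IsManifold 𝓘(ℝ, E) ∞ M]
  {V : M → Type*} [TopologicalSpace (TotalSpace F V)]
  [∀ x, AddCommGroup (V x)] [∀ x, Module ℝ (V x)] [∀ x, TopologicalSpace (V x)]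
  [∀ x, IsTopologicalAddGroup (V x)] [∀ x, ContinuousSMul ℝ (V x)]
  [FiberBundle F V] [VectorBundle ℝ F V] [ContMDiffVectorBundle ∞ F V 𝓘(ℝ, E)]

/-- The trivial connection of a local trivialization. -/
def trivCov (e : Trivialization F (TotalSpace.proj : TotalSpace F V → M))
    [MemTrivializationAtlas e] (σ : Π x, V x) (x : M) : TangentSpace 𝓘(ℝ, E) x →L[ℝ] V x :=
  (e.symmL ℝ x).comp (mvfderiv 𝓘(ℝ, E) (fun y => (e ⟨y, σ y⟩).2) x)

instance contMDiffVectorBundle_one : ContMDiffVectorBundle 1 F V 𝓘(ℝ, E) :=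
  .of_le (n := ∞) (by simp)

theorem isCovariantDerivativeOn_trivCov
    (e : Trivialization F (TotalSpace.proj : TotalSpace F V → M)) [MemTrivializationAtlas e] :
    IsCovariantDerivativeOn (I := 𝓘(ℝ, E)) F (trivCov e) e.baseSet where
  add {σ σ' x} hσ hσ' hx := by
    rw [e.mdifferentiableAt_section_iff 𝓘(ℝ, E) _ hx] at hσ hσ'
    have h : (fun y => (e ⟨y, (σ + σ') y⟩).2) =ᶠ[𝓝 x]
        (fun y => (e ⟨y, σ y⟩).2) + (fun y => (e ⟨y, σ' y⟩).2) := by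
      filter_upwards [e.open_baseSet.mem_nhds hx] with y hy
      exact (e.linear ℝ hy).map_add _ _
    have h2 : mvfderiv 𝓘(ℝ, E) (fun y => (e ⟨y, (σ + σ') y⟩).2) x =
        mvfderiv 𝓘(ℝ, E) (fun y => (e ⟨y, σ y⟩).2) x +
        mvfderiv 𝓘(ℝ, E) (fun y => (e ⟨y, σ' y⟩).2) x := by
      rw [← mvfderiv_add hσ hσ']
      ext X
      simp only [mvfderiv, h.mfderiv_eq]
      rfl
    rw [trivCov, h2, ContinuousLinearMap.comp_add]
    rfl
  leibniz {σ g x} hσ hg hx := by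
    have hσ' := hσ
    rw [e.mdifferentiableAt_section_iff 𝓘(ℝ, E) _ hx] at hσ
    have h : (fun y => (e ⟨y, (g • σ) y⟩).2) =ᶠ[𝓝 x]
        (g • fun y => (e ⟨y, σ y⟩).2) := by
      filter_upwards [e.open_baseSet.mem_nhds hx] with y hy
      exact (e.linear ℝ hy).map_smul _ _
    have h2 : mvfderiv 𝓘(ℝ, E) (fun y => (e ⟨y, (g • σ) y⟩).2) x =
        g x • mvfderiv 𝓘(ℝ, E) (fun y => (e ⟨y, σ y⟩).2) x +
        (mvfderiv 𝓘(ℝ, E) g x).smulRight (e ⟨x, σ x⟩).2 := by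
      rw [← mvfderiv_smul hg hσ]
      ext X
      simp only [mvfderiv, h.mfderiv_eq]
      rfl
    ext X
    have h3 := e.symmL_continuousLinearMapAt (R := ℝ) hx (σ x)
    rw [e.continuousLinearMapAt_apply_of_mem ℝ hx] at h3
    have h4 := congrArg (fun L => e.symmL ℝ x (L X)) h2
    simp only [add_apply, smul_apply, map_add, map_smul, ContinuousLinearMap.smulRight_apply,
      h3] at h4
    exact h4

theorem mdifferentiableAt_frame (e : Trivialization F (TotalSpace.proj : TotalSpace F V → M))
    [MemTrivializationAtlas e] {x : M} (hx : x ∈ e.baseSet) (f : F) :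
    MDifferentiableAt 𝓘(ℝ, E) (𝓘(ℝ, E).prod 𝓘(ℝ, F))
      (fun y => (⟨y, e.symm y f⟩ : TotalSpace F V)) x := by
  rw [e.mdifferentiableAt_section_iff 𝓘(ℝ, E) _ hx]
  refine (mdifferentiableAt_const (c := f)).congr_of_eventuallyEq ?_
  filter_upwards [e.open_baseSet.mem_nhds hx] with y hy
  simp [e.apply_mk_symm hy]

theorem trivCov_frame (e : Trivialization F (TotalSpace.proj : TotalSpace F V → M))
    [MemTrivializationAtlas e] {x : M} (hx : x ∈ e.baseSet) (f : F) :
    trivCov (E := E) e (fun y => e.symm y f) x = 0 := by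
  have h : (fun y => (e ⟨y, e.symm y f⟩).2) =ᶠ[𝓝 x] (fun _ => f) := by
    filter_upwards [e.open_baseSet.mem_nhds hx] with y hy
    simp [e.apply_mk_symm hy]
  have h2 : mvfderiv 𝓘(ℝ, E) (fun y => (e ⟨y, e.symm y f⟩).2) x = 0 := by
    rw [mvfderiv, h.mfderiv_eq, mfderiv_const]
    exact ContinuousLinearMap.comp_zero _
  rw [trivCov, h2, ContinuousLinearMap.comp_zero]

/-- The difference between a connection and the trivial connection of a trivialization. -/
def connDiff (cov : CovariantDerivative 𝓘(ℝ, E) F V)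
    (e : Trivialization F (TotalSpace.proj : TotalSpace F V → M)) [MemTrivializationAtlas e]
    (x : M) : V x →L[ℝ] TangentSpace 𝓘(ℝ, E) x →L[ℝ] V x :=
  (cov.isCovariantDerivativeOn (s := e.baseSet)).difference (isCovariantDerivativeOn_trivCov e) x

theorem connDiff_apply (cov : CovariantDerivative 𝓘(ℝ, E) F V)
    (e : Trivialization F (TotalSpace.proj : TotalSpace F V → M)) [MemTrivializationAtlas e]
    {x : M} (hx : x ∈ e.baseSet) {σ : Π x, V x}
    (hσ : MDifferentiableAt 𝓘(ℝ, E) (𝓘(ℝ, E).prod 𝓘(ℝ, F))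
      (fun y => (⟨y, σ y⟩ : TotalSpace F V)) x) :
    connDiff cov e x (σ x) = cov σ x - trivCov e σ x :=
  IsCovariantDerivativeOn.difference_apply _ _ hx hσ

/-- The trivial connection kills the sections with constant coefficients, so their derivative is the
tensorial difference; in particular it is linear in `f`. -/
theorem cov_frame (cov : CovariantDerivative 𝓘(ℝ, E) F V)
    (e : Trivialization F (TotalSpace.proj : TotalSpace F V → M)) [MemTrivializationAtlas e]
    {x : M} (hx : x ∈ e.baseSet) (f : F) :
    cov (fun y => e.symm y f) x = connDiff cov e x (e.symm x f) := by
  have := connDiff_apply cov e hx (mdifferentiableAt_frame e hx f)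
  rw [trivCov_frame e hx, sub_zero] at this
  exact this.symm

/-- The difference from the trivial connection sees only the value of σ at `x`, so it can be
evaluated on the section with coefficients frozen at `x`. -/
theorem trivialization_cov (cov : CovariantDerivative 𝓘(ℝ, E) F V)
    (e : Trivialization F (TotalSpace.proj : TotalSpace F V → M)) [MemTrivializationAtlas e]
    {x : M} (hx : x ∈ e.baseSet) {σ : Π x, V x}
    (hσ : MDifferentiableAt 𝓘(ℝ, E) (𝓘(ℝ, E).prod 𝓘(ℝ, F))
      (fun y => (⟨y, σ y⟩ : TotalSpace F V)) x) (X : TangentSpace 𝓘(ℝ, E) x) :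
    (e ⟨x, cov σ x X⟩).2 = mvfderiv 𝓘(ℝ, E) (fun y => (e ⟨y, σ y⟩).2) x X +
      (e ⟨x, cov (fun y => e.symm y (e ⟨x, σ x⟩).2) x X⟩).2 := by
  have h1 := connDiff_apply cov e hx hσ
  rw [cov_frame cov e hx, e.symm_apply_apply_mk hx, h1]
  simp only [← e.continuousLinearMapAt_apply_of_mem ℝ hx]
  rw [sub_apply, map_sub, trivCov]
  simp only [ContinuousLinearMap.comp_apply]
  rw [e.continuousLinearMapAt_symmL hx]
  abel

variable [FiniteDimensional ℝ E] [T2Space M]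

/-- `A` is a connection form of `cov` on a chart ball of radius `r` around `x₀`, on which the
bundle is trivialized. -/
structure IsLocalForm (cov : CovariantDerivative 𝓘(ℝ, E) F V) (x₀ : M)
    (A : E → E →L[ℝ] F →L[ℝ] F) (r : ℝ) : Prop where
  contDiff : ContDiff ℝ ∞ A
  pos : 0 < r
  ball_subset : Metric.ball (extChartAt 𝓘(ℝ, E) x₀ x₀) r ⊆ (extChartAt 𝓘(ℝ, E) x₀).target
  baseSet : ∀ y ∈ (extChartAt 𝓘(ℝ, E) x₀).source,
    extChartAt 𝓘(ℝ, E) x₀ y ∈ Metric.ball (extChartAt 𝓘(ℝ, E) x₀ x₀) r →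
    y ∈ (trivializationAt F V x₀).baseSet
  frame : ∀ y ∈ (extChartAt 𝓘(ℝ, E) x₀).source,
    extChartAt 𝓘(ℝ, E) x₀ y ∈ Metric.ball (extChartAt 𝓘(ℝ, E) x₀ x₀) r →
    ∀ (X : TangentSpace 𝓘(ℝ, E) y) (f : F),
      (trivializationAt F V x₀ ⟨y, cov (fun z => (trivializationAt F V x₀).symm z f) y X⟩).2 =
        A (extChartAt 𝓘(ℝ, E) x₀ y) (mvfderiv 𝓘(ℝ, E) (extChartAt 𝓘(ℝ, E) x₀) y X) f

/-- Cutting off a function that is smooth near a point. -/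
theorem exists_contDiff_eqOn_ball {W : Type*} [NormedAddCommGroup W] [NormedSpace ℝ W] {O : Set E}
    {p : E} (hO : O ∈ 𝓝 p) {h : E → W} (hh : ContDiffOn ℝ ∞ h O) :
    ∃ r > 0, ∃ g : E → W, ContDiff ℝ ∞ g ∧ EqOn g h (Metric.ball p r) := by
  obtain ⟨R, hR, hRO⟩ := Metric.mem_nhds_iff.1 hO
  let χ : ContDiffBump p := ⟨R / 4, R / 2, by positivity, by linarith⟩
  refine ⟨R / 4, by positivity, fun z => χ z • h z, ?_, fun z hz => ?_⟩
  · refine contMDiff_iff_contDiff.1 (contMDiff_of_tsupport fun z hz => ContDiffAt.contMDiffAt ?_)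
    have hz' : z ∈ Metric.ball p R := by
      have h1 := closure_mono (Function.support_smul_subset_left χ h) hz
      rw [show closure (Function.support χ) = tsupport χ from rfl, χ.tsupport_eq] at h1
      exact Metric.closedBall_subset_ball (by simp only [χ]; linarith) h1
    exact χ.contDiff.contDiffAt.smul (hh.contDiffAt
      (Filter.mem_of_superset (Metric.isOpen_ball.mem_nhds hz') hRO))
  · simp [χ.one_of_mem_closedBall (Metric.ball_subset_closedBall hz)]

/-- Smoothness of the connection is applied to a global section, the local frame times a bump
function. Near x₀ the product is the frame, and a connection is local; a second cut-off, in the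
chart, extends the resulting form to all of E. -/
theorem exists_isLocalForm_frame (cov : CovariantDerivative 𝓘(ℝ, E) F V)
    (hcov : cov.ContMDiffCovariantDerivative ∞) (x₀ : M) (f : F) :
    ∃ r > 0, ∃ A : E → E →L[ℝ] F, ContDiff ℝ ∞ A ∧
      ∀ y ∈ (extChartAt 𝓘(ℝ, E) x₀).source,
        extChartAt 𝓘(ℝ, E) x₀ y ∈ Metric.ball (extChartAt 𝓘(ℝ, E) x₀ x₀) r →
        y ∈ (trivializationAt F V x₀).baseSet ∧ ∀ X : TangentSpace 𝓘(ℝ, E) y,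
        (trivializationAt F V x₀ ⟨y, cov (fun z => (trivializationAt F V x₀).symm z f) y X⟩).2 =
          A (extChartAt 𝓘(ℝ, E) x₀ y) (mvfderiv 𝓘(ℝ, E) (extChartAt 𝓘(ℝ, E) x₀) y X) := by
  set e := trivializationAt F V x₀ with he
  set φ := extChartAt 𝓘(ℝ, E) x₀ with hφ
  set eT := trivializationAt E (TangentSpace 𝓘(ℝ, E) : M → Type _) x₀ with heT
  have hx₀ : x₀ ∈ e.baseSet := mem_baseSet_trivializationAt F V x₀
  obtain ⟨ψ, -, hψ⟩ := (SmoothBumpFunction.nhds_basis_tsupport (I := 𝓘(ℝ, E)) x₀).mem_iff.1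
    (e.open_baseSet.mem_nhds hx₀)
  have hfr : ContMDiffOn 𝓘(ℝ, E) (𝓘(ℝ, E).prod 𝓘(ℝ, F)) ∞
      (fun y => (⟨y, e.symm y f⟩ : TotalSpace F V)) e.baseSet := by
    rw [e.contMDiffOn_section_baseSet_iff]
    refine (contMDiffOn_const (c := f)).congr fun y hy => ?_
    simp [e.apply_mk_symm hy]
  have hσ := ContMDiffOn.smul_section_of_tsupport ψ.contMDiff.contMDiffOn e.open_baseSet hψ hfr
  have hG := hcov.contMDiff.contMDiff hσ.contMDiffOn
  set eH := trivializationAt (E →L[ℝ] F) (fun x : M => TangentSpace 𝓘(ℝ, E) x →L[ℝ] V x) x₀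
  have hG' := (eH.contMDiffOn_section_baseSet_iff (IB := 𝓘(ℝ, E))).1 (hG.mono (subset_univ _))
  have hcomp := hG'.comp (contMDiffOn_extChartAt_symm x₀ |>.mono inter_subset_left)
    (s := φ.target ∩ φ.symm ⁻¹' eH.baseSet) (fun z hz => hz.2)
  have hO : φ.target ∩ φ.symm ⁻¹' eH.baseSet ∈ 𝓝 (φ x₀) := by
    refine Filter.inter_mem (extChartAt_target_mem_nhds x₀) ?_
    refine (continuousAt_extChartAt_symm x₀).preimage_mem_nhds ?_
    rw [extChartAt_to_inv]
    exact eH.open_baseSet.mem_nhds (mem_baseSet_trivializationAt _ _ x₀)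
  obtain ⟨r₁, hr₁, A, hA, hAeq⟩ := exists_contDiff_eqOn_ball hO hcomp.contDiffOn
  have hN : {y | y ∈ e.baseSet ∧ y ∈ eT.baseSet ∧ ∀ᶠ z in 𝓝 y, ψ z = 1} ∈ 𝓝 x₀ := by
    filter_upwards [e.open_baseSet.mem_nhds hx₀, eT.open_baseSet.mem_nhds
      (mem_baseSet_trivializationAt _ _ x₀), ψ.eventuallyEq_one.eventually_nhds] with y h1 h2 h3
    exact ⟨h1, h2, h3⟩
  have hN' : φ.symm ⁻¹' {y | y ∈ e.baseSet ∧ y ∈ eT.baseSet ∧ ∀ᶠ z in 𝓝 y, ψ z = 1} ∈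
      𝓝 (φ x₀) := by
    refine (continuousAt_extChartAt_symm x₀).preimage_mem_nhds ?_
    rwa [extChartAt_to_inv]
  obtain ⟨r₂, hr₂, hr₂'⟩ := Metric.mem_nhds_iff.1 hN'
  refine ⟨min r₁ r₂, lt_min hr₁ hr₂, A, hA, fun y hy hb => ?_⟩
  have hb' := hr₂' (Metric.ball_subset_ball (min_le_right _ _) hb)
  rw [mem_preimage, φ.left_inv hy] at hb'
  obtain ⟨hye, hyT, hyψ⟩ := hb'
  refine ⟨hye, fun X => ?_⟩
  rw [hAeq (Metric.ball_subset_ball (min_le_left _ _) hb), Function.comp_apply, φ.left_inv hy]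
  have hc : cov (fun z => e.symm z f) y = cov ((ψ : M → ℝ) • fun z => e.symm z f) y := by
    refine cov.isCovariantDerivativeOnUniv.congr_of_eventuallyEq (mdifferentiableAt_frame e hye f)
      ((hσ y).mdifferentiableAt (by simp)) Filter.univ_mem ?_
    filter_upwards [hyψ] with z hz
    simp [hz]
  rw [hc]
  change _ = (e.continuousLinearMapAt ℝ y) (cov ((ψ : M → ℝ) • fun z => e.symm z f) y (eT.symmL ℝ y _))
  rw [e.continuousLinearMapAt_apply_of_mem ℝ hye]
  have hX : mvfderiv 𝓘(ℝ, E) φ y X = eT.continuousLinearMapAt ℝ y X := by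
    rw [TangentBundle.continuousLinearMapAt_trivializationAt (by simpa [φ] using hy)]
    rfl
  rw [hX, eT.symmL_continuousLinearMapAt hyT]

set_option synthInstance.maxHeartbeats 200000 in
-- Both sides of the frame equation are linear in the coefficient vector, so the forms found for a
-- basis of F can be added up.
theorem exists_isLocalForm (cov : CovariantDerivative 𝓘(ℝ, E) F V)
    (hcov : cov.ContMDiffCovariantDerivative ∞) (x₀ : M) :
    ∃ A r, IsLocalForm cov x₀ A r := by
  let b := Module.finBasis ℝ F
  choose r hr A hA h using fun i => exists_isLocalForm_frame cov hcov x₀ (b i)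
  obtain ⟨r₀, hr₀, ht⟩ := Metric.mem_nhds_iff.1 (extChartAt_target_mem_nhds (I := 𝓘(ℝ, E)) x₀)
  have hN : {y | y ∈ (trivializationAt F V x₀).baseSet} ∈ 𝓝 x₀ :=
    (trivializationAt F V x₀).open_baseSet.mem_nhds (mem_baseSet_trivializationAt _ _ x₀)
  have hN' : (extChartAt 𝓘(ℝ, E) x₀).symm ⁻¹' {y | y ∈ (trivializationAt F V x₀).baseSet} ∈
      𝓝 (extChartAt 𝓘(ℝ, E) x₀ x₀) := by
    refine (continuousAt_extChartAt_symm x₀).preimage_mem_nhds ?_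
    rwa [extChartAt_to_inv]
  obtain ⟨r₂, hr₂, hr₂'⟩ := Metric.mem_nhds_iff.1 hN'
  -- In rank zero the basis is empty and any radius serves.
  obtain ⟨ρ, hρ, hρr⟩ : ∃ ρ > 0, ∀ i, ρ ≤ r i := by
    obtain hι | hι := isEmpty_or_nonempty (Fin (Module.finrank ℝ F))
    · exact ⟨1, one_pos, fun i => hι.elim i⟩
    · obtain ⟨i, hi⟩ := Finite.exists_min r
      exact ⟨r i, hr i, hi⟩
  let Φ : Fin (Module.finrank ℝ F) → F →L[ℝ] F →L[ℝ] F := fun i =>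
    ContinuousLinearMap.smulRightL ℝ F F (LinearMap.toContinuousLinearMap (b.coord i))
  have hbase : ∀ y ∈ (extChartAt 𝓘(ℝ, E) x₀).source, extChartAt 𝓘(ℝ, E) x₀ y ∈
      Metric.ball (extChartAt 𝓘(ℝ, E) x₀ x₀) (min (min r₀ r₂) ρ) →
      y ∈ (trivializationAt F V x₀).baseSet := by
    intro y hy hb
    have := hr₂' (Metric.ball_subset_ball ((min_le_left _ _).trans (min_le_right _ _)) hb)
    rwa [mem_preimage, PartialEquiv.left_inv _ hy] at this
  refine ⟨fun z => ∑ i, (Φ i).comp (A i z), min (min r₀ r₂) ρ,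
    ⟨ContDiff.sum fun i _ => contDiff_const.clm_comp (hA i), lt_min (lt_min hr₀ hr₂) hρ,
    (Metric.ball_subset_ball ((min_le_left _ _).trans (min_le_left _ _))).trans ht, hbase,
    fun y hy hb X f => ?_⟩⟩
  have hye := hbase y hy hb
  have key : ∀ i, _ := fun i =>
    (h i y hy (Metric.ball_subset_ball ((min_le_right _ _).trans (hρr i)) hb)).2 X
  set e := trivializationAt F V x₀
  simp only [cov_frame cov e hye, ← e.continuousLinearMapAt_apply_of_mem ℝ hye,
    ← e.symmL_apply (R := ℝ) hye] at key ⊢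
  conv_lhs => rw [← b.sum_repr f]
  simp only [map_sum, map_smul, sum_apply, smul_apply, key]
  simp [Φ]

theorem IsLocalForm.cov_apply {cov : CovariantDerivative 𝓘(ℝ, E) F V} {x₀ : M}
    {A : E → E →L[ℝ] F →L[ℝ] F} {r : ℝ} (h : IsLocalForm cov x₀ A r) {y : M}
    (hy : y ∈ (extChartAt 𝓘(ℝ, E) x₀).source)
    (hb : extChartAt 𝓘(ℝ, E) x₀ y ∈ Metric.ball (extChartAt 𝓘(ℝ, E) x₀ x₀) r) {σ : Π x, V x}
    (hσ : MDifferentiableAt 𝓘(ℝ, E) (𝓘(ℝ, E).prod 𝓘(ℝ, F))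
      (fun y => (⟨y, σ y⟩ : TotalSpace F V)) y) (X : TangentSpace 𝓘(ℝ, E) y) :
    (trivializationAt F V x₀ ⟨y, cov σ y X⟩).2 =
      mvfderiv 𝓘(ℝ, E) (fun z => (trivializationAt F V x₀ ⟨z, σ z⟩).2) y X +
      A (extChartAt 𝓘(ℝ, E) x₀ y) (mvfderiv 𝓘(ℝ, E) (extChartAt 𝓘(ℝ, E) x₀) y X)
        (trivializationAt F V x₀ ⟨y, σ y⟩).2 := by
  rw [trivialization_cov cov _ (h.baseSet y hy hb) hσ, h.frame y hy hb]

end LocalForm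

/-! ### Parallel fields on an interval and their equation in a local form -/

section ParallelOn

variable {E F : Type} [NormedAddCommGroup E] [NormedSpace ℝ E]
  [NormedAddCommGroup F] [NormedSpace ℝ F] [FiniteDimensional ℝ F]
  [FiniteDimensional ℝ E] {M : Type*} [TopologicalSpace M] [T2Space M] [ChartedSpace E M]
  [IsManifold 𝓘(ℝ, E) ∞ M]
  {V : M → Type*} [TopologicalSpace (TotalSpace F V)]
  [∀ x, AddCommGroup (V x)] [∀ x, Module ℝ (V x)] [∀ x, TopologicalSpace (V x)]
  [∀ x, IsTopologicalAddGroup (V x)] [∀ x, ContinuousSMul ℝ (V x)]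
  [FiberBundle F V] [VectorBundle ℝ F V] [ContMDiffVectorBundle ∞ F V 𝓘(ℝ, E)]

theorem hasDerivWithinAt_comp_curve {W : Type*} [NormedAddCommGroup W] [NormedSpace ℝ W]
    {G : M → W} {σ : ℝ → M} {s : Set ℝ} {t : ℝ} (hG : MDifferentiableAt 𝓘(ℝ, E) 𝓘(ℝ, W) G (σ t))
    (hσ : MDifferentiableWithinAt 𝓘(ℝ, ℝ) 𝓘(ℝ, E) σ s t) :
    HasDerivWithinAt (fun r => G (σ r))
      (mvfderiv 𝓘(ℝ, E) G (σ t) (mfderivWithin 𝓘(ℝ, ℝ) 𝓘(ℝ, E) σ s t (1 : ℝ))) s t := by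
  have h := hG.hasMFDerivAt.comp_hasMFDerivWithinAt t hσ.hasMFDerivWithinAt
  have h2 : HasFDerivWithinAt (fun r => G (σ r)) ((mvfderiv 𝓘(ℝ, E) G (σ t)).comp
      (mfderivWithin 𝓘(ℝ, ℝ) 𝓘(ℝ, E) σ s t) : ℝ →L[ℝ] W) s t :=
    hasMFDerivWithinAt_iff_hasFDerivWithinAt.1 h
  exact h2.hasDerivWithinAt

/-- `S` is smooth and parallel on `[a, b]`. -/
def IsParallelOn (cov : CovariantDerivative 𝓘(ℝ, E) F V) (S : ℝ → TotalSpace F V)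
    (a b : ℝ) : Prop :=
  ContMDiffOn 𝓘(ℝ, ℝ) (𝓘(ℝ, E).prod 𝓘(ℝ, F)) ∞ S (Icc a b) ∧
    ∀ t ∈ Icc a b, covDerivAlong cov S (Icc a b) t = 0

theorem mdifferentiableWithinAt_proj_comp {S : ℝ → TotalSpace F V} {s : Set ℝ} {t : ℝ}
    (hS : MDifferentiableWithinAt 𝓘(ℝ, ℝ) (𝓘(ℝ, E).prod 𝓘(ℝ, F)) S s t) :
    MDifferentiableWithinAt 𝓘(ℝ, ℝ) 𝓘(ℝ, E) (fun r => (S r).proj) s t :=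
  ((mdifferentiableWithinAt_totalSpace _ _).1 hS).1

theorem differentiableWithinAt_trivialization_comp {S : ℝ → TotalSpace F V} {s : Set ℝ} {t : ℝ}
    (hS : MDifferentiableWithinAt 𝓘(ℝ, ℝ) (𝓘(ℝ, E).prod 𝓘(ℝ, F)) S s t)
    (e : Trivialization F (TotalSpace.proj : TotalSpace F V → M)) [MemTrivializationAtlas e]
    (he : (S t).proj ∈ e.baseSet) :
    DifferentiableWithinAt ℝ (fun r => (e (S r)).2) s t :=
  ((e.mdifferentiableWithinAt_totalSpace_iff 𝓘(ℝ, E) S ((e.mem_source).2 he)).1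
    hS).2.differentiableWithinAt

theorem covDerivAlong_comp (cov : CovariantDerivative 𝓘(ℝ, E) F V) {S : ℝ → TotalSpace F V}
    {s s' : Set ℝ} {f : ℝ → ℝ} {t f' : ℝ} (hf : HasDerivWithinAt f f' s t) (hm : MapsTo f s s')
    (hs : UniqueDiffWithinAt ℝ s t)
    (hS : MDifferentiableWithinAt 𝓘(ℝ, ℝ) (𝓘(ℝ, E).prod 𝓘(ℝ, F)) S s' (f t)) :
    covDerivAlong cov (fun r => S (f r)) s t = f' • covDerivAlong cov S s' (f t) := by
  have h1 : derivWithin (fun r => (trivializationAt F V (S (f t)).proj (S (f r))).2) s t =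
      f' • derivWithin (fun r => (trivializationAt F V (S (f t)).proj (S r)).2) s' (f t) :=
    ((differentiableWithinAt_trivialization_comp hS _
      (mem_baseSet_trivializationAt F V _)).hasDerivWithinAt.scomp t hf hm).derivWithin hs
  have h2 : mfderivWithin 𝓘(ℝ, ℝ) 𝓘(ℝ, E) (fun r => (S (f r)).proj) s t (1 : ℝ) =
      f' • mfderivWithin 𝓘(ℝ, ℝ) 𝓘(ℝ, E) (fun r => (S r).proj) s' (f t) (1 : ℝ) := by
    have h3 := (mdifferentiableWithinAt_proj_comp hS).hasMFDerivWithinAt.comp t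
      (hf.hasFDerivWithinAt.hasMFDerivWithinAt) hm
    have h4 := h3.mfderivWithin (uniqueMDiffWithinAt_iff_uniqueDiffWithinAt.2 hs)
    have h5 := DFunLike.congr_fun h4 (1 : ℝ)
    have h6 : ∀ L : ℝ →L[ℝ] E,
        L.comp (ContinuousLinearMap.toSpanSingleton ℝ f') 1 = f' • L 1 := fun L => by
      simp [← map_smul]
    exact h5.trans (h6 _)
  unfold covDerivAlong
  simp only [h1, h2, map_smul, smul_add]
  congr 1
  have hb := mem_baseSet_trivializationAt F V (S (f t)).proj
  rw [← Trivialization.symmL_apply (R := ℝ) _ hb, map_smul, Trivialization.symmL_apply _ hb]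

theorem IsParallelOn.comp {cov : CovariantDerivative 𝓘(ℝ, E) F V} {S : ℝ → TotalSpace F V}
    {a b a' b' : ℝ} (hS : IsParallelOn cov S a' b') {f : ℝ → ℝ} (hf : ContDiff ℝ ∞ f) (hab : a < b)
    (hm : MapsTo f (Icc a b) (Icc a' b')) : IsParallelOn cov (fun r => S (f r)) a b := by
  refine ⟨hS.1.comp hf.contMDiff.contMDiffOn hm, fun t ht => ?_⟩
  rw [covDerivAlong_comp cov (((hf.differentiable (by simp)) t).hasDerivAt.hasDerivWithinAt) hm
    (uniqueDiffOn_Icc hab t ht) ((hS.1 (f t) (hm ht)).mdifferentiableWithinAt (by simp)),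
    hS.2 (f t) (hm ht), smul_zero]

theorem IsParallelOn.mono {cov : CovariantDerivative 𝓘(ℝ, E) F V} {S : ℝ → TotalSpace F V}
    {a b a' b' : ℝ} (hS : IsParallelOn cov S a b) (ha : a ≤ a') (hab : a' < b') (hb : b' ≤ b) :
    IsParallelOn cov S a' b' :=
  hS.comp contDiff_id hab (Icc_subset_Icc ha hb)

theorem covDerivAlong_congr (cov : CovariantDerivative 𝓘(ℝ, E) F V) {S S' : ℝ → TotalSpace F V}
    {s : Set ℝ} (h : EqOn S S' s) {t : ℝ} (ht : t ∈ s) (h0 : covDerivAlong cov S' s t = 0) :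
    covDerivAlong cov S s t = 0 := by
  have h1 : ∀ p, derivWithin (fun r => (trivializationAt F V p (S r)).2) s t =
      derivWithin (fun r => (trivializationAt F V p (S' r)).2) s t := fun p =>
    derivWithin_congr (fun r hr => by simp only [h hr]) (by simp only [h ht])
  have h2 : (mfderivWithin 𝓘(ℝ, ℝ) 𝓘(ℝ, E) (fun r => (S r).proj) s t : ℝ → E) =
      mfderivWithin 𝓘(ℝ, ℝ) 𝓘(ℝ, E) (fun r => (S' r).proj) s t := by
    have := mfderivWithin_congr (I := 𝓘(ℝ, ℝ)) (I' := 𝓘(ℝ, E)) (f := fun r => (S' r).proj)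
      (f₁ := fun r => (S r).proj) (s := s) (x := t)
      (fun r hr => by simp only [h hr]) (by simp only [h ht])
    exact congrArg (fun (L : ℝ →L[ℝ] E) => (L : ℝ → E)) this
  -- The two derivatives lie in fibres over different expressions for the same point. With both
  -- points abstracted, their equality can be substituted.
  have key : ∀ (p q : TotalSpace F V) (w w' : TotalSpace F V → F) (X X' : E), p = q →
      w = w' → X = X' →
      (trivializationAt F V p.proj).symm p.proj (w p) +
        cov (fun y => (trivializationAt F V p.proj).symm y (trivializationAt F V p.proj p).2)
          p.proj X' = 0 →
      (trivializationAt F V q.proj).symm q.proj (w' q) +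
        cov (fun y => (trivializationAt F V q.proj).symm y (trivializationAt F V q.proj q).2)
          q.proj X = 0 := by
    rintro p q w w' X X' rfl rfl rfl h
    exact h
  exact key (S' t) (S t)
    (fun p => derivWithin (fun r => (trivializationAt F V p.proj (S' r)).2) s t)
    (fun p => derivWithin (fun r => (trivializationAt F V p.proj (S r)).2) s t) _ _
    (h ht).symm (funext fun p => (h1 p.proj).symm) (congrFun h2 1) h0

theorem IsParallelOn.congr {cov : CovariantDerivative 𝓘(ℝ, E) F V} {S S' : ℝ → TotalSpace F V}
    {a b : ℝ} (hS : IsParallelOn cov S' a b) (h : EqOn S S' (Icc a b)) : IsParallelOn cov S a b :=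
  ⟨hS.1.congr h, fun t ht => covDerivAlong_congr cov h ht (hS.2 t ht)⟩

/-- The domain of a local form: a chart ball. -/
def chartBall (E : Type) [NormedAddCommGroup E] [NormedSpace ℝ E] {M : Type*} [TopologicalSpace M]
    [ChartedSpace E M] (x₀ : M) (r : ℝ) : Set M :=
  (extChartAt 𝓘(ℝ, E) x₀).source ∩
    extChartAt 𝓘(ℝ, E) x₀ ⁻¹' Metric.ball (extChartAt 𝓘(ℝ, E) x₀ x₀) r

variable {cov : CovariantDerivative 𝓘(ℝ, E) F V} {x₀ : M}
  {A : E → E →L[ℝ] F →L[ℝ] F} {r : ℝ}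

/-- `covDerivAlong` uses the trivialization at the moving point. On changing to the one at x₀, the
derivative of the coordinate change enters once through the product rule for the coefficients and
once through the derivative of the frozen section; the two terms match. -/
theorem IsLocalForm.trivialization_covDerivAlong (h : IsLocalForm cov x₀ A r)
    {S : ℝ → TotalSpace F V} {s : Set ℝ} {t : ℝ} (hs : UniqueDiffWithinAt ℝ s t)
    (hS : MDifferentiableWithinAt 𝓘(ℝ, ℝ) (𝓘(ℝ, E).prod 𝓘(ℝ, F)) S s t)
    (ht : (S t).proj ∈ chartBall E x₀ r) :
    (trivializationAt F V x₀ ⟨(S t).proj, covDerivAlong cov S s t⟩).2 =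
      derivWithin (fun r => (trivializationAt F V x₀ (S r)).2) s t +
      A (extChartAt 𝓘(ℝ, E) x₀ (S t).proj)
        (derivWithin (fun r => extChartAt 𝓘(ℝ, E) x₀ (S r).proj) s t)
        (trivializationAt F V x₀ (S t)).2 := by
  set e₀ := trivializationAt F V x₀
  set e := trivializationAt F V (S t).proj with he
  set y := (S t).proj with hy
  have hye₀ : y ∈ e₀.baseSet := h.baseSet y ht.1 ht.2
  have hye : y ∈ e.baseSet := mem_baseSet_trivializationAt F V y
  have hσ := mdifferentiableWithinAt_proj_comp hS
  set Y := mfderivWithin 𝓘(ℝ, ℝ) 𝓘(ℝ, E) (fun r => (S r).proj) s t (1 : ℝ) with hY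
  set f := (e (S t)).2 with hf
  have hg : MDifferentiableAt 𝓘(ℝ, E) 𝓘(ℝ, F →L[ℝ] F)
      (fun z => (e.coordChangeL ℝ e₀ z : F →L[ℝ] F)) y :=
    mdifferentiableAt_coordChangeL hye hye₀
  have hφ : MDifferentiableAt 𝓘(ℝ, E) 𝓘(ℝ, E) (extChartAt 𝓘(ℝ, E) x₀) y :=
    mdifferentiableAt_extChartAt (by simpa using ht.1)
  have d1 := hasDerivWithinAt_comp_curve (G := extChartAt 𝓘(ℝ, E) x₀) hφ hσ
  have d2 := hasDerivWithinAt_comp_curve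
    (G := fun z => (e.coordChangeL ℝ e₀ z : F →L[ℝ] F)) hg hσ
  have d3 := (differentiableWithinAt_trivialization_comp hS e hye).hasDerivWithinAt
  have hN : ∀ z ∈ e.baseSet ∩ e₀.baseSet, ∀ v : V z,
      (e₀ ⟨z, v⟩).2 = (e.coordChangeL ℝ e₀ z : F →L[ℝ] F) (e ⟨z, v⟩).2 := by
    intro z hz v
    rw [ContinuousLinearEquiv.coe_coe, Trivialization.coordChangeL_apply e e₀ hz,
      e.symm_apply_apply_mk hz.1]
  have hNy : e.baseSet ∩ e₀.baseSet ∈ 𝓝 y :=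
    (e.open_baseSet.inter e₀.open_baseSet).mem_nhds ⟨hye, hye₀⟩
  have d4 : HasDerivWithinAt (fun r => (e₀ (S r)).2) _ s t :=
    (d2.clm_apply d3).congr_of_eventuallyEq
      (by
        filter_upwards [hσ.continuousWithinAt hNy] with r hr
        exact hN _ hr _)
      (hN _ ⟨hye, hye₀⟩ _)
  rw [d4.derivWithin hs, d1.derivWithin hs]
  have hc := h.cov_apply ht.1 ht.2 (mdifferentiableAt_frame (E := E) e hye f) Y
  have hfr : (e₀ ⟨y, e.symm y f⟩).2 = (e₀ (S t)).2 := by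
    rw [hf, e.symm_apply_apply_mk hye]
  rw [hfr] at hc
  -- Only the direction Y of the curve matters, so both derivatives are computed along the curve.
  have hm : mvfderiv 𝓘(ℝ, E) (fun z => (e₀ ⟨z, e.symm z f⟩).2) y Y =
      mvfderiv 𝓘(ℝ, E) (fun z => (e.coordChangeL ℝ e₀ z : F →L[ℝ] F)) y Y f := by
    have hev : (fun z => (e₀ ⟨z, e.symm z f⟩).2) =ᶠ[𝓝 y]
        fun z => (e.coordChangeL ℝ e₀ z : F →L[ℝ] F) f := by
      filter_upwards [hNy] with z hz
      rw [hN z hz, e.apply_mk_symm hz.1]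
    have h1 := (hg.clm_apply (mdifferentiableAt_const (c := f))).congr_of_eventuallyEq hev
    have d5 := hasDerivWithinAt_comp_curve (G := fun z => (e₀ ⟨z, e.symm z f⟩).2) h1 hσ
    have d6 := (d2.clm_apply (hasDerivWithinAt_const t s f)).congr_of_eventuallyEq
      (f₁ := fun r => (e₀ ⟨(S r).proj, e.symm (S r).proj f⟩).2)
      (hσ.continuousWithinAt.eventually hev) hev.self_of_nhds
    have := hs.eq_deriv _ d5 d6
    simpa using this
  rw [hm] at hc
  simp only [covDerivAlong, ← he, ← hy, ← hY, ← hf]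
  rw [← e₀.continuousLinearMapAt_apply_of_mem ℝ hye₀, map_add,
    e₀.continuousLinearMapAt_apply_of_mem ℝ hye₀, e₀.continuousLinearMapAt_apply_of_mem ℝ hye₀,
    hc, hN y ⟨hye, hye₀⟩, e.apply_mk_symm hye]
  abel

theorem IsLocalForm.chartBall_subset (h : IsLocalForm cov x₀ A r) :
    chartBall E x₀ r ⊆ (trivializationAt F V x₀).baseSet := fun y hy => h.baseSet y hy.1 hy.2

/-- In a fixed trivialization DS/dt = 0 reads u' = -A(c')u. Smoothness of S is not asked for on the
right because solutions of this equation are smooth. -/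
theorem IsLocalForm.isParallelOn_iff (h : IsLocalForm cov x₀ A r) {S : ℝ → TotalSpace F V}
    {a b : ℝ} (hab : a < b) (hb : ∀ t ∈ Icc a b, (S t).proj ∈ chartBall E x₀ r)
    (hσ : ContMDiffOn 𝓘(ℝ, ℝ) 𝓘(ℝ, E) ∞ (fun t => (S t).proj) (Icc a b)) :
    IsParallelOn cov S a b ↔ FormParallel A (fun t => extChartAt 𝓘(ℝ, E) x₀ (S t).proj)
      (fun t => (trivializationAt F V x₀ (S t)).2) a b := by
  set e₀ := trivializationAt F V x₀
  have hsrc : MapsTo S (Icc a b) e₀.source := fun t ht =>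
    e₀.mem_source.2 (h.chartBall_subset (hb t ht))
  have hc : ContDiffOn ℝ ∞ (fun t => extChartAt 𝓘(ℝ, E) x₀ (S t).proj) (Icc a b) :=
    ((contMDiffOn_extChartAt (n := ∞)).comp hσ
      fun t ht => by simpa using (hb t ht).1).contDiffOn
  have hsm : FormParallel A (fun t => extChartAt 𝓘(ℝ, E) x₀ (S t).proj)
      (fun t => (e₀ (S t)).2) a b →
      ContMDiffOn 𝓘(ℝ, ℝ) (𝓘(ℝ, E).prod 𝓘(ℝ, F)) ∞ S (Icc a b) := fun hp =>
    (e₀.contMDiffOn_iff hsrc).2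
      ⟨hσ, (FormParallel.contDiffOn h.contDiff hab hc hp).contMDiffOn⟩
  have hu := uniqueDiffOn_Icc hab
  have key : ContMDiffOn 𝓘(ℝ, ℝ) (𝓘(ℝ, E).prod 𝓘(ℝ, F)) ∞ S (Icc a b) → ∀ t ∈ Icc a b,
      (covDerivAlong cov S (Icc a b) t = 0 ↔
        derivWithin (fun t => (e₀ (S t)).2) (Icc a b) t =
          (-(A (extChartAt 𝓘(ℝ, E) x₀ (S t).proj) (derivWithin
            (fun t => extChartAt 𝓘(ℝ, E) x₀ (S t).proj) (Icc a b) t))) (e₀ (S t)).2) := by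
    intro hS t ht
    have hy := h.chartBall_subset (hb t ht)
    have h1 := h.trivialization_covDerivAlong (hu t ht)
      ((hS t ht).mdifferentiableWithinAt (by simp)) (hb t ht)
    rw [neg_apply, eq_neg_iff_add_eq_zero, ← h1,
      ← e₀.continuousLinearMapAt_apply_of_mem ℝ hy]
    refine ⟨fun h0 => by rw [h0, map_zero], fun h0 => ?_⟩
    rw [← e₀.symmL_continuousLinearMapAt (R := ℝ) hy (covDerivAlong cov S (Icc a b) t), h0,
      map_zero]
  constructor
  · intro hS t ht
    have hd := (differentiableWithinAt_trivialization_comp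
      ((hS.1 t ht).mdifferentiableWithinAt (by simp)) e₀
      (h.chartBall_subset (hb t ht))).hasDerivWithinAt
    rwa [(key hS.1 t ht).1 (hS.2 t ht)] at hd
  · intro hp
    exact ⟨hsm hp, fun t ht => (key (hsm hp) t ht).2 ((hp t ht).derivWithin (hu t ht))⟩

end ParallelOn

/-! ### Piecewise properties of intervals -/

section Piecewise

/-- `[a, b]` has a subdivision into intervals with property `P`. -/
inductive Pw (P : ℝ → ℝ → Prop) : ℝ → ℝ → Prop
  | base {a b : ℝ} : a < b → P a b → Pw P a b
  | snoc {a b c : ℝ} : Pw P a b → b < c → P b c → Pw P a c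

variable {P Q R : ℝ → ℝ → Prop} {a b c : ℝ}

theorem Pw.lt (h : Pw P a b) : a < b := by
  induction h with
  | base h _ => exact h
  | snoc _ h _ ih => exact ih.trans h

theorem Pw.trans (h : Pw P a b) (h' : Pw P b c) : Pw P a c := by
  induction h' with
  | base h1 h2 => exact h.snoc h1 h2
  | snoc _ h1 h2 ih => exact ih.snoc h1 h2

theorem Pw.imp (h : Pw P a b)
    (hPQ : ∀ a' b', a ≤ a' → a' < b' → b' ≤ b → P a' b' → Q a' b') : Pw Q a b := by
  induction h with
  | base h1 h2 => exact .base h1 (hPQ _ _ le_rfl h1 le_rfl h2)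
  | snoc h h1 h2 ih =>
    exact (ih fun a' b' ha hab hb => hPQ a' b' ha hab (hb.trans h1.le)).snoc h1
      (hPQ _ _ h.lt.le h1 le_rfl h2)

theorem Pw.mono (hP : ∀ a a' b' b, a ≤ a' → a' < b' → b' ≤ b → P a b → P a' b') (h : Pw P a b) :
    ∀ {a' b'}, a ≤ a' → a' < b' → b' ≤ b → Pw P a' b' := by
  induction h with
  | base h1 h2 => exact fun ha hab hb => .base hab (hP _ _ _ _ ha hab hb h2)
  | @snoc b c h h1 h2 ih =>
    intro a' b' ha hab hb
    obtain hb' | hb' := le_or_gt b' b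
    · exact ih ha hab hb'
    obtain ha' | ha' := le_or_gt b a'
    · exact .base hab (hP _ _ _ _ ha' hab hb h2)
    · exact (ih ha ha' le_rfl).snoc hb' (hP _ _ _ _ le_rfl hb' hb h2)

/-- Common refinement: the second subdivision is cut down to each interval of the first. -/
theorem Pw.and (hP : ∀ a a' b' b, a ≤ a' → a' < b' → b' ≤ b → P a b → P a' b')
    (hQ : ∀ a a' b' b, a ≤ a' → a' < b' → b' ≤ b → Q a b → Q a' b')
    (h : Pw P a b) (h' : Pw Q a b) : Pw (fun a b => P a b ∧ Q a b) a b := by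
  induction h with
  | base h1 h2 => exact h'.imp fun a' b' ha hab hb hq => ⟨hP _ _ _ _ ha hab hb h2, hq⟩
  | @snoc b c h h1 h2 ih =>
    exact (ih (h'.mono hQ le_rfl h.lt h1.le)).trans ((h'.mono hQ h.lt.le h1 le_rfl).imp
      fun a' b' ha hab hb hq => ⟨hP _ _ _ _ ha hab hb h2, hq⟩)

theorem Pw.map (h : Pw P a b) {g : ℝ → ℝ} (hg : StrictMono g)
    (hPQ : ∀ a' b', a ≤ a' → a' < b' → b' ≤ b → P a' b' → Q (g a') (g b')) : Pw Q (g a) (g b) := by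
  induction h with
  | base h1 h2 => exact .base (hg h1) (hPQ _ _ le_rfl h1 le_rfl h2)
  | snoc h h1 h2 ih =>
    exact (ih fun a' b' ha hab hb => hPQ a' b' ha hab (hb.trans h1.le)).snoc (hg h1)
      (hPQ _ _ h.lt.le h1 le_rfl h2)

theorem Pw.map_anti (h : Pw P a b) {g : ℝ → ℝ} (hg : StrictAnti g)
    (hPQ : ∀ a' b', a ≤ a' → a' < b' → b' ≤ b → P a' b' → Q (g b') (g a')) : Pw Q (g b) (g a) := by
  induction h with
  | base h1 h2 => exact .base (hg h1) (hPQ _ _ le_rfl h1 le_rfl h2)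
  | snoc h h1 h2 ih =>
    exact (Pw.base (hg h1) (hPQ _ _ h.lt.le h1 le_rfl h2)).trans
      (ih fun a' b' ha hab hb => hPQ a' b' ha hab (hb.trans h1.le))

/-- The Lebesgue number lemma, for properties that hold on every interval contained in one member of
an open cover. -/
theorem Pw.of_local (hab : a < b) {ι : Type*} {c : ι → Set (Icc a b)}
    (hc₁ : ∀ i, IsOpen (c i)) (hc₂ : univ ⊆ ⋃ i, c i)
    (hP : ∀ i, ∀ a' b', a ≤ a' → a' < b' → b' ≤ b →
      (∀ t (ht : t ∈ Icc a b), t ∈ Icc a' b' → (⟨t, ht⟩ : Icc a b) ∈ c i) → P a' b') :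
    Pw P a b := by
  obtain ⟨t, ht0, htm, ⟨m, hm⟩, htc⟩ := exists_monotone_Icc_subset_open_cover_Icc hab.le hc₁ hc₂
  -- The points `t n` are only weakly increasing. Repetitions are skipped, and before the first
  -- advance the subdivision is still empty.
  have key : ∀ n, (t n : ℝ) = a ∨ Pw P a (t n) := by
    intro n
    induction n with
    | zero => exact .inl ht0
    | succ n ih =>
      obtain heq | hlt := (htm (Nat.le_succ n)).eq_or_lt
      · rwa [← heq]
      obtain ⟨i, hi⟩ := htc n
      have h1 : P (t n) (t (n + 1)) := hP i _ _ (t n).2.1 hlt (t (n + 1)).2.2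
        fun s hs hs' => hi ⟨hs'.1, hs'.2⟩
      right
      obtain h | h := ih
      · have hlt' : (t n : ℝ) < t (n + 1) := hlt
        rw [h] at h1 hlt'
        exact .base hlt' h1
      · exact h.snoc hlt h1
  obtain h | h := key m
  · rw [hm m le_rfl] at h
    exact absurd h hab.ne'
  · rwa [hm m le_rfl] at h

theorem Pw.continuousOn {X : Type*} [TopologicalSpace X] {f : ℝ → X} (h : Pw P a b)
    (hP : ∀ a' b', P a' b' → ContinuousOn f (Icc a' b')) : ContinuousOn f (Icc a b) := by
  induction h with
  | base h1 h2 => exact hP _ _ h2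
  | snoc h h1 h2 ih =>
    rw [← Icc_union_Icc_eq_Icc h.lt.le h1.le]
    exact ih.union_of_isClosed (hP _ _ h2) isClosed_Icc isClosed_Icc

theorem pw_of_subdivision {N : ℕ} (τ : Fin (N + 1) → ℝ) (hτ : StrictMono τ) (hN : 0 < N)
    (h : ∀ i : Fin N, P (τ i.castSucc) (τ i.succ)) : Pw P (τ 0) (τ (Fin.last N)) := by
  induction N with
  | zero => exact absurd hN (lt_irrefl 0)
  | succ N ih =>
    have h1 : τ (Fin.last N).castSucc < τ (Fin.last (N + 1)) := hτ (Fin.castSucc_lt_last _)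
    have h2 := h (Fin.last N)
    rw [Fin.succ_last] at h2
    obtain rfl | hN' := Nat.eq_zero_or_pos N
    · exact .base h1 h2
    · exact (ih (fun i => τ i.castSucc) (fun i j hij => hτ (Fin.castSucc_lt_castSucc_iff.2 hij)) hN'
        fun i => h i.castSucc).snoc h1 h2

theorem Pw.exists_subdivision (h : Pw P a b) : ∃ (N : ℕ) (τ : Fin (N + 1) → ℝ), StrictMono τ ∧
    τ 0 = a ∧ τ (Fin.last N) = b ∧ ∀ i : Fin N, P (τ i.castSucc) (τ i.succ) := by
  induction h with
  | @base b h1 h2 =>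
    refine ⟨1, ![a, b], Fin.strictMono_iff_lt_succ.2 fun i => ?_, rfl, rfl, fun i => ?_⟩ <;>
    · obtain rfl := Subsingleton.elim i 0
      assumption
  | @snoc b c h h1 h2 ih =>
    obtain ⟨N, τ, hτ, h0, hl, hP⟩ := ih
    refine ⟨N + 1, Fin.snoc (α := fun _ => ℝ) τ c, Fin.strictMono_iff_lt_succ.2 fun i => ?_,
      ?_, ?_, fun i => ?_⟩
    · refine Fin.lastCases ?_ (fun j => ?_) i
      · rw [Fin.succ_last, Fin.snoc_last, Fin.snoc_castSucc, hl]
        exact h1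
      · rw [Fin.succ_castSucc, Fin.snoc_castSucc, Fin.snoc_castSucc]
        exact hτ (Fin.castSucc_lt_succ)
    · exact (Fin.snoc_castSucc (α := fun _ => ℝ) c τ 0).trans h0
    · exact Fin.snoc_last _ _
    · refine Fin.lastCases ?_ (fun j => ?_) i
      · rw [Fin.succ_last, Fin.snoc_last, Fin.snoc_castSucc, hl]
        exact h2
      · rw [Fin.succ_castSucc, Fin.snoc_castSucc, Fin.snoc_castSucc]
        exact hP j

/-- Links the inductive form, suited to gluing and induction, to the indexed subdivisions of the
definitions; 0 ≠ 1 excludes the empty subdivision. -/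
theorem pw_zero_one_iff : Pw P 0 1 ↔ ∃ (N : ℕ) (τ : Fin (N + 1) → ℝ), IsSubdivision τ ∧
    ∀ i : Fin N, P (τ i.castSucc) (τ i.succ) := by
  constructor
  · intro h
    obtain ⟨N, τ, hτ, h0, hl, hP⟩ := h.exists_subdivision
    exact ⟨N, τ, ⟨hτ, h0, hl⟩, hP⟩
  · rintro ⟨N, τ, ⟨hτ, h0, hl⟩, hP⟩
    have hN : 0 < N := by
      refine Nat.pos_of_ne_zero ?_
      rintro rfl
      have : τ 0 = τ (Fin.last 0) := rfl
      rw [h0, hl] at this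
      exact zero_ne_one this
    have := pw_of_subdivision τ hτ hN hP
    rwa [h0, hl] at this

end Piecewise

/-! ### Transport along piecewise smooth curves -/

section Transport

variable {E F : Type} [NormedAddCommGroup E] [NormedSpace ℝ E]
  [NormedAddCommGroup F] [NormedSpace ℝ F] [FiniteDimensional ℝ F]
  [FiniteDimensional ℝ E] {M : Type*} [TopologicalSpace M] [T2Space M] [ChartedSpace E M]
  [IsManifold 𝓘(ℝ, E) ∞ M]
  {V : M → Type*} [TopologicalSpace (TotalSpace F V)]
  [∀ x, AddCommGroup (V x)] [∀ x, Module ℝ (V x)] [∀ x, TopologicalSpace (V x)]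
  [∀ x, IsTopologicalAddGroup (V x)] [∀ x, ContinuousSMul ℝ (V x)]
  [FiberBundle F V] [VectorBundle ℝ F V] [ContMDiffVectorBundle ∞ F V 𝓘(ℝ, E)]

variable (E) in
/-- `σ` is smooth on the intervals of a subdivision of `[a, b]`. -/
def PwSmooth (σ : ℝ → M) (a b : ℝ) : Prop :=
  Pw (fun a b => ContMDiffOn 𝓘(ℝ, ℝ) 𝓘(ℝ, E) ∞ σ (Icc a b)) a b

/-- `q` is the parallel transport of `p` along `σ` from time `a` to time `b`. -/
def Tr (cov : CovariantDerivative 𝓘(ℝ, E) F V) (σ : ℝ → M) (a b : ℝ) (p q : TotalSpace F V) :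
    Prop :=
  ∃ S, Pw (IsParallelOn cov S) a b ∧ (∀ t ∈ Icc a b, (S t).proj = σ t) ∧ S a = p ∧ S b = q

theorem piecewiseSmooth_iff {x y : M} (γ : Path x y) :
    PiecewiseSmooth E γ ↔ PwSmooth E γ.extend 0 1 :=
  (pw_zero_one_iff (P := fun a b => ContMDiffOn 𝓘(ℝ, ℝ) 𝓘(ℝ, E) ∞ γ.extend (Icc a b))).symm

theorem isParallelTransport_iff (cov : CovariantDerivative 𝓘(ℝ, E) F V) {x y : M} (γ : Path x y)
    (v : V x) (w : V y) :
    IsParallelTransport cov γ v w ↔ Tr cov γ.extend 0 1 ⟨x, v⟩ ⟨y, w⟩ := by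
  constructor
  · rintro ⟨S, ⟨_, h2, h3⟩, h4, h5⟩
    exact ⟨S, pw_zero_one_iff.2 h3, h2, h4, h5⟩
  · rintro ⟨S, h1, h2, h4, h5⟩
    exact ⟨S, ⟨h1.continuousOn fun _ _ h => h.1.continuousOn, h2, pw_zero_one_iff.1 h1⟩, h4, h5⟩

theorem PwSmooth.continuousOn {σ : ℝ → M} {a b : ℝ} (h : PwSmooth E σ a b) :
    ContinuousOn σ (Icc a b) :=
  Pw.continuousOn h fun _ _ h => h.continuousOn

theorem PwSmooth.mono {σ : ℝ → M} {a b a' b' : ℝ} (h : PwSmooth E σ a b) (ha : a ≤ a')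
    (hab : a' < b') (hb : b' ≤ b) : PwSmooth E σ a' b' :=
  Pw.mono (fun _ _ _ _ h1 _ h3 h => h.mono (Icc_subset_Icc h1 h3)) h ha hab hb

theorem PwSmooth.congr {σ σ' : ℝ → M} {a b : ℝ} (h : PwSmooth E σ a b)
    (hσ : EqOn σ' σ (Icc a b)) : PwSmooth E σ' a b :=
  Pw.imp h fun _ _ ha _ hb h => h.congr (hσ.mono (Icc_subset_Icc ha hb))

variable {cov : CovariantDerivative 𝓘(ℝ, E) F V}

theorem Tr.lt {σ : ℝ → M} {a b : ℝ} {p q : TotalSpace F V} (h : Tr cov σ a b p q) : a < b := by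
  obtain ⟨S, h, -⟩ := h
  exact h.lt

theorem Tr.congr {σ σ' : ℝ → M} {a b : ℝ} {p q : TotalSpace F V} (h : Tr cov σ a b p q)
    (hσ : EqOn σ' σ (Icc a b)) : Tr cov σ' a b p q := by
  obtain ⟨S, h1, h2, h3⟩ := h
  exact ⟨S, h1, fun t ht => (h2 t ht).trans (hσ ht).symm, h3⟩

theorem Tr.trans {σ : ℝ → M} {a b c : ℝ} {p q r : TotalSpace F V} (h : Tr cov σ a b p q)
    (h' : Tr cov σ b c q r) : Tr cov σ a c p r := by
  have hab := h.lt
  have hbc := h'.lt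
  obtain ⟨S, h1, h2, h3, h4⟩ := h
  obtain ⟨S', h1', h2', h3', h4'⟩ := h'
  have e1 : EqOn (fun t => if t ≤ b then S t else S' t) S (Icc a b) :=
    fun t ht => if_pos ht.2
  have e2 : EqOn (fun t => if t ≤ b then S t else S' t) S' (Icc b c) := by
    intro t ht
    obtain rfl | hlt := ht.1.eq_or_lt
    · simp [h4, h3']
    · exact if_neg hlt.not_ge
  refine ⟨fun t => if t ≤ b then S t else S' t,
    (h1.imp fun a' b' ha _ hb h => h.congr (e1.mono (Icc_subset_Icc ha hb))).trans
      (h1'.imp fun a' b' ha _ hb h => h.congr (e2.mono (Icc_subset_Icc ha hb))),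
    fun t ht => ?_, (e1 (left_mem_Icc.2 hab.le)).trans h3, (e2 (right_mem_Icc.2 hbc.le)).trans h4'⟩
  obtain htb | htb := le_total t b
  · rw [e1 ⟨ht.1, htb⟩, h2 t ⟨ht.1, htb⟩]
  · rw [e2 ⟨htb, ht.2⟩, h2' t ⟨htb, ht.2⟩]

theorem Tr.comp_affine {σ : ℝ → M} {a b α β : ℝ} (hα : 0 < α) {p q : TotalSpace F V}
    (h : Tr cov σ (α * a + β) (α * b + β) p q) : Tr cov (fun t => σ (α * t + β)) a b p q := by
  have hmap : ∀ a' b', MapsTo (fun t => α * t + β) (Icc ((a' - β) / α) ((b' - β) / α))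
      (Icc a' b') := by
    intro a' b' t ht
    rw [mem_Icc, div_le_iff₀ hα, le_div_iff₀ hα] at ht
    constructor <;> linarith [ht.1, ht.2, mul_comm α t]
  obtain ⟨S, h1, h2, h3, h4⟩ := h
  refine ⟨fun t => S (α * t + β), ?_, fun t ht => h2 _ ⟨?_, ?_⟩, h3, h4⟩
  · have := h1.map (g := fun t => (t - β) / α) (Q := IsParallelOn cov (fun t => S (α * t + β)))
      (fun s t hst => div_lt_div_of_pos_right (sub_lt_sub_right hst β) hα)
      (fun a' b' _ hab _ h => h.comp (f := fun t => α * t + β) (by fun_prop)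
        (div_lt_div_of_pos_right (sub_lt_sub_right hab β) hα) (hmap a' b'))
    simpa [hα.ne'] using this
  · nlinarith [ht.1]
  · nlinarith [ht.2]

theorem PwSmooth.comp_affine {σ : ℝ → M} {a b α β : ℝ} (hα : 0 < α)
    (h : PwSmooth E σ (α * a + β) (α * b + β)) : PwSmooth E (fun t => σ (α * t + β)) a b := by
  have hmap : ∀ a' b', MapsTo (fun t => α * t + β) (Icc ((a' - β) / α) ((b' - β) / α))
      (Icc a' b') := by
    intro a' b' t ht
    rw [mem_Icc, div_le_iff₀ hα, le_div_iff₀ hα] at ht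
    constructor <;> linarith [ht.1, ht.2, mul_comm α t]
  have := Pw.map h (g := fun t => (t - β) / α)
    (Q := fun a b => ContMDiffOn 𝓘(ℝ, ℝ) 𝓘(ℝ, E) ∞ (fun t => σ (α * t + β)) (Icc a b))
    (fun s t hst => div_lt_div_of_pos_right (sub_lt_sub_right hst β) hα)
    (fun a' b' _ hab _ h => h.comp (f := fun t => α * t + β)
      (ContDiff.contMDiff (by fun_prop)).contMDiffOn (hmap a' b'))
  simpa [PwSmooth, hα.ne'] using this

theorem Tr.reverse {σ : ℝ → M} {p q : TotalSpace F V} (h : Tr cov σ 0 1 p q) :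
    Tr cov (fun t => σ (1 - t)) 0 1 q p := by
  obtain ⟨S, h1, h2, h3, h4⟩ := h
  refine ⟨fun t => S (1 - t), ?_, fun t ht => h2 _ ⟨by linarith [ht.2], by linarith [ht.1]⟩,
    by simpa using h4, by simpa using h3⟩
  have := h1.map_anti (g := fun t => 1 - t) (Q := IsParallelOn cov (fun t => S (1 - t)))
    (fun s t hst => sub_lt_sub_left hst 1)
    (fun a' b' _ hab _ h => h.comp (f := fun t => 1 - t) (by fun_prop)
      (sub_lt_sub_left hab 1) (fun t ht => ⟨by linarith [ht.2], by linarith [ht.1]⟩))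
  simpa using this

theorem PwSmooth.reverse {σ : ℝ → M} (h : PwSmooth E σ 0 1) :
    PwSmooth E (fun t => σ (1 - t)) 0 1 := by
  have := Pw.map_anti h (g := fun t => 1 - t)
    (Q := fun a b => ContMDiffOn 𝓘(ℝ, ℝ) 𝓘(ℝ, E) ∞ (fun t => σ (1 - t)) (Icc a b))
    (fun s t hst => sub_lt_sub_left hst 1)
    (fun a' b' _ hab _ h => h.comp (f := fun t => 1 - t)
      (ContDiff.contMDiff (by fun_prop)).contMDiffOn
      (fun t ht => ⟨by linarith [ht.2], by linarith [ht.1]⟩))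
  simpa [PwSmooth] using this

/-- The image of `s ↦ p + s (c - p)` in a chart. -/
def chartScale (E : Type) [NormedAddCommGroup E] [NormedSpace ℝ E] {M : Type*} [TopologicalSpace M]
    [ChartedSpace E M] (x₀ : M) (p : E) (σ : ℝ → M) (s : ℝ) (t : ℝ) : M :=
  (extChartAt 𝓘(ℝ, E) x₀).symm (p + s • (extChartAt 𝓘(ℝ, E) x₀ (σ t) - p))

variable {x₀ : M} {A : E → E →L[ℝ] F →L[ℝ] F} {r : ℝ}

theorem isOpen_chartBall (x₀ : M) (r : ℝ) : IsOpen (chartBall E x₀ r) :=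
  isOpen_extChartAt_preimage' x₀ Metric.isOpen_ball

theorem scale_mem_ball {p : E}
    (hp : p ∈ Metric.ball (extChartAt 𝓘(ℝ, E) x₀ x₀) r) {y : M} (hy : y ∈ chartBall E x₀ r) {s : ℝ}
    (hs : s ∈ Icc (0 : ℝ) 1) : p + s • (extChartAt 𝓘(ℝ, E) x₀ y - p) ∈
      Metric.ball (extChartAt 𝓘(ℝ, E) x₀ x₀) r :=
  (convex_ball _ r).add_smul_sub_mem hp hy.2 hs

theorem IsLocalForm.extChartAt_chartScale (h : IsLocalForm cov x₀ A r) {p : E}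
    (hp : p ∈ Metric.ball (extChartAt 𝓘(ℝ, E) x₀ x₀) r) {σ : ℝ → M} {t : ℝ}
    (hy : σ t ∈ chartBall E x₀ r) {s : ℝ} (hs : s ∈ Icc (0 : ℝ) 1) :
    extChartAt 𝓘(ℝ, E) x₀ (chartScale E x₀ p σ s t) =
      p + s • (extChartAt 𝓘(ℝ, E) x₀ (σ t) - p) :=
  (extChartAt 𝓘(ℝ, E) x₀).right_inv (h.ball_subset (scale_mem_ball hp hy hs))

theorem IsLocalForm.chartScale_mem (h : IsLocalForm cov x₀ A r) {p : E}
    (hp : p ∈ Metric.ball (extChartAt 𝓘(ℝ, E) x₀ x₀) r) {σ : ℝ → M} {t : ℝ}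
    (hy : σ t ∈ chartBall E x₀ r) {s : ℝ} (hs : s ∈ Icc (0 : ℝ) 1) :
    chartScale E x₀ p σ s t ∈ chartBall E x₀ r := by
  refine ⟨(extChartAt 𝓘(ℝ, E) x₀).map_target (h.ball_subset (scale_mem_ball hp hy hs)), ?_⟩
  rw [mem_preimage, h.extChartAt_chartScale hp hy hs]
  exact scale_mem_ball hp hy hs

theorem IsLocalForm.contMDiffOn_chartScale (h : IsLocalForm cov x₀ A r) {p : E}
    (hp : p ∈ Metric.ball (extChartAt 𝓘(ℝ, E) x₀ x₀) r) {σ : ℝ → M} {a b : ℝ}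
    (hσ : ContMDiffOn 𝓘(ℝ, ℝ) 𝓘(ℝ, E) ∞ σ (Icc a b))
    (hy : MapsTo σ (Icc a b) (chartBall E x₀ r)) {s : ℝ} (hs : s ∈ Icc (0 : ℝ) 1) :
    ContMDiffOn 𝓘(ℝ, ℝ) 𝓘(ℝ, E) ∞ (chartScale E x₀ p σ s) (Icc a b) := by
  have hc : ContDiffOn ℝ ∞ (fun t => extChartAt 𝓘(ℝ, E) x₀ (σ t)) (Icc a b) :=
    ((contMDiffOn_extChartAt (n := ∞)).comp hσ fun t ht => by simpa using (hy ht).1).contDiffOn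
  exact (contMDiffOn_extChartAt_symm x₀).comp
    (contDiffOn_const.add (contDiffOn_const.smul (hc.sub contDiffOn_const))).contMDiffOn
    fun t ht => h.ball_subset (scale_mem_ball hp (hy ht) hs)

/-- In the chart the shrunk curve is p + s(c - p), whose solution operator is smooth in s. The
operator exists for all real s, but is a transport only for s in [0, 1], where convexity keeps the
curve inside the ball. -/
theorem IsLocalForm.exists_transport_scale_of_smooth (h : IsLocalForm cov x₀ A r) {p : E}
    (hp : p ∈ Metric.ball (extChartAt 𝓘(ℝ, E) x₀ x₀) r) {σ : ℝ → M} {a b : ℝ} (hab : a < b)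
    (hσ : ContMDiffOn 𝓘(ℝ, ℝ) 𝓘(ℝ, E) ∞ σ (Icc a b))
    (hy : MapsTo σ (Icc a b) (chartBall E x₀ r)) :
    ∃ T : ℝ → F →L[ℝ] F, ContDiff ℝ ∞ T ∧ ∀ s ∈ Icc (0 : ℝ) 1,
      PwSmooth E (chartScale E x₀ p σ s) a b ∧ ∀ f, Tr cov (chartScale E x₀ p σ s) a b
        ⟨chartScale E x₀ p σ s a, (trivializationAt F V x₀).symm (chartScale E x₀ p σ s a) f⟩
        ⟨chartScale E x₀ p σ s b,
          (trivializationAt F V x₀).symm (chartScale E x₀ p σ s b) (T s f)⟩ := by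
  set e := trivializationAt F V x₀
  have hc : ContDiffOn ℝ ∞ (fun t => extChartAt 𝓘(ℝ, E) x₀ (σ t)) (Icc a b) :=
    ((contMDiffOn_extChartAt (n := ∞)).comp hσ fun t ht => by simpa using (hy ht).1).contDiffOn
  obtain ⟨T, hT, hTu⟩ := exists_contDiff_scaled_transport h.contDiff hab hc p
  refine ⟨T, hT, fun s hs => ⟨.base hab (h.contMDiffOn_chartScale hp hσ hy hs), fun f => ?_⟩⟩
  obtain ⟨u, hu1, hu2, hu⟩ := hTu s f
  let S : ℝ → TotalSpace F V := fun t =>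
    ⟨chartScale E x₀ p σ s t, e.symm (chartScale E x₀ p σ s t) (u t)⟩
  refine ⟨S, .base hab ((h.isParallelOn_iff hab (fun t ht => h.chartScale_mem hp (hy ht) hs)
    (h.contMDiffOn_chartScale hp hσ hy hs)).2 ?_), fun _ _ => rfl, by simp [S, hu1],
    by simp [S, hu2]⟩
  have e1 : EqOn (fun t => extChartAt 𝓘(ℝ, E) x₀ (S t).proj)
      (fun t => p + s • (extChartAt 𝓘(ℝ, E) x₀ (σ t) - p)) (Icc a b) := fun t ht =>
    h.extChartAt_chartScale hp (hy ht) hs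
  have e2 : EqOn (fun t => (e (S t)).2) u (Icc a b) := fun t ht => by
    simp only [S]
    rw [e.apply_mk_symm (h.chartBall_subset (h.chartScale_mem hp (hy ht) hs))]
  intro t ht
  have := (hu t ht).congr_of_mem (f₁ := fun t => (e (S t)).2) (fun t ht => e2 ht) ht
  rwa [← derivWithin_congr e1 (e1 ht), ← e1 ht, ← e2 ht] at this

/-- Transport along the curves obtained by shrinking a curve in a chart ball depends smoothly on
the shrinking factor. -/
theorem IsLocalForm.exists_transport_scale (h : IsLocalForm cov x₀ A r) {p : E}
    (hp : p ∈ Metric.ball (extChartAt 𝓘(ℝ, E) x₀ x₀) r) {σ : ℝ → M} {a b : ℝ}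
    (hσ : PwSmooth E σ a b) (hy : MapsTo σ (Icc a b) (chartBall E x₀ r)) :
    ∃ T : ℝ → F →L[ℝ] F, ContDiff ℝ ∞ T ∧ ∀ s ∈ Icc (0 : ℝ) 1,
      PwSmooth E (chartScale E x₀ p σ s) a b ∧ ∀ f, Tr cov (chartScale E x₀ p σ s) a b
        ⟨chartScale E x₀ p σ s a, (trivializationAt F V x₀).symm (chartScale E x₀ p σ s a) f⟩
        ⟨chartScale E x₀ p σ s b,
          (trivializationAt F V x₀).symm (chartScale E x₀ p σ s b) (T s f)⟩ := by
  induction hσ with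
  | base hab hσ => exact h.exists_transport_scale_of_smooth hp hab hσ hy
  | snoc hab hbc hσ ih =>
    obtain ⟨T, hT, hTu⟩ := ih fun t ht => hy ⟨ht.1, ht.2.trans hbc.le⟩
    obtain ⟨T', hT', hTu'⟩ := h.exists_transport_scale_of_smooth hp hbc hσ
      fun t ht => hy ⟨hab.lt.le.trans ht.1, ht.2⟩
    refine ⟨fun s => (T' s).comp (T s), hT'.clm_comp hT, fun s hs =>
      ⟨(hTu s hs).1.trans (hTu' s hs).1, fun f => ((hTu s hs).2 f).trans ((hTu' s hs).2 (T s f))⟩⟩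

theorem chartScale_one {p : E} {σ : ℝ → M} {t : ℝ} (ht : σ t ∈ chartBall E x₀ r) :
    chartScale E x₀ p σ 1 t = σ t := by
  simp only [chartScale, one_smul, add_sub_cancel]
  exact (extChartAt 𝓘(ℝ, E) x₀).left_inv ht.1

/-- On `[a, b]` the curve `σ` stays in the domain of a local form. -/
def InChartBall (cov : CovariantDerivative 𝓘(ℝ, E) F V) (σ : ℝ → M) (a b : ℝ) : Prop :=
  ∃ x₀ A r, IsLocalForm cov x₀ A r ∧ MapsTo σ (Icc a b) (chartBall E x₀ r)

theorem InChartBall.mono {σ : ℝ → M} {a b a' b' : ℝ} (h : InChartBall cov σ a b) (ha : a ≤ a')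
    (hb : b' ≤ b) : InChartBall cov σ a' b' := by
  obtain ⟨x₀, A, r, h, hm⟩ := h
  exact ⟨x₀, A, r, h, hm.mono_left (Icc_subset_Icc ha hb)⟩

theorem pw_inChartBall (hcov : CovariantDerivative.ContMDiffCovariantDerivative cov ∞) {σ : ℝ → M}
    {a b : ℝ} (hab : a < b) (hσ : ContinuousOn σ (Icc a b)) : Pw (InChartBall cov σ) a b := by
  choose A r hA using fun x₀ => exists_isLocalForm cov hcov x₀
  refine Pw.of_local hab (c := fun x₀ => {t : Icc a b | σ t ∈ chartBall E x₀ (r x₀)})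
    (fun x₀ => (isOpen_chartBall x₀ (r x₀)).preimage hσ.domRestrict) (fun t _ => ?_)
    fun x₀ a' b' ha hab hb h => ⟨x₀, A x₀, r x₀, hA x₀, fun t ht => h t ⟨ha.trans ht.1,
      ht.2.trans hb⟩ ht⟩
  exact mem_iUnion.2 ⟨σ t, mem_extChartAt_source _, Metric.mem_ball_self (hA _).pos⟩

theorem PwSmooth.pw_inChartBall (hcov : CovariantDerivative.ContMDiffCovariantDerivative cov ∞)
    {σ : ℝ → M} {a b : ℝ} (hσ : PwSmooth E σ a b) :
    Pw (fun a b => ContMDiffOn 𝓘(ℝ, ℝ) 𝓘(ℝ, E) ∞ σ (Icc a b) ∧ InChartBall cov σ a b) a b :=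
  Pw.and (fun _ _ _ _ h1 _ h3 h => h.mono (Icc_subset_Icc h1 h3))
    (fun _ _ _ _ h1 _ h3 h => h.mono h1 h3) hσ
    (FlatTransport.pw_inChartBall hcov (Pw.lt hσ) hσ.continuousOn)

/-- Over a piece inside a chart ball this is the solution operator at scale s = 1, read through the
trivialization; consecutive pieces compose. -/
theorem exists_tr (hcov : CovariantDerivative.ContMDiffCovariantDerivative cov ∞)
    {σ : ℝ → M} {a b : ℝ} (hσ : PwSmooth E σ a b) :
    ∃ L : V (σ a) →L[ℝ] V (σ b), ∀ v, Tr cov σ a b ⟨σ a, v⟩ ⟨σ b, L v⟩ := by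
  have base : ∀ {a b}, a < b → ContMDiffOn 𝓘(ℝ, ℝ) 𝓘(ℝ, E) ∞ σ (Icc a b) →
      InChartBall cov σ a b →
      ∃ L : V (σ a) →L[ℝ] V (σ b), ∀ v, Tr cov σ a b ⟨σ a, v⟩ ⟨σ b, L v⟩ := by
    rintro a b hab hs ⟨x₀, A, r, h, hm⟩
    obtain ⟨T, -, hT⟩ := h.exists_transport_scale_of_smooth (Metric.mem_ball_self h.pos) hab hs hm
    set e := trivializationAt F V x₀
    have ha := hm (left_mem_Icc.2 hab.le)
    have hb := hm (right_mem_Icc.2 hab.le)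
    refine ⟨((e.symmL ℝ (σ b)).comp (T 1)).comp (e.continuousLinearMapAt ℝ (σ a)), fun v => ?_⟩
    have := (hT 1 ⟨zero_le_one, le_rfl⟩).2 (e.continuousLinearMapAt ℝ (σ a) v)
    rw [chartScale_one ha, chartScale_one hb,
      ← e.symmL_apply (R := ℝ) (h.chartBall_subset ha),
      e.symmL_continuousLinearMapAt (h.chartBall_subset ha),
      ← e.symmL_apply (R := ℝ) (h.chartBall_subset hb)] at this
    exact this.congr fun t ht => (chartScale_one (hm ht)).symm
  induction hσ.pw_inChartBall hcov with
  | base hab h => exact base hab h.1 h.2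
  | snoc h hbc h' ih =>
    obtain ⟨L, hL⟩ := ih (Pw.imp h fun _ _ _ _ _ h => h.1)
    obtain ⟨L', hL'⟩ := base hbc h'.1 h'.2
    exact ⟨L'.comp L, fun v => (hL v).trans (hL' _)⟩

theorem IsLocalForm.eqOn_of_isParallelOn (h : IsLocalForm cov x₀ A r) {S S' : ℝ → TotalSpace F V}
    {a b : ℝ} (hab : a < b) (hS : IsParallelOn cov S a b) (hS' : IsParallelOn cov S' a b)
    (hp : ∀ t ∈ Icc a b, (S t).proj = (S' t).proj)
    (hm : ∀ t ∈ Icc a b, (S t).proj ∈ chartBall E x₀ r) (h0 : S a = S' a) :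
    EqOn S S' (Icc a b) := by
  have hsm := fun t ht => ((contMDiffWithinAt_totalSpace).1 (hS.1 t ht)).1
  have hsm' := fun t ht => ((contMDiffWithinAt_totalSpace).1 (hS'.1 t ht)).1
  have h1 := (h.isParallelOn_iff hab hm hsm).1 hS
  have h2 := (h.isParallelOn_iff hab (fun t ht => hp t ht ▸ hm t ht) hsm').1 hS'
  have hc : ContDiffOn ℝ ∞ (fun t => extChartAt 𝓘(ℝ, E) x₀ (S t).proj) (Icc a b) :=
    ((contMDiffOn_extChartAt (n := ∞)).comp hsm
      fun t ht => by simpa using (hm t ht).1).contDiffOn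
  have e1 : EqOn (fun t => extChartAt 𝓘(ℝ, E) x₀ (S t).proj)
      (fun t => extChartAt 𝓘(ℝ, E) x₀ (S' t).proj) (Icc a b) := fun t ht => by
    simp only [hp t ht]
  have h2' : FormParallel A (fun t => extChartAt 𝓘(ℝ, E) x₀ (S t).proj)
      (fun t => (trivializationAt F V x₀ (S' t)).2) a b := by
    intro t ht
    have := h2 t ht
    rwa [← derivWithin_congr e1 (e1 ht), ← e1 ht] at this
  have := FormParallel.eqOn h.contDiff hab hc h1 h2' (by simp only [h0])
  intro t ht
  have hy := h.chartBall_subset (hm t ht)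
  refine (trivializationAt F V x₀).injOn ((trivializationAt F V x₀).mem_source.2 hy)
    ((trivializationAt F V x₀).mem_source.2 (hp t ht ▸ hy)) (Prod.ext ?_ (this ht))
  exact ((trivializationAt F V x₀).coe_fst' hy).trans
    ((hp t ht).trans ((trivializationAt F V x₀).coe_fst' (hp t ht ▸ hy)).symm)

theorem Tr.pwSmooth {σ : ℝ → M} {a b : ℝ} {p q : TotalSpace F V} (h : Tr cov σ a b p q) :
    PwSmooth E σ a b := by
  obtain ⟨S, h1, h2, -⟩ := h
  refine h1.imp fun a' b' ha _ hb h => ?_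
  have hsm : ContMDiffOn 𝓘(ℝ, ℝ) 𝓘(ℝ, E) ∞ (fun t => (S t).proj) (Icc a' b') :=
    fun t ht => ((contMDiffWithinAt_totalSpace).1 (h.1 t ht)).1
  exact hsm.congr fun t ht => (h2 t ⟨ha.trans ht.1, ht.2.trans hb⟩).symm

/-- On a common refinement into pieces inside chart balls both fields solve the same linear
equation, so equality propagates from the left end of each piece to its right end. -/
theorem Tr.unique (hcov : CovariantDerivative.ContMDiffCovariantDerivative cov ∞)
    {σ : ℝ → M} {a b : ℝ} {p q q' : TotalSpace F V} (h : Tr cov σ a b p q)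
    (h' : Tr cov σ a b p q') : q = q' := by
  have hch := h.pwSmooth.pw_inChartBall hcov
  obtain ⟨S, h1, h2, h3, rfl⟩ := h
  obtain ⟨S', h1', h2', h3', rfl⟩ := h'
  have hm : ∀ {S : ℝ → TotalSpace F V}, ∀ a a' b' b : ℝ, a ≤ a' → a' < b' → b' ≤ b →
    IsParallelOn cov S a b → IsParallelOn cov S a' b' := fun _ _ _ _ ha hab hb h => h.mono ha hab hb
  have := Pw.and (fun _ _ _ _ ha hab hb h => ⟨hm _ _ _ _ ha hab hb h.1, hm _ _ _ _ ha hab hb h.2⟩)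
    (fun _ _ _ _ h1 _ h3 h => h.mono h1 h3) (h1.and hm hm h1')
    (hch.imp fun _ _ _ _ _ h => h.2)
  have h0 : S a = S' a := h3.trans h3'.symm
  clear h1 h1' hch h3 h3' hm
  induction this with
  | base hab h =>
    obtain ⟨⟨ha, hb⟩, x₀, A, r, hf, hmap⟩ := h
    exact hf.eqOn_of_isParallelOn hab ha hb (fun t ht => (h2 t ht).trans (h2' t ht).symm)
      (fun t ht => h2 t ht ▸ hmap ht) h0 (right_mem_Icc.2 hab.le)
  | snoc hpw hbc h ih =>
    obtain ⟨⟨ha, hb⟩, x₀, A, r, hf, hmap⟩ := h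
    have h4 := ih (fun t ht => h2 t ⟨ht.1, ht.2.trans hbc.le⟩)
      (fun t ht => h2' t ⟨ht.1, ht.2.trans hbc.le⟩)
    have h2b := fun t (ht : t ∈ Icc _ _) => h2 t ⟨hpw.lt.le.trans ht.1, ht.2⟩
    have h2b' := fun t (ht : t ∈ Icc _ _) => h2' t ⟨hpw.lt.le.trans ht.1, ht.2⟩
    exact hf.eqOn_of_isParallelOn hbc ha hb (fun t ht => (h2b t ht).trans (h2b' t ht).symm)
      (fun t ht => h2b t ht ▸ hmap ht) h4 (right_mem_Icc.2 hbc.le)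

theorem Tr.split {σ : ℝ → M} {a b c : ℝ} (hab : a < b) (hbc : b < c) {p q : TotalSpace F V}
    (h : Tr cov σ a c p q) : ∃ m : V (σ b), Tr cov σ a b p ⟨σ b, m⟩ ∧ Tr cov σ b c ⟨σ b, m⟩ q := by
  obtain ⟨S, h1, h2, h3, h4⟩ := h
  have hm : ∀ a a' b' b : ℝ, a ≤ a' → a' < b' → b' ≤ b →
    IsParallelOn cov S a b → IsParallelOn cov S a' b' := fun _ _ _ _ ha hab hb h => h.mono ha hab hb
  obtain ⟨m, hSb⟩ : ∃ m : V (σ b), S b = ⟨σ b, m⟩ := by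
    rw [← h2 b ⟨hab.le, hbc.le⟩]
    exact ⟨_, rfl⟩
  exact ⟨m, ⟨S, h1.mono hm le_rfl hab hbc.le, fun t ht => h2 t ⟨ht.1, ht.2.trans hbc.le⟩, h3, hSb⟩,
    ⟨S, h1.mono hm hab.le hbc le_rfl, fun t ht => h2 t ⟨hab.le.trans ht.1, ht.2⟩, hSb, h4⟩⟩

end Transport

/-! ### Transport along paths as a linear isomorphism -/

section PathTransport

variable {E F : Type} [NormedAddCommGroup E] [NormedSpace ℝ E]
  [NormedAddCommGroup F] [NormedSpace ℝ F] [FiniteDimensional ℝ F]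
  [FiniteDimensional ℝ E] {M : Type*} [TopologicalSpace M] [T2Space M] [ChartedSpace E M]
  [IsManifold 𝓘(ℝ, E) ∞ M]
  {V : M → Type*} [TopologicalSpace (TotalSpace F V)]
  [∀ x, AddCommGroup (V x)] [∀ x, Module ℝ (V x)] [∀ x, TopologicalSpace (V x)]
  [∀ x, IsTopologicalAddGroup (V x)] [∀ x, ContinuousSMul ℝ (V x)]
  [FiberBundle F V] [VectorBundle ℝ F V] [ContMDiffVectorBundle ∞ F V 𝓘(ℝ, E)]
  {cov : CovariantDerivative 𝓘(ℝ, E) F V} {x y z : M}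

/-- The restriction of a path to `[s, t]`, reparametrized by `[0, 1]`. -/
def subpathCast {X : Type*} [TopologicalSpace X] {x y p q : X} (γ : Path x y) (s t : unitInterval)
    (hp : p = γ s) (hq : q = γ t) : Path p q :=
  (γ.subpath s t).cast hp hq

theorem subpathCast_extend {X : Type*} [TopologicalSpace X] {x y p q : X} (γ : Path x y)
    (s t : unitInterval) (hp : p = γ s) (hq : q = γ t) :
    EqOn (subpathCast γ s t hp hq).extend
      (fun r => γ.extend (((t : ℝ) - s) * r + s)) (Icc 0 1) := by
  intro r hr
  have h : ((t : ℝ) - s) * r + s ∈ Icc (0 : ℝ) 1 := by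
    have := hr.1; have := hr.2; have := s.2.1; have := t.2.1; have := s.2.2; have := t.2.2
    constructor <;> nlinarith
  rw [subpathCast, Path.extend_cast, Path.extend_apply _ hr]
  simp only
  rw [Path.extend_apply _ h]
  refine congrArg γ (Subtype.ext ?_)
  simp [Icc.convexComb]
  ring

theorem pwSmooth_trans {γ : Path x y} {γ' : Path y z} (h : PiecewiseSmooth E γ)
    (h' : PiecewiseSmooth E γ') : PiecewiseSmooth E (γ.trans γ') := by
  rw [piecewiseSmooth_iff] at h h' ⊢
  have h1 : PwSmooth E (fun t => γ.extend (2 * t + 0)) 0 (1 / 2) :=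
    PwSmooth.comp_affine two_pos (by convert h using 1 <;> norm_num)
  have h2 : PwSmooth E (fun t => γ'.extend (2 * t + -1)) (1 / 2) 1 :=
    PwSmooth.comp_affine two_pos (by convert h' using 1 <;> norm_num)
  exact (h1.congr fun t ht => (Path.extend_trans_of_le_half _ _ ht.2).trans (by simp)).trans
    (h2.congr fun t ht => (Path.extend_trans_of_half_le _ _ ht.1).trans (by simp [sub_eq_add_neg]))

theorem pwSmooth_symm {γ : Path x y} (h : PiecewiseSmooth E γ) : PiecewiseSmooth E γ.symm := by
  rw [piecewiseSmooth_iff] at h ⊢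
  exact h.reverse.congr fun t _ => Path.extend_symm_apply _ _

theorem pwSmooth_refl (x : M) : PiecewiseSmooth E (Path.refl x) := by
  rw [piecewiseSmooth_iff]
  refine Pw.base zero_lt_one ?_
  rw [Path.refl_extend]
  exact contMDiffOn_const

theorem pwSmooth_subpathCast {γ : Path x y} (h : PiecewiseSmooth E γ) {s t : unitInterval}
    (hst : s ≤ t) {p q : M} (hp : p = γ s) (hq : q = γ t) :
    PiecewiseSmooth E (subpathCast γ s t hp hq) := by
  obtain rfl | hst := hst.eq_or_lt
  · subst hp
    subst hq
    convert pwSmooth_refl (E := E) (γ s)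
    simp [subpathCast]
  rw [piecewiseSmooth_iff] at h ⊢
  have hst' : (s : ℝ) < t := hst
  refine PwSmooth.congr (PwSmooth.comp_affine (sub_pos.2 hst') ?_) (subpathCast_extend γ s t hp hq)
  simpa using h.mono s.2.1 hst' t.2.2

/-- `A` is the parallel transport along `γ`. -/
def HasTransport (cov : CovariantDerivative 𝓘(ℝ, E) F V) (γ : Path x y) (A : V x ≃L[ℝ] V y) :
    Prop :=
  ∀ v, IsParallelTransport cov γ v (A v)

theorem HasTransport.piecewiseSmooth {γ : Path x y} {A : V x ≃L[ℝ] V y}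
    (h : HasTransport cov γ A) : PiecewiseSmooth E γ :=
  (piecewiseSmooth_iff γ).2 ((isParallelTransport_iff cov γ 0 _).1 (h 0)).pwSmooth

theorem IsParallelTransport.unique (hcov : CovariantDerivative.ContMDiffCovariantDerivative cov ∞)
    {γ : Path x y} {v : V x} {w w' : V y} (h : IsParallelTransport cov γ v w)
    (h' : IsParallelTransport cov γ v w') : w = w' :=
  TotalSpace.mk_injective _
    (((isParallelTransport_iff _ _ _ _).1 h).unique hcov ((isParallelTransport_iff _ _ _ _).1 h'))

theorem HasTransport.iff (hcov : CovariantDerivative.ContMDiffCovariantDerivative cov ∞)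
    {γ : Path x y} {A : V x ≃L[ℝ] V y} (h : HasTransport cov γ A) {v : V x} {w : V y} :
    IsParallelTransport cov γ v w ↔ w = A v :=
  ⟨fun hw => hw.unique hcov (h v), fun hw => hw ▸ h v⟩

theorem HasTransport.unique (hcov : CovariantDerivative.ContMDiffCovariantDerivative cov ∞)
    {γ : Path x y} {A B : V x ≃L[ℝ] V y} (h : HasTransport cov γ A) (h' : HasTransport cov γ B) :
    A = B := by
  ext v
  exact (h v).unique hcov (h' v)

theorem HasTransport.parallelTransport (hcov : CovariantDerivative.ContMDiffCovariantDerivative cov ∞)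
    {γ : Path x y} {A : V x ≃L[ℝ] V y} (h : HasTransport cov γ A) (v : V x) :
    parallelTransport cov γ v = A v := by
  have hex : ∃ w, IsParallelTransport cov γ v w := ⟨_, h v⟩
  rw [FlatTransport.parallelTransport, dif_pos hex]
  exact hex.choose_spec.unique hcov (h v)

theorem IsParallelTransport.symm {γ : Path x y} {v : V x} {w : V y}
    (h : IsParallelTransport cov γ v w) : IsParallelTransport cov γ.symm w v := by
  rw [isParallelTransport_iff] at h ⊢
  exact h.reverse.congr fun t _ => Path.extend_symm_apply _ _

theorem IsParallelTransport.trans {γ : Path x y} {γ' : Path y z} {u : V x} {v : V y} {w : V z}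
    (h : IsParallelTransport cov γ u v) (h' : IsParallelTransport cov γ' v w) :
    IsParallelTransport cov (γ.trans γ') u w := by
  rw [isParallelTransport_iff] at h h' ⊢
  have h1 : Tr cov (fun t => γ.extend (2 * t + 0)) 0 (1 / 2) ⟨x, u⟩ ⟨y, v⟩ :=
    Tr.comp_affine two_pos (by convert h using 1 <;> norm_num)
  have h2 : Tr cov (fun t => γ'.extend (2 * t + -1)) (1 / 2) 1 ⟨y, v⟩ ⟨z, w⟩ :=
    Tr.comp_affine two_pos (by convert h' using 1 <;> norm_num)
  exact (h1.congr fun t ht => (Path.extend_trans_of_le_half _ _ ht.2).trans (by simp)).trans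
    (h2.congr fun t ht => (Path.extend_trans_of_half_le _ _ ht.1).trans (by simp [sub_eq_add_neg]))

/-- Linear maps exist along the path and along its reverse; a reversed parallel field is parallel,
so by uniqueness they are inverse to each other. -/
theorem exists_hasTransport (hcov : CovariantDerivative.ContMDiffCovariantDerivative cov ∞)
    {γ : Path x y} (hγ : PiecewiseSmooth E γ) : ∃ A, HasTransport cov γ A := by
  have key : ∀ {x y : M} {γ : Path x y}, PiecewiseSmooth E γ →
      ∃ L : V x →L[ℝ] V y, ∀ v, IsParallelTransport cov γ v (L v) := by
    intro x y γ hγ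
    obtain ⟨L, hL⟩ := exists_tr hcov ((piecewiseSmooth_iff γ).1 hγ)
    have h0 : γ.extend 0 = x := γ.extend_zero
    have h1 : γ.extend 1 = y := γ.extend_one
    have hT := fun v w => isParallelTransport_iff cov γ v w
    -- The end points of the extended path equal x and y only propositionally. With the curve
    -- generalized, these equalities can be substituted into the fibres.
    generalize γ.extend = σ at *
    clear hγ
    subst h0 h1
    exact ⟨L, fun v => (hT _ _).2 (hL v)⟩
  obtain ⟨L, hL⟩ := key hγ
  obtain ⟨L', hL'⟩ := key (pwSmooth_symm hγ)
  refine ⟨ContinuousLinearEquiv.equivOfInverse L L' (fun v => ?_) (fun v => ?_), hL⟩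
  · exact (hL' (L v)).unique hcov (hL v).symm
  · have := (hL' v).symm
    rw [Path.symm_symm] at this
    exact (hL (L' v)).unique hcov this

theorem HasTransport.trans {γ : Path x y} {γ' : Path y z} {A : V x ≃L[ℝ] V y} {B : V y ≃L[ℝ] V z}
    (h : HasTransport cov γ A) (h' : HasTransport cov γ' B) :
    HasTransport cov (γ.trans γ') (A.trans B) := fun v => (h v).trans (h' _)

theorem HasTransport.symm {γ : Path x y} {A : V x ≃L[ℝ] V y} (h : HasTransport cov γ A) :
    HasTransport cov γ.symm A.symm := fun v => by
  simpa using (h (A.symm v)).symm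

/-- The constant path is its own square, so its transport is an invertible idempotent. -/
theorem hasTransport_refl (hcov : CovariantDerivative.ContMDiffCovariantDerivative cov ∞) (x : M) :
    HasTransport cov (Path.refl x) (ContinuousLinearEquiv.refl ℝ (V x)) := by
  obtain ⟨A, hA⟩ := exists_hasTransport hcov (pwSmooth_refl (E := E) x)
  have h1 := hA.trans hA
  rw [Path.refl_trans_refl] at h1
  have h2 := h1.unique hcov hA
  have h3 : A = ContinuousLinearEquiv.refl ℝ (V x) := by
    ext v
    exact A.injective (DFunLike.congr_fun h2 v)
  rwa [h3] at hA

/-- The path over [s, u] and the concatenation are different parametrizations, compared through one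
parallel field over [s, u] cut at t. The cases s = t and t = u are treated separately because `Tr`
needs intervals of positive length. -/
theorem HasTransport.subpathCast_split
    (hcov : CovariantDerivative.ContMDiffCovariantDerivative cov ∞) {γ : Path x y}
    {s t u : unitInterval} (hst : s ≤ t) (htu : t ≤ u) {p m q : M}
    (hp : p = γ s) (hm : m = γ t) (hq : q = γ u) {A : V p ≃L[ℝ] V q}
    (h : HasTransport cov (subpathCast γ s u hp hq) A) :
    HasTransport cov ((subpathCast γ s t hp hm).trans (subpathCast γ t u hm hq)) A := by
  obtain rfl | hst := hst.eq_or_lt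
  · subst hp hm
    have h2 : subpathCast γ s s rfl rfl = Path.refl (γ s) := by simp [subpathCast]
    rw [h2]
    exact (hasTransport_refl hcov _).trans h
  obtain rfl | htu := htu.eq_or_lt
  · subst hq hm
    have h2 : subpathCast γ t t rfl rfl = Path.refl (γ t) := by simp [subpathCast]
    rw [h2]
    exact h.trans (hasTransport_refl hcov _)
  have hst' : (s : ℝ) < t := hst
  have htu' : (t : ℝ) < u := htu
  have huss := sub_pos.2 (hst'.trans htu')
  intro v
  have h1 := (isParallelTransport_iff _ _ _ _).1 (h v)
  have h2 : Tr cov (fun r => γ.extend (((u : ℝ) - s) * r + s)) 0 1 ⟨p, v⟩ ⟨q, A v⟩ :=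
    h1.congr (subpathCast_extend γ s u hp hq).symm
  -- Undo the reparametrization by the inverse affine map.
  have h3 : Tr cov γ.extend s u ⟨p, v⟩ ⟨q, A v⟩ := by
    have := Tr.comp_affine (a := s) (b := u) (α := ((u : ℝ) - s)⁻¹) (β := -(((u : ℝ) - s)⁻¹ * s))
      (inv_pos.2 huss) (σ := fun r => γ.extend (((u : ℝ) - s) * r + s)) (p := ⟨p, v⟩)
      (q := ⟨q, A v⟩) (by
        convert h2 using 1
        · ring
        · rw [← sub_eq_add_neg, ← mul_sub, inv_mul_cancel₀ huss.ne'])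
    refine this.congr fun r _ => congrArg γ.extend ?_
    field_simp
    ring
  obtain ⟨w, h4, h5⟩ := h3.split hst' htu'
  have hm' : m = γ.extend t := by rw [hm, Path.extend_extends']
  generalize hσ : γ.extend t = m' at *
  subst hm'
  refine IsParallelTransport.trans (v := w) ?_ ?_
  · rw [isParallelTransport_iff]
    exact (Tr.comp_affine (sub_pos.2 hst') (by simpa using h4)).congr (subpathCast_extend γ s t hp hm)
  · rw [isParallelTransport_iff]
    exact (Tr.comp_affine (sub_pos.2 htu') (by simpa using h5)).congr (subpathCast_extend γ t u hm hq)

end PathTransport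

/-! ### Congruences on paths -/

section PathCongruence

theorem range_subpathCast_subset {X : Type*} [TopologicalSpace X] {x y p q : X} {γ : Path x y}
    {s t : unitInterval} (hst : s ≤ t) (hp : p = γ s) (hq : q = γ t) {U : Set X}
    (h : MapsTo γ (Icc s t) U) : range (subpathCast γ s t hp hq) ⊆ U := by
  have h1 : range (subpathCast γ s t hp hq) = range (γ.subpath s t) := rfl
  rw [h1, Path.range_subpath_of_le _ _ _ hst]
  exact h.image_subset

theorem subpathCast_zero_one {X : Type*} [TopologicalSpace X] {x y : X} (γ : Path x y)
    {u : unitInterval} (hu : u = 1) (hp : x = γ 0) (hq : y = γ u) :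
    subpathCast γ 0 u hp hq = γ := by
  subst hu
  ext s
  simp [subpathCast]

/-- A congruence relation `r` on a class `P` of paths. -/
structure PathCongruence (X : Type*) [TopologicalSpace X] where
  P : ∀ {x y : X}, Path x y → Prop
  r : ∀ {x y : X}, Path x y → Path x y → Prop
  P_refl : ∀ x, P (Path.refl x)
  P_trans : ∀ {x y z : X} {a : Path x y} {b : Path y z}, P a → P b → P (a.trans b)
  P_sub : ∀ {x y : X} {a : Path x y}, P a → ∀ {s t : unitInterval}, s ≤ t →
    ∀ {p q : X} (hp : p = a s) (hq : q = a t), P (subpathCast a s t hp hq)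
  refl : ∀ {x y : X} {a : Path x y}, P a → r a a
  symm : ∀ {x y : X} {a b : Path x y}, r a b → r b a
  trans : ∀ {x y : X} {a b c : Path x y}, r a b → r b c → r a c
  congr : ∀ {x y z : X} {a a' : Path x y} {b b' : Path y z}, r a a' → r b b' →
    r (a.trans b) (a'.trans b')
  assoc : ∀ {x y z w : X} {a : Path x y} {b : Path y z} {c : Path z w}, P a → P b → P c →
    r ((a.trans b).trans c) (a.trans (b.trans c))
  unit : ∀ {x y : X} {a : Path x y}, P a → r (a.trans (Path.refl y)) a
  split : ∀ {x y : X} {a : Path x y}, P a → ∀ {s t u : unitInterval}, s ≤ t → t ≤ u →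
    ∀ {p m q : X} (hp : p = a s) (hm : m = a t) (hq : q = a u),
      r (subpathCast a s u hp hq) ((subpathCast a s t hp hm).trans (subpathCast a t u hm hq))

namespace PathCongruence

variable {X : Type*} [TopologicalSpace X] (R : PathCongruence X)

/-- All paths in `U` with the same end points are congruent. -/
def Good (U : Set X) : Prop :=
  ∀ ⦃x y : X⦄ ⦃a b : Path x y⦄, R.P a → R.P b → range a ⊆ U → range b ⊆ U → R.r a b

/-- Every point has a good open neighbourhood. -/
def LocallyGood : Prop := ∀ x, ∃ U, IsOpen U ∧ x ∈ U ∧ R.Good U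

/-- Every point has a basis of neighbourhoods that are connected by paths of the given class. -/
def LocallyConnected : Prop := ∀ x, ∀ W ∈ 𝓝 x, ∃ U ⊆ W, IsOpen U ∧ x ∈ U ∧
  ∀ p ∈ U, ∀ q ∈ U, ∃ a : Path p q, R.P a ∧ range a ⊆ U

variable {R}

/-- A ladder: cut γ into pieces inside good sets, let a and b follow γ piece by piece, and join
a(t_i) to b(t_i) by a short rung. Each cell of the ladder lies in one good set, so its two ways
round are congruent. -/
theorem exists_nhds_related (hgood : R.LocallyGood) (hconn : R.LocallyConnected) {x y : X}
    (γ : Path x y) :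
    ∃ N ∈ 𝓝 γ, ∀ a ∈ N, ∀ b ∈ N, R.P a → R.P b → R.r a b := by
  choose U hUo hxU hUg using hgood
  obtain ⟨t, ht0, htm, ⟨n, hn⟩, htc⟩ := exists_monotone_Icc_subset_open_cover_unitInterval
    (c := fun z => γ ⁻¹' U z) (fun z => (hUo z).preimage γ.continuous)
    (fun s _ => mem_iUnion.2 ⟨γ s, hxU (γ s)⟩)
  choose c hc using htc
  -- A rung at t_i borders the cells i - 1 and i, so it must lie in both good sets. For i = 0
  -- truncated subtraction makes them coincide.
  have hWn : ∀ i, U (c i) ∩ U (c (i - 1)) ∈ 𝓝 (γ (t i)) := by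
    intro i
    refine ((hUo _).inter (hUo _)).mem_nhds ⟨hc i ⟨le_rfl, htm (Nat.le_succ i)⟩, ?_⟩
    obtain _ | i := i
    · exact hc 0 ⟨le_rfl, htm (Nat.le_succ 0)⟩
    · exact hc i ⟨htm (Nat.le_succ i), le_rfl⟩
  choose W hWU hWo htW hWc using fun i => hconn (γ (t i)) _ (hWn i)
  have hcont : Continuous ((↑) : Path x y → C(unitInterval, X)) := continuous_induced_dom
  refine ⟨⋂ i ∈ Finset.range (n + 1), ({a : Path x y | MapsTo a (Icc (t i) (t (i + 1))) (U (c i))} ∩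
    {a : Path x y | MapsTo a {t i} (W i)}), IsOpen.mem_nhds ?_ ?_, ?_⟩
  · refine isOpen_biInter_finset fun i _ => IsOpen.inter ?_ ?_
    · exact (ContinuousMap.isOpen_setOfPred_mapsTo isCompact_Icc (hUo _)).preimage hcont
    · exact (ContinuousMap.isOpen_setOfPred_mapsTo isCompact_singleton (hWo _)).preimage hcont
  · simp only [mem_iInter]
    exact fun i _ => ⟨hc i, mapsTo_singleton.2 (htW i)⟩
  intro a ha b hb hPa hPb
  simp only [mem_iInter, Finset.mem_range, Nat.lt_succ_iff] at ha hb
  have haU : ∀ i ≤ n, MapsTo a (Icc (t i) (t (i + 1))) (U (c i)) := fun i hi => (ha i hi).1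
  have hbU : ∀ i ≤ n, MapsTo b (Icc (t i) (t (i + 1))) (U (c i)) := fun i hi => (hb i hi).1
  have haW : ∀ i ≤ n, a (t i) ∈ W i := fun i hi => mapsTo_singleton.1 (ha i hi).2
  have hbW : ∀ i ≤ n, b (t i) ∈ W i := fun i hi => mapsTo_singleton.1 (hb i hi).2
  have htrans : ∀ {p q w : X} {d : Path p q} {d' : Path q w} {O : Set X}, range d ⊆ O →
      range d' ⊆ O → range (d.trans d') ⊆ O := fun h1 h2 => by
    rw [Path.trans_range]
    exact union_subset h1 h2
  -- Quantifying over every rung `d` at t_i lets the induction step choose the rung at t_i for the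
  -- cell being crossed.
  have key : ∀ i ≤ n, ∀ {p q : X} (hp : p = a (t i)) (hq : q = b (t i)) (d : Path p q), R.P d →
      range d ⊆ W i → R.r ((subpathCast a 0 (t i) a.source.symm hp).trans d)
        (subpathCast b 0 (t i) b.source.symm hq) := by
    intro i
    induction i with
    | zero =>
      intro hi p q hp hq d hd hdW
      have hle : Icc (0 : unitInterval) (t 0) ⊆ Icc (t 0) (t 1) := by
        rw [ht0, Icc_self, singleton_subset_iff, ← ht0]
        exact ⟨le_rfl, htm zero_le_one⟩
      have h0 : (0 : unitInterval) ≤ t 0 := ht0.ge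
      exact hUg _ (R.P_trans (R.P_sub hPa h0 _ _) hd) (R.P_sub hPb h0 _ _)
        (htrans (range_subpathCast_subset h0 _ _ ((haU 0 hi).mono_left hle))
          (hdW.trans ((hWU 0).trans inter_subset_left)))
        (range_subpathCast_subset h0 _ _ ((hbU 0 hi).mono_left hle))
    | succ i ih =>
      intro hi p q hp hq d hd hdW
      have hi' : i ≤ n := (Nat.le_succ i).trans hi
      obtain ⟨d', hd', hdW'⟩ := hWc i _ (haW i hi') _ (hbW i hi')
      have h0 : (0 : unitInterval) ≤ t i := unitInterval.nonneg'
      have h1 : t i ≤ t (i + 1) := htm (Nat.le_succ i)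
      have hPa1 := R.P_sub hPa h0 a.source.symm rfl
      have hPa2 := R.P_sub hPa h1 rfl hp
      have hPb1 := R.P_sub hPb h0 b.source.symm rfl
      have hPb2 := R.P_sub hPb h1 rfl hq
      have e1 := R.congr (R.split hPa h0 h1 a.source.symm rfl hp) (R.refl hd)
      have e2 := R.assoc hPa1 hPa2 hd
      have e3 : R.r ((subpathCast a (t i) (t (i + 1)) rfl hp).trans d)
          (d'.trans (subpathCast b (t i) (t (i + 1)) rfl hq)) :=
        hUg (c i) (R.P_trans hPa2 hd) (R.P_trans hd' hPb2)
          (htrans (range_subpathCast_subset h1 _ _ (haU i hi'))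
            (hdW.trans ((hWU _).trans inter_subset_right)))
          (htrans (hdW'.trans ((hWU _).trans inter_subset_left))
            (range_subpathCast_subset h1 _ _ (hbU i hi')))
      have e4 := R.congr (R.refl hPa1) e3
      have e5 := R.symm (R.assoc hPa1 hd' hPb2)
      have e6 := R.congr (ih hi' rfl rfl d' hd' hdW') (R.refl hPb2)
      have e7 := R.symm (R.split hPb h0 h1 b.source.symm rfl hq)
      exact R.trans e1 (R.trans e2 (R.trans e4 (R.trans e5 (R.trans e6 e7))))
  have h1 : t n = 1 := hn n le_rfl
  -- At time 1 both paths are at y, so the constant path is the last rung.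
  have := key n le_rfl (p := y) (q := y) (by rw [h1, a.target]) (by rw [h1, b.target])
    (Path.refl y) (R.P_refl y) (by
      rw [Path.refl_range, singleton_subset_iff]
      simpa [h1] using haW n le_rfl)
  rw [subpathCast_zero_one _ h1, subpathCast_zero_one _ h1] at this
  exact R.trans (R.symm (R.unit hPa)) this

/-- Let Z be the set of continuous paths near which every path of the class is congruent to γ₀. It
is open by definition and closed because nearby paths of the class are congruent and the class is
dense. A homotopy is a continuous map of the unit interval into the path space that starts in Z. -/
theorem related_of_homotopic (hgood : R.LocallyGood) (hconn : R.LocallyConnected)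
    (hdense : ∀ {x y : X} (γ : Path x y), ∀ N ∈ 𝓝 γ, ∃ a ∈ N, R.P a) {x y : X}
    {γ₀ γ₁ : Path x y} (h₀ : R.P γ₀) (h₁ : R.P γ₁) (h : γ₀.Homotopic γ₁) : R.r γ₀ γ₁ := by
  obtain ⟨H⟩ := h
  let Z : Set (Path x y) := {a | ∀ᶠ b in 𝓝 a, R.P b → R.r γ₀ b}
  have hZo : IsOpen Z := isOpen_iff_eventually.2 fun a ha => eventually_eventually_nhds.2 ha
  -- If some b in Z is close to a, density gives a path c of the class near b; it is congruent to γ₀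
  -- and to every path of the class near a, so a is in Z.
  have hZc : IsClosed Z := by
    refine ⟨isOpen_iff_mem_nhds.2 fun a ha => ?_⟩
    obtain ⟨N, hN, hNr⟩ := exists_nhds_related hgood hconn a
    filter_upwards [eventually_mem_nhds_iff.2 hN] with b hb hbZ
    obtain ⟨c, ⟨hcN, hc⟩, hPc⟩ := hdense b _ (Filter.inter_mem hb hbZ)
    refine ha ?_
    filter_upwards [hN] with d hd hPd
    exact R.trans (hc hPc) (hNr c hcN d hd hPc hPd)
  have hcont : Continuous fun s => H.eval s := by
    refine continuous_induced_rng.2 ?_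
    exact H.toHomotopy.curry.continuous
  have hpre : (fun s => H.eval s) ⁻¹' Z = univ := by
    refine IsClopen.eq_univ ⟨hZc.preimage hcont, hZo.preimage hcont⟩ ⟨0, ?_⟩
    obtain ⟨N, hN, hNr⟩ := exists_nhds_related hgood hconn γ₀
    have : H.eval 0 = γ₀ := H.eval_zero
    simp only [mem_preimage, this]
    filter_upwards [hN] with b hb hPb
    exact hNr _ (mem_of_mem_nhds hN) b hb h₀ hPb
  have h1 : H.eval 1 ∈ Z := (hpre.ge (mem_univ (1 : unitInterval)) :)
  rw [H.eval_one] at h1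
  exact h1.self_of_nhds h₁

/-- Countably many neighbourhoods, on each of which all paths of the class are congruent, cover the
second countable path space. -/
theorem exists_countable_representatives (hgood : R.LocallyGood) (hconn : R.LocallyConnected)
    (x y : X) [SecondCountableTopology (Path x y)] :
    ∃ S : Set (Path x y), S.Countable ∧ ∀ γ, R.P γ → ∃ a ∈ S, R.P a ∧ R.r a γ := by
  classical
  choose N hN hNr using fun γ : Path x y => exists_nhds_related hgood hconn γ
  obtain ⟨s, hs, hsu⟩ := TopologicalSpace.countable_cover_nhds hN
  refine ⟨(fun γ => if h : ∃ a ∈ N γ, R.P a then h.choose else γ) '' s, hs.image _, fun γ hγ => ?_⟩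
  obtain ⟨b, hb, hγb⟩ := mem_iUnion₂.1 (hsu.ge (mem_univ γ))
  have h : ∃ a ∈ N b, R.P a := ⟨γ, hγb, hγ⟩
  refine ⟨_, mem_image_of_mem _ hb, ?_⟩
  simp only [dif_pos h]
  exact ⟨h.choose_spec.2, hNr b _ h.choose_spec.1 _ hγb h.choose_spec.2 hγ⟩

end PathCongruence

/-- The homotopy relation. -/
def homotopyCongruence (X : Type*) [TopologicalSpace X] : PathCongruence X where
  P _ := True
  r := Path.Homotopic
  P_refl _ := trivial
  P_trans _ _ := trivial
  P_sub _ _ _ _ _ _ _ _ := trivial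
  refl _ := Path.Homotopic.refl _
  symm h := Path.Homotopic.symm h
  trans h h' := Path.Homotopic.trans h h'
  congr := Path.Homotopic.hcomp
  assoc _ _ _ := ⟨Path.Homotopy.transAssoc _ _ _⟩
  unit _ := ⟨Path.Homotopy.transRefl _⟩
  split _ _ _ _ _ _ _ _ _ hp hm hq := by
    subst hp hm hq
    exact ⟨(Path.Homotopy.subpathTransSubpath _ _ _ _).symm⟩

end PathCongruence

/-! ### Paths in chart balls, density of piecewise smooth paths -/

section ChartBall

variable {E : Type} [NormedAddCommGroup E] [NormedSpace ℝ E]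
  [FiniteDimensional ℝ E] {M : Type*} [TopologicalSpace M] [T2Space M] [ChartedSpace E M]
  [IsManifold 𝓘(ℝ, E) ∞ M]

/-- `r` is the radius of a ball contained in the target of the chart at `x₀`. -/
def IsChartRadius (E : Type) [NormedAddCommGroup E] [NormedSpace ℝ E] {M : Type*}
    [TopologicalSpace M] [ChartedSpace E M] (x₀ : M) (r : ℝ) : Prop :=
  0 < r ∧ Metric.ball (extChartAt 𝓘(ℝ, E) x₀ x₀) r ⊆ (extChartAt 𝓘(ℝ, E) x₀).target

variable {x₀ : M} {r : ℝ}

theorem mem_chartBall (x₀ : M) (hr : 0 < r) : x₀ ∈ chartBall E x₀ r :=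
  ⟨mem_extChartAt_source x₀, Metric.mem_ball_self hr⟩

theorem exists_chartBall_subset (x₀ : M) {W : Set M} (hW : W ∈ 𝓝 x₀) :
    ∃ r, IsChartRadius E x₀ r ∧ ∀ r' ≤ r, chartBall E x₀ r' ⊆ W := by
  have h1 : (extChartAt 𝓘(ℝ, E) x₀).symm ⁻¹' W ∈ 𝓝 (extChartAt 𝓘(ℝ, E) x₀ x₀) := by
    refine (continuousAt_extChartAt_symm x₀).preimage_mem_nhds ?_
    rwa [extChartAt_to_inv]
  obtain ⟨r, hr, hr'⟩ := Metric.mem_nhds_iff.1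
    (Filter.inter_mem h1 (extChartAt_target_mem_nhds (I := 𝓘(ℝ, E)) x₀))
  refine ⟨r, ⟨hr, hr'.trans inter_subset_right⟩, fun r' hrr y hy => ?_⟩
  have := (hr' (Metric.ball_subset_ball hrr hy.2)).1
  rwa [mem_preimage, (extChartAt 𝓘(ℝ, E) x₀).left_inv hy.1] at this

theorem IsChartRadius.symm_mem (h : IsChartRadius E x₀ r) {v : E}
    (hv : v ∈ Metric.ball (extChartAt 𝓘(ℝ, E) x₀ x₀) r) :
    (extChartAt 𝓘(ℝ, E) x₀).symm v ∈ chartBall E x₀ r := by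
  refine ⟨(extChartAt 𝓘(ℝ, E) x₀).map_target (h.2 hv), ?_⟩
  rwa [mem_preimage, (extChartAt 𝓘(ℝ, E) x₀).right_inv (h.2 hv)]

/-- The straight-line homotopy in the chart; convexity keeps it in the ball. -/
theorem IsChartRadius.homotopic (h : IsChartRadius E x₀ r) {x y : M} {a b : Path x y}
    (ha : range a ⊆ chartBall E x₀ r) (hb : range b ⊆ chartBall E x₀ r) : a.Homotopic b := by
  set φ := extChartAt 𝓘(ℝ, E) x₀ with hφ
  have hmem : ∀ z : unitInterval × unitInterval, φ (a z.2) + (z.1 : ℝ) • (φ (b z.2) - φ (a z.2)) ∈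
      Metric.ball (extChartAt 𝓘(ℝ, E) x₀ x₀) r := fun z =>
    scale_mem_ball (ha (mem_range_self _)).2 (hb (mem_range_self _)) z.1.2
  have hca : Continuous fun t => φ (a t) := continuousOn_univ.1
    ((continuousOn_extChartAt x₀).comp a.continuous.continuousOn
      fun t _ => (ha (mem_range_self t)).1)
  have hcb : Continuous fun t => φ (b t) := continuousOn_univ.1
    ((continuousOn_extChartAt x₀).comp b.continuous.continuousOn
      fun t _ => (hb (mem_range_self t)).1)
  have hc : Continuous fun z : unitInterval × unitInterval =>
      φ (a z.2) + (z.1 : ℝ) • (φ (b z.2) - φ (a z.2)) :=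
    (hca.comp continuous_snd).add ((continuous_subtype_val.comp continuous_fst).smul
      ((hcb.comp continuous_snd).sub (hca.comp continuous_snd)))
  have hx : φ.symm (φ x) = x := φ.left_inv (by
    have := (ha (mem_range_self 0)).1
    rwa [a.source] at this)
  have hy : φ.symm (φ y) = y := φ.left_inv (by
    have := (ha (mem_range_self 1)).1
    rwa [a.target] at this)
  exact ⟨{
    toFun := fun z => φ.symm (φ (a z.2) + (z.1 : ℝ) • (φ (b z.2) - φ (a z.2)))
    continuous_toFun := continuousOn_univ.1 ((continuousOn_extChartAt_symm x₀).comp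
      hc.continuousOn fun z _ => h.2 (hmem z))
    map_zero_left := fun t => by
      simpa using φ.left_inv (ha (mem_range_self t)).1
    map_one_left := fun t => by
      simpa using φ.left_inv (hb (mem_range_self t)).1
    prop' := fun s t ht => by
      obtain rfl | ht := ht
      · simp [hx]
      · rw [mem_singleton_iff] at ht
        subst ht
        simp [hy] }⟩

theorem IsChartRadius.exists_path (h : IsChartRadius E x₀ r) {p q : M}
    (hp : p ∈ chartBall E x₀ r) (hq : q ∈ chartBall E x₀ r) :
    ∃ a : Path p q, PiecewiseSmooth E a ∧ range a ⊆ chartBall E x₀ r := by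
  set φ := extChartAt 𝓘(ℝ, E) x₀ with hφ
  have hmem : ∀ t ∈ Icc (0 : ℝ) 1, φ p + t • (φ q - φ p) ∈
      Metric.ball (extChartAt 𝓘(ℝ, E) x₀ x₀) r := fun t ht => scale_mem_ball hp.2 hq ht
  have hs : ContMDiffOn 𝓘(ℝ, ℝ) 𝓘(ℝ, E) ∞ (fun t : ℝ => φ.symm (φ p + t • (φ q - φ p)))
      (Icc 0 1) := (contMDiffOn_extChartAt_symm x₀).comp
    (ContDiff.contMDiff (by fun_prop)).contMDiffOn fun t ht => h.2 (hmem t ht)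
  let a : Path p q :=
    { toFun := fun t => φ.symm (φ p + (t : ℝ) • (φ q - φ p))
      continuous_toFun := continuousOn_iff_continuous_domRestrict.1 hs.continuousOn
      source' := by simpa using φ.left_inv hp.1
      target' := by simpa using φ.left_inv hq.1 }
  refine ⟨a, (piecewiseSmooth_iff a).2 (.base zero_lt_one (hs.congr fun t ht => ?_)), ?_⟩
  · rw [Path.extend_apply _ ht]
    rfl
  · rintro _ ⟨t, rfl⟩
    exact h.symm_mem (hmem t t.2)

theorem PwSmooth.glue {σ σ' : ℝ → M} {a b c : ℝ} (h : PwSmooth E σ a b) (h' : PwSmooth E σ' b c)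
    (hb : σ b = σ' b) : ∃ τ, PwSmooth E τ a c ∧ EqOn τ σ (Icc a b) ∧ EqOn τ σ' (Icc b c) := by
  have e1 : EqOn (fun t => if t ≤ b then σ t else σ' t) σ (Icc a b) :=
    fun t ht => if_pos ht.2
  have e2 : EqOn (fun t => if t ≤ b then σ t else σ' t) σ' (Icc b c) := by
    intro t ht
    obtain rfl | hlt := ht.1.eq_or_lt
    · simp [hb]
    · exact if_neg hlt.not_ge
  exact ⟨_, (h.congr e1).trans (h'.congr e2), e1, e2⟩

/-- The compact-open topology is that of uniform convergence for a metric on M. Subdivide so that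
each piece of γ lies in a chart ball of small diameter, and replace the pieces by coordinate
segments with the same end points. -/
theorem exists_piecewiseSmooth_mem_nhds [SecondCountableTopology M] {x y : M} (γ : Path x y)
    {N : Set (Path x y)} (hN : N ∈ 𝓝 γ) : ∃ a ∈ N, PiecewiseSmooth E a := by
  have : LocallyCompactSpace M := ChartedSpace.locallyCompactSpace E M
  let _ : MetricSpace M := TopologicalSpace.metrizableSpaceMetric M
  obtain ⟨N', hN', hNN⟩ := mem_nhds_induced ((↑) : Path x y → C(unitInterval, M)) γ N |>.1 hN
  obtain ⟨ε, hε, hεN⟩ := Metric.mem_nhds_iff.1 hN'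
  -- Two points of such a chart ball are within ε / 2 of its centre, hence at distance less than ε
  -- from each other.
  choose r hr hrW using fun z : M => exists_chartBall_subset (E := E) z
    (Metric.ball_mem_nhds z (half_pos hε))
  let Q : ℝ → ℝ → Prop := fun a b => ∃ z, MapsTo γ.extend (Icc a b) (chartBall E z (r z))
  have hQ : Pw Q 0 1 := by
    refine Pw.of_local zero_lt_one (c := fun z => {t : Icc (0 : ℝ) 1 | γ.extend t ∈
      chartBall E z (r z)}) (fun z => (isOpen_chartBall z _).preimage (by fun_prop))
      (fun t _ => mem_iUnion.2 ⟨γ.extend t, mem_chartBall _ (hr _).1⟩)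
      fun z a b ha hab hb h => ⟨z, fun t ht => h t ⟨ha.trans ht.1, ht.2.trans hb⟩ ht⟩
  have base : ∀ {a b}, a < b → Q a b → ∃ σ : ℝ → M, PwSmooth E σ a b ∧ σ a = γ.extend a ∧
      σ b = γ.extend b ∧ ∀ t ∈ Icc a b, dist (σ t) (γ.extend t) < ε := by
    rintro a b hab ⟨z, hz⟩
    obtain ⟨d, hd, hdr⟩ := (hr z).exists_path (hz (left_mem_Icc.2 hab.le))
      (hz (right_mem_Icc.2 hab.le))
    have hba := sub_pos.2 hab
    have h0 : (b - a)⁻¹ * b + -((b - a)⁻¹ * a) = 1 := by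
      rw [← sub_eq_add_neg, ← mul_sub, inv_mul_cancel₀ hba.ne']
    refine ⟨fun t => d.extend ((b - a)⁻¹ * t + -((b - a)⁻¹ * a)),
      PwSmooth.comp_affine (inv_pos.2 hba) ?_, by simp, ?_, fun t ht => ?_⟩
    · rw [h0, add_neg_cancel]
      exact (piecewiseSmooth_iff d).1 hd
    · simp only
      rw [h0, Path.extend_one]
    · have h1 : d.extend ((b - a)⁻¹ * t + -((b - a)⁻¹ * a)) ∈ chartBall E z (r z) := by
        refine hdr ?_
        rw [← Path.extend_range]
        exact mem_range_self _
      have h2 := hrW z _ le_rfl h1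
      have h3 := hrW z _ le_rfl (hz ht)
      rw [Metric.mem_ball] at h2 h3
      have := dist_triangle_right (d.extend ((b - a)⁻¹ * t + -((b - a)⁻¹ * a))) (γ.extend t) z
      linarith
  have key : ∀ {a b}, Pw Q a b → ∃ σ : ℝ → M, PwSmooth E σ a b ∧ σ a = γ.extend a ∧
      σ b = γ.extend b ∧ ∀ t ∈ Icc a b, dist (σ t) (γ.extend t) < ε := by
    intro a b h
    induction h with
    | base hab h => exact base hab h
    | snoc hab hbc h ih =>
      obtain ⟨σ, h1, h2, h3, h4⟩ := ih
      obtain ⟨σ', h1', h2', h3', h4'⟩ := base hbc h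
      obtain ⟨τ, hτ, e1, e2⟩ := h1.glue h1' (h3.trans h2'.symm)
      refine ⟨τ, hτ, (e1 (left_mem_Icc.2 hab.lt.le)).trans h2,
        (e2 (right_mem_Icc.2 hbc.le)).trans h3', fun t ht => ?_⟩
      obtain hb | hb := le_total t _
      · rw [e1 ⟨ht.1, hb⟩]
        exact h4 t ⟨ht.1, hb⟩
      · rw [e2 ⟨hb, ht.2⟩]
        exact h4' t ⟨hb, ht.2⟩
  obtain ⟨σ, h1, h2, h3, h4⟩ := key hQ
  let a : Path x y :=
    { toFun := fun t => σ t
      continuous_toFun := continuousOn_iff_continuous_domRestrict.1 h1.continuousOn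
      source' := by simpa using h2
      target' := by simpa using h3 }
  refine ⟨a, hNN (hεN ?_), (piecewiseSmooth_iff a).2 (h1.congr fun t ht => ?_)⟩
  · rw [Metric.mem_ball, ContinuousMap.dist_lt_iff hε]
    intro t
    have := h4 t t.2
    rwa [Path.extend_extends'] at this
  · rw [Path.extend_apply _ ht]
    rfl

theorem locallyGood_homotopyCongruence (E : Type) [NormedAddCommGroup E] [NormedSpace ℝ E]
    [FiniteDimensional ℝ E] {M : Type*} [TopologicalSpace M] [T2Space M] [ChartedSpace E M]
    [IsManifold 𝓘(ℝ, E) ∞ M] :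
    (homotopyCongruence M).LocallyGood := by
  intro x
  obtain ⟨r, hr, -⟩ := exists_chartBall_subset (E := E) x Filter.univ_mem
  exact ⟨chartBall E x r, isOpen_chartBall x r, mem_chartBall x hr.1,
    fun _ _ _ _ _ _ ha hb => hr.homotopic ha hb⟩

theorem exists_piecewiseSmooth_connected_nhds (x : M) {W : Set M} (hW : W ∈ 𝓝 x) :
    ∃ U ⊆ W, IsOpen U ∧ x ∈ U ∧
      ∀ p ∈ U, ∀ q ∈ U, ∃ a : Path p q, PiecewiseSmooth E a ∧ range a ⊆ U := by
  obtain ⟨r, hr, hrW⟩ := exists_chartBall_subset (E := E) x hW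
  exact ⟨chartBall E x r, hrW r le_rfl, isOpen_chartBall x r, mem_chartBall x hr.1,
    fun p hp q hq => hr.exists_path hp hq⟩

variable (E) in
-- Paths close to γ are homotopic to γ, by the ladder argument for the homotopy relation, and
-- piecewise smooth paths are dense.
theorem exists_piecewiseSmooth_homotopic [SecondCountableTopology M] {x y : M} (γ : Path x y) :
    ∃ a : Path x y, PiecewiseSmooth E a ∧ a.Homotopic γ := by
  obtain ⟨N, hN, hr⟩ := PathCongruence.exists_nhds_related (locallyGood_homotopyCongruence E)
    (fun x W hW => by
      obtain ⟨U, h1, h2, h3, h4⟩ := exists_piecewiseSmooth_connected_nhds (E := E) x hW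
      refine ⟨U, h1, h2, h3, fun p hp q hq => ?_⟩
      obtain ⟨a, -, ha⟩ := h4 p hp q hq
      exact ⟨a, trivial, ha⟩) γ
  obtain ⟨a, haN, ha⟩ := exists_piecewiseSmooth_mem_nhds (E := E) γ hN
  exact ⟨a, ha, hr a haN γ (mem_of_mem_nhds hN) trivial trivial⟩

end ChartBall

/-! ### Parallel transport modulo a family of subgroups -/

section TransportCongruence

variable {E F : Type} [NormedAddCommGroup E] [NormedSpace ℝ E]
  [NormedAddCommGroup F] [NormedSpace ℝ F] [FiniteDimensional ℝ F]
  [FiniteDimensional ℝ E] {M : Type*} [TopologicalSpace M] [T2Space M] [ChartedSpace E M]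
  [IsManifold 𝓘(ℝ, E) ∞ M]
  {V : M → Type*} [TopologicalSpace (TotalSpace F V)]
  [∀ x, AddCommGroup (V x)] [∀ x, Module ℝ (V x)] [∀ x, TopologicalSpace (V x)]
  [∀ x, IsTopologicalAddGroup (V x)] [∀ x, ContinuousSMul ℝ (V x)]
  [FiberBundle F V] [VectorBundle ℝ F V] [ContMDiffVectorBundle ∞ F V 𝓘(ℝ, E)]
  {cov : CovariantDerivative 𝓘(ℝ, E) F V}

/-- Two piecewise smooth paths are congruent if their parallel transports agree modulo `N`. -/
def transportCongruence (hcov : CovariantDerivative.ContMDiffCovariantDerivative cov ∞)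
    (N : ∀ x, Subgroup (V x ≃L[ℝ] V x))
    (hN : ∀ {x y : M} {γ : Path x y} {A : V x ≃L[ℝ] V y}, HasTransport cov γ A →
      ∀ B ∈ N y, (A.trans B).trans A.symm ∈ N x) : PathCongruence M where
  P γ := PiecewiseSmooth E γ
  r {x _} a b := ∃ A B, HasTransport cov a A ∧ HasTransport cov b B ∧ A.trans B.symm ∈ N x
  P_refl := pwSmooth_refl
  P_trans := pwSmooth_trans
  P_sub h _ _ hst _ _ hp hq := pwSmooth_subpathCast h hst hp hq
  refl {x _ a} h := by
    obtain ⟨A, hA⟩ := exists_hasTransport hcov h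
    refine ⟨A, A, hA, hA, ?_⟩
    rw [ContinuousLinearEquiv.self_trans_symm]
    exact (N x).one_mem
  symm {x _ a b} := by
    rintro ⟨A, B, hA, hB, h⟩
    exact ⟨B, A, hB, hA, (N x).inv_mem h⟩
  trans {x _ a b c} := by
    rintro ⟨A, B, hA, hB, h⟩ ⟨B', C, hB', hC, h'⟩
    obtain rfl := hB.unique hcov hB'
    refine ⟨A, C, hA, hC, ?_⟩
    convert (N x).mul_mem h' h using 1
    ext v
    change _ = C.symm (B (B.symm (A v)))
    simp
  congr {x y z a a' b b'} := by
    rintro ⟨A, A', hA, hA', h⟩ ⟨B, B', hB, hB', h'⟩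
    refine ⟨_, _, hA.trans hB, hA'.trans hB', ?_⟩
    -- The discrepancy between b and b' lives over y; transport along a' carries it back to x. This
    -- is where the compatibility of N with transport enters.
    convert (N x).mul_mem (hN hA' _ h') h using 1
    ext v
    change _ = A'.symm (B'.symm (B (A' (A'.symm (A v)))))
    simp
  assoc {x _ _ _ a b c} ha hb hc := by
    obtain ⟨A, hA⟩ := exists_hasTransport hcov ha
    obtain ⟨B, hB⟩ := exists_hasTransport hcov hb
    obtain ⟨C, hC⟩ := exists_hasTransport hcov hc
    refine ⟨_, _, (hA.trans hB).trans hC, hA.trans (hB.trans hC), ?_⟩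
    convert (N x).one_mem using 1
    ext v
    change _ = v
    simp
  unit {x y a} ha := by
    obtain ⟨A, hA⟩ := exists_hasTransport hcov ha
    refine ⟨_, _, hA.trans (hasTransport_refl hcov y), hA, ?_⟩
    convert (N x).one_mem using 1
    ext v
    change _ = v
    simp
  split {x y a} ha {s t u} hst htu {p m q} hp hm hq := by
    obtain ⟨A, hA⟩ := exists_hasTransport hcov (pwSmooth_subpathCast ha (hst.trans htu) hp hq)
    refine ⟨A, A, hA, hA.subpathCast_split hcov hst htu hp hm hq, ?_⟩
    rw [ContinuousLinearEquiv.self_trans_symm]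
    exact (N p).one_mem

/-- If transport along small loops belongs to `N`, so does transport along null-homotopic loops. -/
theorem mem_of_homotopic_refl [SecondCountableTopology M]
    (hcov : CovariantDerivative.ContMDiffCovariantDerivative cov ∞)
    (N : ∀ x, Subgroup (V x ≃L[ℝ] V x))
    (hN : ∀ {x y : M} {γ : Path x y} {A : V x ≃L[ℝ] V y}, HasTransport cov γ A →
      ∀ B ∈ N y, (A.trans B).trans A.symm ∈ N x)
    (hsmall : ∀ x₀ : M, ∃ U, IsOpen U ∧ x₀ ∈ U ∧ ∀ ⦃x : M⦄ (γ : Path x x) (A : V x ≃L[ℝ] V x),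
      range γ ⊆ U → HasTransport cov γ A → A ∈ N x) {x : M} {γ : Path x x} {A : V x ≃L[ℝ] V x}
    (hA : HasTransport cov γ A) (hγ : γ.Homotopic (Path.refl x)) : A ∈ N x := by
  have h := PathCongruence.related_of_homotopic (R := transportCongruence hcov N hN) (fun x₀ => by
      obtain ⟨U, h1, h2, h3⟩ := hsmall x₀
      refine ⟨U, h1, h2, fun x y a b ha hb haU hbU => ?_⟩
      obtain ⟨A, hA⟩ := exists_hasTransport hcov ha
      obtain ⟨B, hB⟩ := exists_hasTransport hcov hb
      -- Two paths in U with the same end points differ by a loop in U.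
      refine ⟨A, B, hA, hB, h3 (a.trans b.symm) _ ?_ (hA.trans hB.symm)⟩
      rw [Path.trans_range, Path.symm_range]
      exact union_subset haU hbU)
    (fun x W hW => exists_piecewiseSmooth_connected_nhds x hW)
    (fun γ N hN => exists_piecewiseSmooth_mem_nhds γ hN)
    hA.piecewiseSmooth (pwSmooth_refl x) hγ
  obtain ⟨A', B, hA', hB, hAB⟩ := h
  obtain rfl := hA.unique hcov hA'
  obtain rfl := hB.unique hcov (hasTransport_refl hcov x)
  exact hAB

end TransportCongruence

/-! ### Elements of the restricted holonomy group are joined to the identity by smooth curves -/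

section Holonomy

variable {E F : Type} [NormedAddCommGroup E] [NormedSpace ℝ E]
  [NormedAddCommGroup F] [NormedSpace ℝ F] [FiniteDimensional ℝ F]
  [FiniteDimensional ℝ E] {M : Type*} [TopologicalSpace M] [T2Space M] [ChartedSpace E M]
  [IsManifold 𝓘(ℝ, E) ∞ M]
  {V : M → Type*} [TopologicalSpace (TotalSpace F V)]
  [∀ x, AddCommGroup (V x)] [∀ x, Module ℝ (V x)] [∀ x, TopologicalSpace (V x)]
  [∀ x, IsTopologicalAddGroup (V x)] [∀ x, ContinuousSMul ℝ (V x)]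
  [FiberBundle F V] [VectorBundle ℝ F V] [ContMDiffVectorBundle ∞ F V 𝓘(ℝ, E)]
  {cov : CovariantDerivative 𝓘(ℝ, E) F V}

theorem homotopic_refl_trans {X : Type*} [TopologicalSpace X] {x : X} {a b : Path x x}
    (ha : a.Homotopic (Path.refl x)) (hb : b.Homotopic (Path.refl x)) :
    (a.trans b).Homotopic (Path.refl x) :=
  (ha.hcomp hb).trans ⟨Path.Homotopy.transRefl _⟩

theorem homotopic_refl_symm {X : Type*} [TopologicalSpace X] {x : X} {a : Path x x}
    (ha : a.Homotopic (Path.refl x)) : a.symm.Homotopic (Path.refl x) := by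
  obtain ⟨H⟩ := ha
  exact ⟨H.symm₂.cast rfl (Path.refl_symm).symm⟩

theorem homotopic_refl_conj {X : Type*} [TopologicalSpace X] {x y : X} (a : Path x y)
    {b : Path y y} (hb : b.Homotopic (Path.refl y)) :
    ((a.trans b).trans a.symm).Homotopic (Path.refl x) :=
  ((((Path.Homotopic.refl a).hcomp hb).trans ⟨Path.Homotopy.transRefl _⟩).hcomp
    (Path.Homotopic.refl _)).trans ⟨(Path.Homotopy.reflTransSymm a).symm⟩

/-- The transports along loops at `x`. -/
def holSubgroup (hcov : CovariantDerivative.ContMDiffCovariantDerivative cov ∞) (x : M) :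
    Subgroup (V x ≃L[ℝ] V x) where
  carrier := {A | ∃ γ : Path x x, HasTransport cov γ A}
  one_mem' := ⟨_, hasTransport_refl hcov x⟩
  mul_mem' := by
    rintro A B ⟨γ, hA⟩ ⟨γ', hB⟩
    -- Products of operators compose from right to left, so the loop of B is run first.
    exact ⟨_, hB.trans hA⟩
  inv_mem' := by
    rintro A ⟨γ, hA⟩
    exact ⟨_, hA.symm⟩

/-- The transports along null-homotopic loops at `x`. -/
def restrictedHolSubgroup (hcov : CovariantDerivative.ContMDiffCovariantDerivative cov ∞) (x : M) :
    Subgroup (V x ≃L[ℝ] V x) where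
  carrier := {A | ∃ γ : Path x x, HasTransport cov γ A ∧ γ.Homotopic (Path.refl x)}
  one_mem' := ⟨_, hasTransport_refl hcov x, Path.Homotopic.refl _⟩
  mul_mem' := by
    rintro A B ⟨γ, hA, hγ⟩ ⟨γ', hB, hγ'⟩
    exact ⟨_, hB.trans hA, homotopic_refl_trans hγ' hγ⟩
  inv_mem' := by
    rintro A ⟨γ, hA, hγ⟩
    exact ⟨_, hA.symm, homotopic_refl_symm hγ⟩

/-- Run out along γ, around the loop and back: the result is null-homotopic if the loop is. This
gives both normality and the compatibility needed by the local-to-global principle. -/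
theorem HasTransport.conj_mem (hcov : CovariantDerivative.ContMDiffCovariantDerivative cov ∞)
    {x y : M} {γ : Path x y} {A : V x ≃L[ℝ] V y} (hA : HasTransport cov γ A)
    {B : V y ≃L[ℝ] V y} (hB : B ∈ restrictedHolSubgroup hcov y) :
    (A.trans B).trans A.symm ∈ restrictedHolSubgroup hcov x := by
  obtain ⟨β, hB, hβ⟩ := hB
  exact ⟨_, (hA.trans hB).trans hA.symm, homotopic_refl_conj γ hβ⟩

/-- The elements of `K` that are joined to the identity by a smooth curve in `K`. -/
def smoothComponent {W : Type*} [AddCommGroup W] [Module ℝ W] [TopologicalSpace W] (F : Type)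
    [NormedAddCommGroup F] [NormedSpace ℝ F] (K : Subgroup (W ≃L[ℝ] W)) :
    Subgroup (W ≃L[ℝ] W) where
  carrier := {A | ∀ φ : W ≃L[ℝ] F, ∃ c : ℝ → F →L[ℝ] F, ContDiff ℝ ∞ c ∧ c 0 = 1 ∧
    c 1 = conjGL φ A ∧ ∀ s, ∃ B ∈ K, c s = conjGL φ B}
  one_mem' φ := ⟨fun _ => 1, contDiff_const, rfl, by simp, fun s => ⟨1, K.one_mem, by simp⟩⟩
  mul_mem' := by
    intro A B hA hB φ
    obtain ⟨c, hc, h0, h1, hs⟩ := hA φ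
    obtain ⟨c', hc', h0', h1', hs'⟩ := hB φ
    refine ⟨fun s => c s * c' s, hc.clm_comp hc', by simp [h0, h0'], by simp [h1, h1'], fun s => ?_⟩
    obtain ⟨C, hC, hCs⟩ := hs s
    obtain ⟨C', hC', hCs'⟩ := hs' s
    exact ⟨C * C', K.mul_mem hC hC', by simp [hCs, hCs']⟩
  inv_mem' := by
    intro A hA φ
    obtain ⟨c, hc, h0, h1, hs⟩ := hA φ
    -- The curve to A, run backwards and translated by A⁻¹, goes from 1 to A⁻¹.
    refine ⟨fun s => c (1 - s) * (conjGL φ A⁻¹ : F →L[ℝ] F),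
      (hc.comp (contDiff_const.sub contDiff_id)).clm_comp contDiff_const, ?_, by simp [h0],
      fun s => ?_⟩
    · simp [h1]
    · obtain ⟨C, hC, hCs⟩ := hs (1 - s)
      obtain ⟨C', hC', hCs'⟩ := hs 1
      have : conjGL φ A = conjGL φ C' := Units.ext (h1 ▸ hCs')
      exact ⟨C * C'⁻¹, K.mul_mem hC (K.inv_mem hC'), by simp [hCs, this]⟩

/-- Two identifications of W with F differ by a fixed automorphism of F, and conjugation by it
preserves smoothness; so a curve for one of them suffices. -/
theorem mem_smoothComponent_of_exists {W : Type*} [AddCommGroup W] [Module ℝ W]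
    [TopologicalSpace W] {K : Subgroup (W ≃L[ℝ] W)} {A : W ≃L[ℝ] W} (ψ : W ≃L[ℝ] F)
    {c : ℝ → F →L[ℝ] F} (hc : ContDiff ℝ ∞ c) (h0 : c 0 = 1) (h1 : c 1 = conjGL ψ A)
    (hs : ∀ s, ∃ B ∈ K, c s = conjGL ψ B) : A ∈ smoothComponent F K := by
  intro φ
  let P : F ≃L[ℝ] F := ψ.symm.trans φ
  have hP : ∀ B : W ≃L[ℝ] W, (P : F →L[ℝ] F) * ((conjGL ψ B : F →L[ℝ] F) * (P.symm : F →L[ℝ] F)) =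
      conjGL φ B := by
    intro B
    ext v
    simp [P, conjGL_apply]
  refine ⟨fun s => (P : F →L[ℝ] F) * (c s * (P.symm : F →L[ℝ] F)),
    contDiff_const.clm_comp (hc.clm_comp contDiff_const), ?_, ?_, fun s => ?_⟩
  · simp only [h0]
    ext v
    simp
  · simp only [h1, hP]
  · obtain ⟨B, hB, hBs⟩ := hs s
    exact ⟨B, hB, by simp only [hBs, hP]⟩

variable {x₀ : M} {A : E → E →L[ℝ] F →L[ℝ] F} {r : ℝ}

theorem IsLocalForm.isChartRadius (h : IsLocalForm cov x₀ A r) : IsChartRadius E x₀ r :=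
  ⟨h.pos, h.ball_subset⟩

/-- Shrink the loop to its base point by homotheties of the chart. The transport is smooth in the
scale, is `B` at scale 1 and the identity at scale 0, and every shrunk loop is null-homotopic
because it lies in the ball. -/
theorem IsLocalForm.mem_smoothComponent
    (hcov : CovariantDerivative.ContMDiffCovariantDerivative cov ∞) (h : IsLocalForm cov x₀ A r)
    {x : M} {γ : Path x x} {B : V x ≃L[ℝ] V x} (hγ : range γ ⊆ chartBall E x₀ r)
    (hB : HasTransport cov γ B) : B ∈ smoothComponent F (restrictedHolSubgroup hcov x) := by
  have hx : x ∈ chartBall E x₀ r := by simpa using hγ (mem_range_self 0)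
  have hy : MapsTo γ.extend (Icc 0 1) (chartBall E x₀ r) := fun t ht =>
    hγ (γ.extend_range ▸ mem_range_self t)
  set e := trivializationAt F V x₀
  have hxe : x ∈ e.baseSet := h.chartBall_subset hx
  obtain ⟨T, hT, hTs⟩ := h.exists_transport_scale hx.2 ((piecewiseSmooth_iff γ).1
    hB.piecewiseSmooth) hy
  set p := extChartAt 𝓘(ℝ, E) x₀ x with hp
  have hs0 : ∀ s, chartScale E x₀ p γ.extend s 0 = x := fun s => by
    simpa [chartScale, hp] using (extChartAt 𝓘(ℝ, E) x₀).left_inv hx.1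
  have hs1 : ∀ s, chartScale E x₀ p γ.extend s 1 = x := fun s => by
    simpa [chartScale, hp] using (extChartAt 𝓘(ℝ, E) x₀).left_inv hx.1
  let ψ : V x ≃L[ℝ] F := e.continuousLinearEquivAt ℝ x hxe
  have hψ : ∀ f, ψ.symm f = e.symm x f := fun f => rfl
  have key : ∀ s ∈ Icc (0 : ℝ) 1, ∀ (γ' : Path x x) (C : V x ≃L[ℝ] V x),
      EqOn γ'.extend (chartScale E x₀ p γ.extend s) (Icc 0 1) → HasTransport cov γ' C →
      T s = conjGL ψ C := by
    intro s hs γ' C hγ' hC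
    ext f
    have h1 := (hTs s hs).2 f
    rw [hs0, hs1] at h1
    have h2 := (isParallelTransport_iff cov γ' _ _).2 (h1.congr hγ')
    have h3 := h2.unique hcov (hC _)
    rw [conjGL_apply, hψ, ← h3, ← hψ, ContinuousLinearEquiv.apply_symm_apply]
  have hT0 : T 0 = 1 := by
    rw [key 0 ⟨le_rfl, zero_le_one⟩ (Path.refl x) _ (fun t _ => ?_) (hasTransport_refl hcov x)]
    · ext v
      simp [conjGL_apply]
    · simpa [chartScale, hp] using ((extChartAt 𝓘(ℝ, E) x₀).left_inv hx.1).symm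
  -- The curve must be defined on all of ℝ with all its values transports; sin²(πs/2) maps ℝ
  -- smoothly into [0, 1], sending 0 to 0 and 1 to 1.
  have hmem : ∀ s, Real.sin (Real.pi / 2 * s) ^ 2 ∈ Icc (0 : ℝ) 1 := fun s =>
    ⟨sq_nonneg _, Real.sin_sq_le_one _⟩
  refine mem_smoothComponent_of_exists ψ (c := fun s => T (Real.sin (Real.pi / 2 * s) ^ 2))
    (hT.comp (by fun_prop)) (by simp [hT0]) ?_ fun s => ?_
  · simp only [mul_one, Real.sin_pi_div_two, one_pow]
    exact key 1 ⟨zero_le_one, le_rfl⟩ γ B (fun t ht => (chartScale_one (hy ht)).symm) hB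
  · have hs := hmem s
    set s' := Real.sin (Real.pi / 2 * s) ^ 2
    have hpw := (hTs s' hs).1
    let γ' : Path x x :=
      { toFun := fun t => chartScale E x₀ p γ.extend s' t
        continuous_toFun := continuousOn_iff_continuous_domRestrict.1 hpw.continuousOn
        source' := hs0 s'
        target' := hs1 s' }
    have he : EqOn γ'.extend (chartScale E x₀ p γ.extend s') (Icc 0 1) := fun t ht => by
      rw [Path.extend_apply _ ht]
      rfl
    obtain ⟨C, hC⟩ := exists_hasTransport hcov ((piecewiseSmooth_iff γ').2 (hpw.congr he))
    refine ⟨C, ⟨γ', hC, h.isChartRadius.homotopic ?_ ?_⟩, key s' hs γ' C he hC⟩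
    · rintro _ ⟨t, rfl⟩
      exact h.chartScale_mem hx.2 (hy t.2) hs
    · rw [Path.refl_range, singleton_subset_iff]
      exact hx

/-- Every element of the restricted holonomy group is joined to the identity by a smooth curve. -/
theorem restrictedHolSubgroup_le_smoothComponent [SecondCountableTopology M]
    (hcov : CovariantDerivative.ContMDiffCovariantDerivative cov ∞) (x : M) :
    restrictedHolSubgroup hcov x ≤ smoothComponent F (restrictedHolSubgroup hcov x) := by
  rintro A ⟨γ, hA, hγ⟩
  refine mem_of_homotopic_refl hcov (fun x => smoothComponent F (restrictedHolSubgroup hcov x))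
    (fun {x y γ A} hA B hB φ => ?_) (fun x₀ => ?_) hA hγ
  · obtain ⟨c, hc, h0, h1, hs⟩ := hB (A.symm.trans φ)
    have hconj : ∀ B : V y ≃L[ℝ] V y,
        conjGL (A.symm.trans φ) B = conjGL φ ((A.trans B).trans A.symm) := fun B => by
      ext v
      simp [conjGL_apply]
    refine ⟨c, hc, h0, by rw [h1, hconj], fun s => ?_⟩
    obtain ⟨C, hC, hCs⟩ := hs s
    exact ⟨_, hA.conj_mem hcov hC, by rw [hCs, hconj]⟩
  · obtain ⟨A, r, h⟩ := exists_isLocalForm cov hcov x₀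
    exact ⟨chartBall E x₀ r, isOpen_chartBall x₀ r, mem_chartBall x₀ h.pos,
      fun x γ A hγ hA => h.mem_smoothComponent hcov hγ hA⟩

end Holonomy

/-! ### Curvature in a local trivialization -/

section CurvatureForm

variable {E F : Type} [NormedAddCommGroup E] [NormedSpace ℝ E]
  [NormedAddCommGroup F] [NormedSpace ℝ F]

/-- The covariant derivative of `f` in the direction of the vector field `X`, for the connection
form `A`. -/
def formCov (A : E → E →L[ℝ] F →L[ℝ] F) (X : E → E) (f : E → F) (v : E) : F :=
  fderiv ℝ f v (X v) + A v (X v) (f v)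

theorem hasFDerivAt_formCov {A : E → E →L[ℝ] F →L[ℝ] F} (hA : ContDiff ℝ ∞ A) {f : E → F}
    {X : E → E} {p : E} (hf : ContDiffAt ℝ 2 f p) (hX : DifferentiableAt ℝ X p) :
    ∃ L : E →L[ℝ] F, HasFDerivAt (formCov A X f) L p ∧ ∀ v,
      L v = fderiv ℝ (fderiv ℝ f) p v (X p) + fderiv ℝ f p (fderiv ℝ X p v) +
        (fderiv ℝ A p v (X p) (f p) + A p (fderiv ℝ X p v) (f p) + A p (X p) (fderiv ℝ f p v)) := by
  have h1 : DifferentiableAt ℝ (fderiv ℝ f) p :=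
    (hf.fderiv_right (m := 1) le_rfl).differentiableAt one_ne_zero
  have h2 := h1.hasFDerivAt.clm_apply hX.hasFDerivAt
  have h3 := (((hA.differentiable (by simp)) p).hasFDerivAt.clm_apply hX.hasFDerivAt).clm_apply
    (hf.differentiableAt two_ne_zero).hasFDerivAt
  refine ⟨_, h2.add h3, fun v => ?_⟩
  simp only [add_apply, ContinuousLinearMap.comp_apply, ContinuousLinearMap.flip_apply]
  abel

/-- Second derivatives of f cancel by symmetry, and the derivatives of X and Y combine to the
bracket term; what remains is of order zero in f. -/
theorem formCov_commutator {A : E → E →L[ℝ] F →L[ℝ] F} (hA : ContDiff ℝ ∞ A) {f : E → F}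
    {X Y : E → E} {p : E} (hf : ContDiffAt ℝ 2 f p) (hX : DifferentiableAt ℝ X p)
    (hY : DifferentiableAt ℝ Y p) :
    formCov A X (formCov A Y f) p - formCov A Y (formCov A X f) p -
      formCov A (VectorField.lieBracket ℝ X Y) f p = formCurvature A p (X p) (Y p) (f p) := by
  obtain ⟨L, hL, hLv⟩ := hasFDerivAt_formCov hA hf hX
  obtain ⟨L', hL', hLv'⟩ := hasFDerivAt_formCov hA hf hY
  have hs := (hf.isSymmSndFDerivAt (by simp)).eq (X p) (Y p)
  have e1 : formCov A X (formCov A Y f) p = L' (X p) + A p (X p) (formCov A Y f p) := by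
    rw [← hL'.fderiv]; rfl
  have e2 : formCov A Y (formCov A X f) p = L (Y p) + A p (Y p) (formCov A X f p) := by
    rw [← hL.fderiv]; rfl
  rw [e1, e2, hLv, hLv']
  simp only [formCov, formCurvature, VectorField.lieBracket, map_add, map_sub, add_apply, sub_apply, hs]
  simp only [ContinuousLinearMap.mul_def, ContinuousLinearMap.comp_apply]
  abel

end CurvatureForm

/-! ### Vector fields and the curvature operator in a chart -/

section Curvature

variable {E F : Type} [NormedAddCommGroup E] [NormedSpace ℝ E]
  [NormedAddCommGroup F] [NormedSpace ℝ F] [FiniteDimensional ℝ F]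
  [FiniteDimensional ℝ E] {M : Type*} [TopologicalSpace M] [T2Space M] [ChartedSpace E M]
  [IsManifold 𝓘(ℝ, E) ∞ M]
  {V : M → Type*} [TopologicalSpace (TotalSpace F V)]
  [∀ x, AddCommGroup (V x)] [∀ x, Module ℝ (V x)] [∀ x, TopologicalSpace (V x)]
  [∀ x, IsTopologicalAddGroup (V x)] [∀ x, ContinuousSMul ℝ (V x)]
  [FiberBundle F V] [VectorBundle ℝ F V] [ContMDiffVectorBundle ∞ F V 𝓘(ℝ, E)]
  {cov : CovariantDerivative 𝓘(ℝ, E) F V}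

/-- The coordinate expression of a vector field in the chart at `x₀`. -/
def chartField (x₀ : M) (X : Π y : M, TangentSpace 𝓘(ℝ, E) y) (v : E) : E :=
  mvfderiv 𝓘(ℝ, E) (extChartAt 𝓘(ℝ, E) x₀) ((extChartAt 𝓘(ℝ, E) x₀).symm v)
    (X ((extChartAt 𝓘(ℝ, E) x₀).symm v))

theorem chartField_apply {x₀ y : M} (hy : y ∈ (extChartAt 𝓘(ℝ, E) x₀).source)
    (X : Π y : M, TangentSpace 𝓘(ℝ, E) y) : chartField x₀ X (extChartAt 𝓘(ℝ, E) x₀ y) =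
      mvfderiv 𝓘(ℝ, E) (extChartAt 𝓘(ℝ, E) x₀) y (X y) := by
  rw [chartField, (extChartAt 𝓘(ℝ, E) x₀).left_inv hy]

theorem contDiffOn_chartField (x₀ : M) {X : Π y : M, TangentSpace 𝓘(ℝ, E) y}
    (hX : ContMDiff 𝓘(ℝ, E) 𝓘(ℝ, E).tangent ∞ (fun y => (⟨y, X y⟩ : TangentBundle 𝓘(ℝ, E) M))) :
    ContDiffOn ℝ ∞ (chartField x₀ X) (extChartAt 𝓘(ℝ, E) x₀).target := by
  set eT := trivializationAt E (TangentSpace 𝓘(ℝ, E) : M → Type _) x₀ with heT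
  have h1 := (eT.contMDiffOn_section_baseSet_iff (IB := 𝓘(ℝ, E)) (n := ∞)).1
    (hX.contMDiffOn (s := eT.baseSet))
  have hm : MapsTo (extChartAt 𝓘(ℝ, E) x₀).symm (extChartAt 𝓘(ℝ, E) x₀).target eT.baseSet :=
    fun v hv => by
      rw [TangentBundle.trivializationAt_baseSet]
      simpa using (extChartAt 𝓘(ℝ, E) x₀).map_target hv
  refine (h1.comp (contMDiffOn_extChartAt_symm x₀) hm).contDiffOn.congr fun v hv => ?_
  have h2 := hm hv
  rw [Function.comp_apply, ← eT.continuousLinearMapAt_apply_of_mem ℝ h2,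
    TangentBundle.continuousLinearMapAt_trivializationAt
      (by simpa using (extChartAt 𝓘(ℝ, E) x₀).map_target hv)]
  rfl

/-- The coordinate expression of a field is its pullback under the inverse chart, and pullbacks
commute with brackets. -/
theorem chartField_mlieBracket {x₀ y : M} (hy : y ∈ (extChartAt 𝓘(ℝ, E) x₀).source)
    {X Y : Π y : M, TangentSpace 𝓘(ℝ, E) y}
    (hX : ContMDiff 𝓘(ℝ, E) 𝓘(ℝ, E).tangent ∞ (fun y => (⟨y, X y⟩ : TangentBundle 𝓘(ℝ, E) M)))
    (hY : ContMDiff 𝓘(ℝ, E) 𝓘(ℝ, E).tangent ∞ (fun y => (⟨y, Y y⟩ : TangentBundle 𝓘(ℝ, E) M))) :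
    mvfderiv 𝓘(ℝ, E) (extChartAt 𝓘(ℝ, E) x₀) y (VectorField.mlieBracket 𝓘(ℝ, E) X Y y) =
      VectorField.lieBracket ℝ (chartField x₀ X) (chartField x₀ Y) (extChartAt 𝓘(ℝ, E) x₀ y) := by
  have : IsManifold 𝓘(ℝ, E) (minSmoothness ℝ 2) M := .of_le (n := ∞)
    (by simpa using (mod_cast le_top : ((2 : ℕ∞) : ℕ∞ω) ≤ ∞))
  have : IsManifold 𝓘(ℝ, E) (minSmoothness ℝ 3) M := .of_le (n := ∞)
    (by simpa using (mod_cast le_top : ((3 : ℕ∞) : ℕ∞ω) ≤ ∞))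
  set φ := extChartAt 𝓘(ℝ, E) x₀ with hφ
  have hpb : ∀ (Z : Π y : M, TangentSpace 𝓘(ℝ, E) y), ∀ v ∈ φ.target,
      VectorField.mpullback 𝓘(ℝ, E) 𝓘(ℝ, E) φ.symm Z v = chartField x₀ Z v := by
    intro Z v hv
    rw [VectorField.mpullback_apply]
    have h1 := mfderiv_extChartAt_comp_mfderivWithin_extChartAt_symm (I := 𝓘(ℝ, E)) hv
    have h2 := mfderivWithin_extChartAt_symm_comp_mfderiv_extChartAt (I := 𝓘(ℝ, E)) hv
    rw [ModelWithCorners.range_eq_univ, mfderivWithin_univ] at h1 h2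
    rw [ContinuousLinearMap.inverse_eq h2 h1]
    rfl
  have hv : φ y ∈ φ.target := φ.map_source hy
  have htn : φ.target ∈ 𝓝 (φ y) := extChartAt_target_mem_nhds' hv
  have hsm : ContMDiffAt 𝓘(ℝ, E) 𝓘(ℝ, E) ∞ φ.symm (φ y) :=
    (contMDiffOn_extChartAt_symm x₀).contMDiffAt htn
  have h := VectorField.mpullback_mlieBracket (I := 𝓘(ℝ, E)) (I' := 𝓘(ℝ, E)) (f := φ.symm)
    (x₀ := φ y) (V := X) (W := Y) (n := ∞) ((hX _).mdifferentiableAt (by simp))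
    ((hY _).mdifferentiableAt (by simp)) hsm
    (by simpa using (mod_cast le_top : ((2 : ℕ∞) : ℕ∞ω) ≤ ∞))
  rw [hpb _ _ hv, chartField_apply hy] at h
  rw [h, ← VectorField.mlieBracketWithin_univ, VectorField.mlieBracketWithin_eq_lieBracketWithin]
  refine (congrFun VectorField.lieBracketWithin_univ _).trans ?_
  refine Filter.EventuallyEq.lieBracket_vectorField_eq ?_ ?_
  · filter_upwards [htn] with v hv using hpb X v hv
  · filter_upwards [htn] with v hv using hpb Y v hv

theorem mvfderiv_comp_chart {W : Type*} [NormedAddCommGroup W] [NormedSpace ℝ W] {x₀ y : M}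
    (hy : y ∈ (extChartAt 𝓘(ℝ, E) x₀).source) {g : M → W} {G : E → W}
    (hG : DifferentiableAt ℝ G (extChartAt 𝓘(ℝ, E) x₀ y))
    (hg : g =ᶠ[𝓝 y] fun z => G (extChartAt 𝓘(ℝ, E) x₀ z)) (X : TangentSpace 𝓘(ℝ, E) y) :
    MDifferentiableAt 𝓘(ℝ, E) 𝓘(ℝ, W) g y ∧ mvfderiv 𝓘(ℝ, E) g y X =
      fderiv ℝ G (extChartAt 𝓘(ℝ, E) x₀ y) (mvfderiv 𝓘(ℝ, E) (extChartAt 𝓘(ℝ, E) x₀) y X) := by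
  have h1 : MDifferentiableAt 𝓘(ℝ, E) 𝓘(ℝ, E) (extChartAt 𝓘(ℝ, E) x₀) y :=
    mdifferentiableAt_extChartAt (by simpa using hy)
  have h2 := hG.hasFDerivAt.hasMFDerivAt.comp y h1.hasMFDerivAt
  have h3 := h2.congr_of_eventuallyEq hg
  refine ⟨h3.mdifferentiableAt, ?_⟩
  rw [mvfderiv, h3.mfderiv]
  rfl

variable {x₀ : M} {A : E → E →L[ℝ] F →L[ℝ] F} {r : ℝ}

theorem IsLocalForm.trivialization_cov_chartField (h : IsLocalForm cov x₀ A r) {y : M}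
    (hy : y ∈ chartBall E x₀ r) {σ : Π y : M, V y} {f : E → F}
    (hf : DifferentiableAt ℝ f (extChartAt 𝓘(ℝ, E) x₀ y))
    (hσ : (fun z => (trivializationAt F V x₀ ⟨z, σ z⟩).2) =ᶠ[𝓝 y]
      fun z => f (extChartAt 𝓘(ℝ, E) x₀ z)) (X : Π y : M, TangentSpace 𝓘(ℝ, E) y) :
    (trivializationAt F V x₀ ⟨y, cov σ y (X y)⟩).2 =
      formCov A (chartField x₀ X) f (extChartAt 𝓘(ℝ, E) x₀ y) := by
  have h1 := mvfderiv_comp_chart hy.1 hf hσ (X y)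
  rw [h.cov_apply hy.1 hy.2 ?_, h1.2, formCov, chartField_apply hy.1,
    show (trivializationAt F V x₀ ⟨y, σ y⟩).2 = _ from hσ.self_of_nhds]
  exact ((trivializationAt F V x₀).mdifferentiableAt_section_iff 𝓘(ℝ, E) _
    (h.chartBall_subset hy)).2 h1.1

/-- Near y each covariant derivative acts on coordinates as `formCov`, so the commutator formula for
connection forms applies. -/
theorem IsLocalForm.trivialization_curvature (h : IsLocalForm cov x₀ A r) {y : M}
    (hy : y ∈ chartBall E x₀ r) {X Y : Π y : M, TangentSpace 𝓘(ℝ, E) y} {σ : Π y : M, V y}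
    (hX : ContMDiff 𝓘(ℝ, E) 𝓘(ℝ, E).tangent ∞ (fun y => (⟨y, X y⟩ : TangentBundle 𝓘(ℝ, E) M)))
    (hY : ContMDiff 𝓘(ℝ, E) 𝓘(ℝ, E).tangent ∞ (fun y => (⟨y, Y y⟩ : TangentBundle 𝓘(ℝ, E) M)))
    (hσ : ContMDiff 𝓘(ℝ, E) (𝓘(ℝ, E).prod 𝓘(ℝ, F)) ∞ (fun y => (⟨y, σ y⟩ : TotalSpace F V))) :
    (trivializationAt F V x₀ ⟨y, curvature cov X Y σ y⟩).2 =
      formCurvature A (extChartAt 𝓘(ℝ, E) x₀ y)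
        (mvfderiv 𝓘(ℝ, E) (extChartAt 𝓘(ℝ, E) x₀) y (X y))
        (mvfderiv 𝓘(ℝ, E) (extChartAt 𝓘(ℝ, E) x₀) y (Y y)) (trivializationAt F V x₀ ⟨y, σ y⟩).2 := by
  set e := trivializationAt F V x₀ with he
  set φ := extChartAt 𝓘(ℝ, E) x₀ with hφ
  let f : E → F := fun v => (e ⟨φ.symm v, σ (φ.symm v)⟩).2
  have hB := isOpen_chartBall (E := E) x₀ r
  have hfe : ∀ z ∈ chartBall E x₀ r, (e ⟨z, σ z⟩).2 = f (φ z) := fun z hz => by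
    simp only [f]
    rw [φ.left_inv hz.1]
  have hfd : ∀ z ∈ chartBall E x₀ r, ContDiffAt ℝ ∞ f (φ z) := by
    intro z hz
    have h1 : ContMDiffAt 𝓘(ℝ, E) 𝓘(ℝ, E) ∞ φ.symm (φ z) :=
      (contMDiffOn_extChartAt_symm x₀).contMDiffAt
        (extChartAt_target_mem_nhds' (φ.map_source hz.1))
    have h2 := (e.contMDiffAt_section_iff (IB := 𝓘(ℝ, E)) (h.chartBall_subset hz)).1 (hσ z)
    rw [← φ.left_inv hz.1] at h2
    exact (h2.comp (φ z) h1).contDiffAt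
  have hZd : ∀ {Z : Π y : M, TangentSpace 𝓘(ℝ, E) y},
      ContMDiff 𝓘(ℝ, E) 𝓘(ℝ, E).tangent ∞ (fun y => (⟨y, Z y⟩ : TangentBundle 𝓘(ℝ, E) M)) →
      ∀ z ∈ chartBall E x₀ r, DifferentiableAt ℝ (chartField x₀ Z) (φ z) := fun hZ z hz =>
    ((contDiffOn_chartField x₀ hZ).contDiffAt
      (extChartAt_target_mem_nhds' (φ.map_source hz.1))).differentiableAt (by simp)
  have h2 : (2 : ℕ∞ω) ≤ ∞ := by simpa using (mod_cast le_top : ((2 : ℕ∞) : ℕ∞ω) ≤ ∞)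
  have h1 : ∀ Z : Π y : M, TangentSpace 𝓘(ℝ, E) y, ∀ z ∈ chartBall E x₀ r,
      (e ⟨z, cov σ z (Z z)⟩).2 = formCov A (chartField x₀ Z) f (φ z) := fun Z z hz =>
    h.trivialization_cov_chartField hz ((hfd z hz).differentiableAt (by simp))
      ((hB.eventually_mem hz).mono hfe) Z
  have h3 : ∀ {Z Z' : Π y : M, TangentSpace 𝓘(ℝ, E) y},
      ContMDiff 𝓘(ℝ, E) 𝓘(ℝ, E).tangent ∞ (fun y => (⟨y, Z y⟩ : TangentBundle 𝓘(ℝ, E) M)) →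
      (e ⟨y, cov (fun y => cov σ y (Z y)) y (Z' y)⟩).2 =
        formCov A (chartField x₀ Z') (formCov A (chartField x₀ Z) f) (φ y) := fun {Z Z'} hZ => by
    obtain ⟨L, hL, -⟩ := hasFDerivAt_formCov h.contDiff ((hfd y hy).of_le h2) (hZd hZ y hy)
    exact h.trivialization_cov_chartField hy hL.differentiableAt
      ((hB.eventually_mem hy).mono (h1 Z)) Z'
  have h4 : (e ⟨y, cov σ y (VectorField.mlieBracket 𝓘(ℝ, E) X Y y)⟩).2 =
      formCov A (VectorField.lieBracket ℝ (chartField x₀ X) (chartField x₀ Y)) f (φ y) := by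
    rw [h1 (VectorField.mlieBracket 𝓘(ℝ, E) X Y) y hy, formCov, chartField_apply hy.1,
      chartField_mlieBracket hy.1 hX hY]
    rfl
  rw [hfe y hy, ← chartField_apply hy.1, ← chartField_apply hy.1, ← formCov_commutator h.contDiff
    ((hfd y hy).of_le h2) (hZd hX y hy) (hZd hY y hy), ← h3 hY, ← h3 hX, ← h4]
  simp only [← e.continuousLinearMapAt_apply_of_mem ℝ (h.chartBall_subset hy), curvature, map_sub]

/-- A constant section of the local frame, cut off by a bump function. `IsFlat` speaks of global
fields only, and this provides enough of them, both for V and for the tangent bundle. -/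
theorem exists_contMDiff_section (x₀ : M) (v : V x₀) : ∃ σ : Π y : M, V y,
    ContMDiff 𝓘(ℝ, E) (𝓘(ℝ, E).prod 𝓘(ℝ, F)) ∞ (fun y => (⟨y, σ y⟩ : TotalSpace F V)) ∧
      σ x₀ = v := by
  set e := trivializationAt F V x₀
  have hx₀ : x₀ ∈ e.baseSet := mem_baseSet_trivializationAt F V x₀
  obtain ⟨ψ, -, hψ⟩ := (SmoothBumpFunction.nhds_basis_tsupport (I := 𝓘(ℝ, E)) x₀).mem_iff.1
    (e.open_baseSet.mem_nhds hx₀)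
  have hfr : ContMDiffOn 𝓘(ℝ, E) (𝓘(ℝ, E).prod 𝓘(ℝ, F)) ∞
      (fun y => (⟨y, e.symm y (e ⟨x₀, v⟩).2⟩ : TotalSpace F V)) e.baseSet := by
    rw [e.contMDiffOn_section_baseSet_iff]
    refine (contMDiffOn_const (c := (e ⟨x₀, v⟩).2)).congr fun y hy => ?_
    simp [e.apply_mk_symm hy]
  refine ⟨_, ContMDiffOn.smul_section_of_tsupport ψ.contMDiff.contMDiffOn e.open_baseSet hψ hfr, ?_⟩
  simp [e.symm_apply_apply_mk hx₀]

/-- The coordinate formula for the curvature depends only on the values of the fields at y, and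
global smooth fields can take any prescribed values there. -/
theorem IsFlat.formCurvature_eq_zero (hflat : IsFlat cov) (h : IsLocalForm cov x₀ A r) {p : E}
    (hp : p ∈ Metric.ball (extChartAt 𝓘(ℝ, E) x₀ x₀) r) (v w : E) : formCurvature A p v w = 0 := by
  set e := trivializationAt F V x₀ with he
  set φ := extChartAt 𝓘(ℝ, E) x₀ with hφ
  obtain ⟨y, hy, rfl⟩ : ∃ y ∈ chartBall E x₀ r, φ y = p :=
    ⟨φ.symm p, h.isChartRadius.symm_mem hp, φ.right_inv (h.ball_subset hp)⟩
  have hsurj : ∀ v : E, ∃ X : TangentSpace 𝓘(ℝ, E) y, mvfderiv 𝓘(ℝ, E) φ y X = v := by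
    intro v
    obtain ⟨L, hL⟩ := isInvertible_mfderiv_extChartAt (I := 𝓘(ℝ, E)) (x := x₀) hy.1
    refine ⟨L.symm v, ?_⟩
    rw [mvfderiv, ← hL]
    exact L.apply_symm_apply v
  obtain ⟨v', rfl⟩ := hsurj v
  obtain ⟨w', rfl⟩ := hsurj w
  obtain ⟨X, hX, rfl⟩ := exists_contMDiff_section (E := E) (F := E)
    (V := (TangentSpace 𝓘(ℝ, E) : M → Type _)) y v'
  obtain ⟨Y, hY, rfl⟩ := exists_contMDiff_section (E := E) (F := E)
    (V := (TangentSpace 𝓘(ℝ, E) : M → Type _)) y w'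
  ext f
  obtain ⟨σ, hσ, hσy⟩ := exists_contMDiff_section (E := E) (F := F) (V := V) y (e.symm y f)
  have h1 := h.trivialization_curvature hy hX hY hσ
  rw [hflat X Y σ hX hY hσ y, hσy, ← e.continuousLinearMapAt_apply_of_mem ℝ (h.chartBall_subset hy),
    map_zero, e.apply_mk_symm (h.chartBall_subset hy)] at h1
  exact h1.symm

end Curvature

/-! ### Flatness and transport along null-homotopic loops -/

section Flat

variable {E F : Type} [NormedAddCommGroup E] [NormedSpace ℝ E]
  [NormedAddCommGroup F] [NormedSpace ℝ F] [FiniteDimensional ℝ F]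
  [FiniteDimensional ℝ E] {M : Type*} [TopologicalSpace M] [T2Space M] [ChartedSpace E M]
  [IsManifold 𝓘(ℝ, E) ∞ M]
  {V : M → Type*} [TopologicalSpace (TotalSpace F V)]
  [∀ x, AddCommGroup (V x)] [∀ x, Module ℝ (V x)] [∀ x, TopologicalSpace (V x)]
  [∀ x, IsTopologicalAddGroup (V x)] [∀ x, ContinuousSMul ℝ (V x)]
  [FiberBundle F V] [VectorBundle ℝ F V] [ContMDiffVectorBundle ∞ F V 𝓘(ℝ, E)]
  {cov : CovariantDerivative 𝓘(ℝ, E) F V} {x₀ : M} {A : E → E →L[ℝ] F →L[ℝ] F} {r : ℝ}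

theorem IsLocalForm.isParallelOn_of_formParallel (h : IsLocalForm cov x₀ A r) {σ : ℝ → M} {a b : ℝ}
    (hab : a < b) (hσ : ContMDiffOn 𝓘(ℝ, ℝ) 𝓘(ℝ, E) ∞ σ (Icc a b))
    (hy : MapsTo σ (Icc a b) (chartBall E x₀ r)) {u : ℝ → F}
    (hu : FormParallel A (fun t => extChartAt 𝓘(ℝ, E) x₀ (σ t)) u a b) :
    IsParallelOn cov
      (fun t => (⟨σ t, (trivializationAt F V x₀).symm (σ t) (u t)⟩ : TotalSpace F V)) a b := by
  set e := trivializationAt F V x₀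
  refine (h.isParallelOn_iff (S := fun t => (⟨σ t, e.symm (σ t) (u t)⟩ : TotalSpace F V))
    hab hy hσ).2 fun t ht => ?_
  have e2 : EqOn (fun t => (e ⟨σ t, e.symm (σ t) (u t)⟩).2) u (Icc a b) := fun t ht => by
    simp only
    rw [e.apply_mk_symm (h.chartBall_subset (hy ht))]
  have := (hu t ht).congr_of_mem (f₁ := fun t => (e ⟨σ t, e.symm (σ t) (u t)⟩).2)
    (fun t ht => e2 ht) ht
  rwa [← e2 ht] at this

/-- By the chain rule dU = -A U makes t ↦ U(c(t))f parallel along every curve c in the ball. -/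
theorem IsLocalForm.tr_of_frame (h : IsLocalForm cov x₀ A r) {σ : ℝ → M} {a b : ℝ}
    (hσ : PwSmooth E σ a b) (hy : MapsTo σ (Icc a b) (chartBall E x₀ r)) {U : E → F →L[ℝ] F}
    (hU : Differentiable ℝ U) (hUA : ∀ y ∈ Metric.ball (extChartAt 𝓘(ℝ, E) x₀ x₀) r, ∀ v,
      fderiv ℝ U y v = -(A y v) * U y) (f : F) :
    Tr cov σ a b
      ⟨σ a, (trivializationAt F V x₀).symm (σ a) (U (extChartAt 𝓘(ℝ, E) x₀ (σ a)) f)⟩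
      ⟨σ b, (trivializationAt F V x₀).symm (σ b) (U (extChartAt 𝓘(ℝ, E) x₀ (σ b)) f)⟩ := by
  refine ⟨fun t => ⟨σ t, (trivializationAt F V x₀).symm (σ t)
    (U (extChartAt 𝓘(ℝ, E) x₀ (σ t)) f)⟩, ?_, fun _ _ => rfl, rfl, rfl⟩
  refine Pw.imp hσ fun a' b' ha hab hb hs => ?_
  have hy' : MapsTo σ (Icc a' b') (chartBall E x₀ r) := hy.mono_left (Icc_subset_Icc ha hb)
  refine h.isParallelOn_of_formParallel hab hs hy' fun t ht => ?_
  have hc : ContDiffOn ℝ ∞ (fun t => extChartAt 𝓘(ℝ, E) x₀ (σ t)) (Icc a' b') :=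
    ((contMDiffOn_extChartAt (n := ∞)).comp hs fun t ht => by simpa using (hy' ht).1).contDiffOn
  have h1 := (hU (extChartAt 𝓘(ℝ, E) x₀ (σ t))).hasFDerivAt.comp_hasDerivWithinAt t
    ((hc.differentiableOn (by simp)) t ht).hasDerivWithinAt
  rw [hUA _ (hy' ht).2] at h1
  simpa using h1.clm_apply (hasDerivWithinAt_const t (Icc a' b') f)

/-- A radial frame is parallel along the segments from its centre, so its value at z is the
transport along the segment to z. -/
theorem IsLocalForm.tr_line (h : IsLocalForm cov x₀ A r) {p z : E}
    (hp : p ∈ Metric.ball (extChartAt 𝓘(ℝ, E) x₀ x₀) r)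
    (hz : z ∈ Metric.ball (extChartAt 𝓘(ℝ, E) x₀ x₀) r) {U : E → F →L[ℝ] F}
    (hU : IsRadialFrame A p U) :
    ∃ γ : Path ((extChartAt 𝓘(ℝ, E) x₀).symm p) ((extChartAt 𝓘(ℝ, E) x₀).symm z),
      range γ ⊆ chartBall E x₀ r ∧ PiecewiseSmooth E γ ∧ ∀ f, IsParallelTransport cov γ
        ((trivializationAt F V x₀).symm _ f) ((trivializationAt F V x₀).symm _ (U z f)) := by
  set φ := extChartAt 𝓘(ℝ, E) x₀ with hφ
  have hmem : ∀ t ∈ Icc (0 : ℝ) 1, p + t • (z - p) ∈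
      Metric.ball (extChartAt 𝓘(ℝ, E) x₀ x₀) r := fun t ht =>
    (convex_ball _ r).add_smul_sub_mem hp hz ht
  have hs : ContMDiffOn 𝓘(ℝ, ℝ) 𝓘(ℝ, E) ∞ (fun t : ℝ => φ.symm (p + t • (z - p)))
      (Icc 0 1) := (contMDiffOn_extChartAt_symm x₀).comp
    (ContDiff.contMDiff (by fun_prop)).contMDiffOn fun t ht => h.ball_subset (hmem t ht)
  let a : Path (φ.symm p) (φ.symm z) :=
    { toFun := fun t => φ.symm (p + (t : ℝ) • (z - p))
      continuous_toFun := continuousOn_iff_continuous_domRestrict.1 hs.continuousOn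
      source' := by simp
      target' := by simp }
  have hext : EqOn a.extend (fun t : ℝ => φ.symm (p + t • (z - p))) (Icc 0 1) := fun t ht => by
    rw [Path.extend_apply _ ht]
    rfl
  refine ⟨a, ?_, (piecewiseSmooth_iff a).2 (.base zero_lt_one (hs.congr hext)), fun f => ?_⟩
  · rintro _ ⟨t, rfl⟩
    exact h.isChartRadius.symm_mem (hmem t t.2)
  rw [isParallelTransport_iff]
  refine Tr.congr ⟨_, .base zero_lt_one (h.isParallelOn_of_formParallel zero_lt_one hs
    (fun t ht => h.isChartRadius.symm_mem (hmem t ht)) (u := fun t => U (p + t • (z - p)) f) ?_),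
    fun _ _ => rfl, ?_, ?_⟩ hext
  · have e1 : EqOn (fun t : ℝ => φ (φ.symm (p + t • (z - p)))) (fun t => p + t • (z - p))
        (Icc 0 1) := fun t ht => φ.right_inv (h.ball_subset (hmem t ht))
    intro t ht
    rw [derivWithin_congr e1 (e1 ht), e1 ht,
      (hasDerivAt_ray p (z - p) t).hasDerivWithinAt.derivWithin (uniqueDiffOn_Icc zero_lt_one t ht)]
    simpa using (hU.2.2 z t ht).clm_apply (hasDerivWithinAt_const t (Icc 0 1) f)
  · have h0 : p + (0 : ℝ) • (z - p) = p := by simp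
    rw [h0, hU.2.1]
    rfl
  · have h1 : p + (1 : ℝ) • (z - p) = z := by simp
    rw [h1]

/-- Over a chart ball, parallel transport of a flat connection along loops is trivial. -/
theorem IsLocalForm.eq_one_of_flat (hcov : CovariantDerivative.ContMDiffCovariantDerivative cov ∞)
    (h : IsLocalForm cov x₀ A r) (hflat : IsFlat cov) {x : M} {γ : Path x x}
    {B : V x ≃L[ℝ] V x} (hγ : range γ ⊆ chartBall E x₀ r) (hB : HasTransport cov γ B) :
    B = 1 := by
  have hx : x ∈ chartBall E x₀ r := by simpa using hγ (mem_range_self 0)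
  have hy : MapsTo γ.extend (Icc 0 1) (chartBall E x₀ r) := fun t ht =>
    hγ (γ.extend_range ▸ mem_range_self t)
  obtain ⟨U, hU⟩ := exists_isRadialFrame h.contDiff (extChartAt 𝓘(ℝ, E) x₀ x)
  have hUA : ∀ y ∈ Metric.ball (extChartAt 𝓘(ℝ, E) x₀ x₀) r, ∀ v,
      fderiv ℝ U y v = -(A y v) * U y := fun y hy v =>
    hU.fderiv_of_flat h.contDiff (fun t ht v w => hflat.formCurvature_eq_zero h
      ((convex_ball _ r).add_smul_sub_mem hx.2 hy ht) v w) v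
  ext v
  have h1 := h.tr_of_frame ((piecewiseSmooth_iff γ).1 hB.piecewiseSmooth) hy
    (hU.1.differentiable (by simp)) hUA (trivializationAt F V x₀ ⟨x, v⟩).2
  rw [Path.extend_zero, Path.extend_one, hU.2.1, one_apply_eq_self,
    Trivialization.symm_apply_apply_mk _ (h.chartBall_subset hx)] at h1
  exact (hB v).unique hcov ((isParallelTransport_iff _ _ _ _).2 h1)

/-- The local-to-global principle for the trivial subgroups. -/
theorem IsFlat.eq_one [SecondCountableTopology M]
    (hcov : CovariantDerivative.ContMDiffCovariantDerivative cov ∞) (hflat : IsFlat cov) {x : M}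
    {γ : Path x x} {B : V x ≃L[ℝ] V x} (hB : HasTransport cov γ B)
    (hγ : γ.Homotopic (Path.refl x)) : B = 1 := by
  refine Subgroup.mem_bot.1 (mem_of_homotopic_refl hcov (fun _ => ⊥) (fun {x y γ A} hA B hB => ?_)
    (fun x₀ => ?_) hB hγ)
  · rw [Subgroup.mem_bot] at hB ⊢
    subst hB
    ext v
    exact A.symm_apply_apply v
  · obtain ⟨A, r, h⟩ := exists_isLocalForm cov hcov x₀
    exact ⟨chartBall E x₀ r, isOpen_chartBall x₀ r, mem_chartBall x₀ h.pos,
      fun x γ A hγ hA => Subgroup.mem_bot.2 (h.eq_one_of_flat hcov hflat hγ hA)⟩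

theorem IsFlat.parallelTransport_eq_of_homotopic [SecondCountableTopology M]
    (hcov : CovariantDerivative.ContMDiffCovariantDerivative cov ∞) (hflat : IsFlat cov) {x y : M}
    {γ₀ γ₁ : Path x y} (h₀ : PiecewiseSmooth E γ₀) (h₁ : PiecewiseSmooth E γ₁)
    (h : γ₀.Homotopic γ₁) : parallelTransport cov γ₀ = parallelTransport cov γ₁ := by
  obtain ⟨A, hA⟩ := exists_hasTransport hcov h₀
  obtain ⟨B, hB⟩ := exists_hasTransport hcov h₁
  have h2 := hflat.eq_one hcov (hA.trans hB.symm) ((h.hcomp (Path.Homotopic.refl _)).trans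
    ⟨(Path.Homotopy.reflTransSymm γ₁).symm⟩)
  funext v
  rw [hA.parallelTransport hcov, hB.parallelTransport hcov]
  exact B.symm.injective ((DFunLike.congr_fun h2 v).trans (B.symm_apply_apply v).symm)

theorem IsFlat.parallelTransport_eq_id [SecondCountableTopology M]
    (hcov : CovariantDerivative.ContMDiffCovariantDerivative cov ∞) (hflat : IsFlat cov) {x : M}
    {γ : Path x x} (h : PiecewiseSmooth E γ) (hγ : γ.Homotopic (Path.refl x)) :
    parallelTransport cov γ = id := by
  obtain ⟨A, hA⟩ := exists_hasTransport hcov h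
  funext v
  rw [hA.parallelTransport hcov, hflat.eq_one hcov hA hγ]
  rfl

/-- Trivial transport around triangles makes radial frames with different centres multiplicative.
Differentiating this relation shows that a radial frame is parallel in every direction, and the
curvature vanishes at its centre. -/
theorem isFlat_of_parallelTransport_eq_id
    (hcov : CovariantDerivative.ContMDiffCovariantDerivative cov ∞)
    (H : ∀ (x : M) (γ : Path x x), PiecewiseSmooth E γ → γ.Homotopic (Path.refl x) →
      parallelTransport cov γ = id) : IsFlat cov := by
  intro X Y σ hX hY hσ x₀
  obtain ⟨A, r, h⟩ := exists_isLocalForm cov hcov x₀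
  have hx₀ := mem_chartBall (E := E) x₀ h.pos
  set e := trivializationAt F V x₀
  set φ := extChartAt 𝓘(ℝ, E) x₀ with hφ
  choose U hU using fun p => exists_isRadialFrame h.contDiff p
  -- The direct segment from p to z and the detour through y bound a triangle inside the ball.
  have hmul : ∀ p ∈ Metric.ball (φ x₀) r, ∀ y ∈ Metric.ball (φ x₀) r,
      ∀ z ∈ Metric.ball (φ x₀) r, U p z = U y z * U p y := by
    intro p hp y hy z hz
    obtain ⟨a, har, has, ha⟩ := h.tr_line hp hy (hU p)
    obtain ⟨b, hbr, hbs, hb⟩ := h.tr_line hy hz (hU y)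
    obtain ⟨c, hcr, hcs, hc⟩ := h.tr_line hp hz (hU p)
    have hloop : ((a.trans b).trans c.symm).Homotopic (Path.refl _) := by
      refine h.isChartRadius.homotopic ?_ ?_
      · rw [Path.trans_range, Path.trans_range, Path.symm_range]
        exact union_subset (union_subset har hbr) hcr
      · rw [Path.refl_range, singleton_subset_iff]
        exact h.isChartRadius.symm_mem hp
    have hs := pwSmooth_trans (pwSmooth_trans has hbs) (pwSmooth_symm hcs)
    obtain ⟨B, hB⟩ := exists_hasTransport hcov (pwSmooth_trans has hbs)
    obtain ⟨C, hC⟩ := exists_hasTransport hcov hcs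
    ext f
    have h1 := congrFun (H _ _ hs hloop) (e.symm _ f)
    rw [(hB.trans hC.symm).parallelTransport hcov] at h1
    have h2 : B (e.symm _ f) = C (e.symm _ f) := (C.symm_apply_eq).1 h1
    rw [← ((hB _).unique hcov ((ha f).trans (hb _))).symm, ← ((hC _).unique hcov (hc f)).symm] at h2
    have h3 := h.chartBall_subset (h.isChartRadius.symm_mem hz)
    have h4 := congrArg (fun v => (e ⟨_, v⟩).2) h2
    rw [e.apply_mk_symm h3, e.apply_mk_symm h3] at h4
    exact h4.symm
  have hcurv : ∀ v w, formCurvature A (φ x₀) v w = 0 := by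
    refine fun v w => formCurvature_eq_zero_of_frame h.contDiff (hU (φ x₀)).1 (hU (φ x₀)).2.1 ?_ v w
    filter_upwards [Metric.ball_mem_nhds (φ x₀) h.pos] with y hy w
    -- The relation is differentiated in z at z = y, the centre of `U y`, where the differential of
    -- `U y` is -A.
    have h1 : U (φ x₀) =ᶠ[𝓝 y] fun z => U y z * U (φ x₀) y := by
      filter_upwards [Metric.isOpen_ball.mem_nhds hy] with z hz
      exact hmul _ hx₀.2 y hy z hz
    have h2 := (((hU y).1.differentiable (by simp) y).hasFDerivAt.mul_const'
      (U (φ x₀) y)).congr_of_eventuallyEq h1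
    rw [h2.fderiv, ← (hU y).fderiv_center]
    rfl
  have h1 := h.trivialization_curvature hx₀ hX hY hσ
  rw [hcurv, zero_apply, ← e.continuousLinearMapAt_apply_of_mem ℝ (h.chartBall_subset hx₀)] at h1
  rw [← e.symmL_continuousLinearMapAt (R := ℝ) (h.chartBall_subset hx₀) (curvature cov X Y σ x₀),
    h1, map_zero]

end Flat

/-! ### The holonomy groups and the fundamental group -/

section HolonomyGroup

variable {E F : Type} [NormedAddCommGroup E] [NormedSpace ℝ E]
  [NormedAddCommGroup F] [NormedSpace ℝ F] [FiniteDimensional ℝ F]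
  [FiniteDimensional ℝ E] {M : Type*} [TopologicalSpace M] [T2Space M] [ChartedSpace E M]
  [IsManifold 𝓘(ℝ, E) ∞ M]
  {V : M → Type*} [TopologicalSpace (TotalSpace F V)]
  [∀ x, AddCommGroup (V x)] [∀ x, Module ℝ (V x)] [∀ x, TopologicalSpace (V x)]
  [∀ x, IsTopologicalAddGroup (V x)] [∀ x, ContinuousSMul ℝ (V x)]
  [FiberBundle F V] [VectorBundle ℝ F V] [ContMDiffVectorBundle ∞ F V 𝓘(ℝ, E)]
  {cov : CovariantDerivative 𝓘(ℝ, E) F V}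

theorem hasTransport_iff (hcov : CovariantDerivative.ContMDiffCovariantDerivative cov ∞) {x y : M}
    {γ : Path x y} {A : V x ≃L[ℝ] V y} :
    HasTransport cov γ A ↔ PiecewiseSmooth E γ ∧ ∀ v, A v = parallelTransport cov γ v := by
  refine ⟨fun h => ⟨h.piecewiseSmooth, fun v => (h.parallelTransport hcov v).symm⟩, fun h => ?_⟩
  obtain ⟨B, hB⟩ := exists_hasTransport hcov h.1
  have : A = B := by
    ext v
    rw [h.2, hB.parallelTransport hcov]
  rwa [this]

theorem coe_holSubgroup (hcov : CovariantDerivative.ContMDiffCovariantDerivative cov ∞) (x : M) :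
    (holSubgroup hcov x : Set (V x ≃L[ℝ] V x)) = holonomySet cov x := by
  ext A
  exact exists_congr fun γ => hasTransport_iff hcov

theorem coe_restrictedHolSubgroup (hcov : CovariantDerivative.ContMDiffCovariantDerivative cov ∞)
    (x : M) :
    (restrictedHolSubgroup hcov x : Set (V x ≃L[ℝ] V x)) = restrictedHolonomySet cov x := by
  ext A
  refine exists_congr fun γ => ?_
  rw [hasTransport_iff hcov]
  tauto

theorem holonomyGroup_eq (hcov : CovariantDerivative.ContMDiffCovariantDerivative cov ∞) (x : M) :
    holonomyGroup cov x = holSubgroup hcov x := by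
  rw [holonomyGroup, ← coe_holSubgroup hcov, Subgroup.closure_eq]

theorem restrictedHolonomyGroup_eq (hcov : CovariantDerivative.ContMDiffCovariantDerivative cov ∞)
    (x : M) : restrictedHolonomyGroup cov x = restrictedHolSubgroup hcov x := by
  rw [restrictedHolonomyGroup, ← coe_restrictedHolSubgroup hcov, Subgroup.closure_eq]

theorem restrictedHolSubgroup_le (hcov : CovariantDerivative.ContMDiffCovariantDerivative cov ∞)
    (x : M) : restrictedHolSubgroup hcov x ≤ holSubgroup hcov x := by
  rintro A ⟨γ, hA, -⟩
  exact ⟨γ, hA⟩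

theorem conj_mem_restrictedHolSubgroup
    (hcov : CovariantDerivative.ContMDiffCovariantDerivative cov ∞) {x : M} {A B : V x ≃L[ℝ] V x}
    (hA : A ∈ holSubgroup hcov x) (hB : B ∈ restrictedHolSubgroup hcov x) :
    A * B * A⁻¹ ∈ restrictedHolSubgroup hcov x := by
  obtain ⟨γ, hA⟩ := (holSubgroup hcov x).inv_mem hA
  exact hA.conj_mem hcov hB

theorem HasTransport.inv_mul_mem (hcov : CovariantDerivative.ContMDiffCovariantDerivative cov ∞)
    {x : M} {γ γ' : Path x x} {A B : V x ≃L[ℝ] V x} (hA : HasTransport cov γ A)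
    (hB : HasTransport cov γ' B) (h : γ.Homotopic γ') :
    A⁻¹ * B ∈ restrictedHolSubgroup hcov x :=
  ⟨_, hB.trans hA.symm, (h.symm.hcomp (Path.Homotopic.refl _)).trans
    ⟨(Path.Homotopy.reflTransSymm γ).symm⟩⟩

/-- The coset of a transport depends only on the homotopy class of the loop, and there are countably
many classes because the loop space is second countable and nearby loops are homotopic. -/
theorem exists_countable_cosets [SecondCountableTopology M]
    (hcov : CovariantDerivative.ContMDiffCovariantDerivative cov ∞) (x : M) :
    ∃ S : Set (V x ≃L[ℝ] V x), S.Countable ∧ ∀ A ∈ holSubgroup hcov x,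
      ∃ B ∈ S, B ∈ holSubgroup hcov x ∧ B⁻¹ * A ∈ restrictedHolSubgroup hcov x := by
  have : LocallyCompactSpace M := ChartedSpace.locallyCompactSpace E M
  have : SecondCountableTopology (Path x x) :=
    TopologicalSpace.secondCountableTopology_induced _ C(unitInterval, M) _
  obtain ⟨S, hS, hSr⟩ := PathCongruence.exists_countable_representatives
    (locallyGood_homotopyCongruence E (M := M)) (fun x W hW => by
      obtain ⟨U, h1, h2, h3, h4⟩ := exists_piecewiseSmooth_connected_nhds (E := E) x hW
      refine ⟨U, h1, h2, h3, fun p hp q hq => ?_⟩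
      obtain ⟨a, -, ha⟩ := h4 p hp q hq
      exact ⟨a, trivial, ha⟩) x x
  choose f hf hfr using fun γ : Path x x => exists_piecewiseSmooth_homotopic E γ
  choose T hT using fun γ : Path x x => exists_hasTransport hcov (hf γ)
  refine ⟨T '' S, hS.image _, ?_⟩
  rintro A ⟨γ, hA⟩
  obtain ⟨a, haS, -, ha⟩ := hSr γ trivial
  exact ⟨T a, mem_image_of_mem _ haS, ⟨_, hT a⟩, (hT a).inv_mul_mem hcov hA ((hfr a).trans ha)⟩

/-- Transports along homotopic loops differ by the transport along a null-homotopic loop, so the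
coset depends only on the class. Each class has a piecewise smooth representative, which gives
existence as well as uniqueness. -/
theorem exists_fundamentalGroup_hom [SecondCountableTopology M]
    (hcov : CovariantDerivative.ContMDiffCovariantDerivative cov ∞) (x : M) :
    ∃ _ : ((restrictedHolonomyGroup cov x).subgroupOf (holonomyGroup cov x)).Normal,
      ∃! Φ : FundamentalGroup M x →* (holonomyGroup cov x ⧸
          (restrictedHolonomyGroup cov x).subgroupOf (holonomyGroup cov x)),
        Function.Surjective Φ ∧ ∀ (γ : Path x x) (A : holonomyGroup cov x),
          PiecewiseSmooth E γ → (∀ v, (A : V x ≃L[ℝ] V x) v = parallelTransport cov γ v) →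
          Φ (FundamentalGroup.fromPath (Path.Homotopic.Quotient.mk γ)) = QuotientGroup.mk A := by
  rw [restrictedHolonomyGroup_eq hcov, holonomyGroup_eq hcov]
  have hn : ((restrictedHolSubgroup hcov x).subgroupOf (holSubgroup hcov x)).Normal :=
    ⟨fun B hB A => conj_mem_restrictedHolSubgroup hcov A.2 hB⟩
  refine ⟨hn, ?_⟩
  have hex : ∀ q : FundamentalGroup M x, ∃ (γ : Path x x) (A : holSubgroup hcov x),
      FundamentalGroup.fromPath (Path.Homotopic.Quotient.mk γ) = q ∧
        HasTransport cov γ (A : V x ≃L[ℝ] V x) := by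
    intro q
    obtain ⟨γ, rfl⟩ := Path.Homotopic.Quotient.mk_surjective q
    obtain ⟨a, ha, har⟩ := exists_piecewiseSmooth_homotopic E γ
    obtain ⟨A, hA⟩ := exists_hasTransport hcov ha
    exact ⟨a, ⟨A, a, hA⟩, Quotient.sound har, hA⟩
  choose c T hc hT using hex
  have key : ∀ (γ : Path x x) (A : holSubgroup hcov x), HasTransport cov γ (A : V x ≃L[ℝ] V x) →
      (QuotientGroup.mk (T (FundamentalGroup.fromPath (Path.Homotopic.Quotient.mk γ))) :
        holSubgroup hcov x ⧸ (restrictedHolSubgroup hcov x).subgroupOf (holSubgroup hcov x)) =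
        QuotientGroup.mk A := by
    intro γ A hA
    rw [QuotientGroup.eq]
    exact (hT _).inv_mul_mem hcov hA (Quotient.exact (hc _))
  let Φ : FundamentalGroup M x →* (holSubgroup hcov x ⧸
      (restrictedHolSubgroup hcov x).subgroupOf (holSubgroup hcov x)) :=
    MonoidHom.mk' (fun q => QuotientGroup.mk (T q)) fun p q => by
      -- In `p * q` the loop of q is run first, as in products of transports, so Φ is a homomorphism
      -- and not an antihomomorphism.
      have h1 : FundamentalGroup.fromPath (Path.Homotopic.Quotient.mk ((c q).trans (c p))) =
          p * q := by
        conv_rhs => rw [← hc p, ← hc q]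
        rfl
      have h2 := key ((c q).trans (c p)) (T p * T q) ((hT q).trans (hT p))
      rw [h1] at h2
      exact h2
  refine ⟨Φ, ⟨?_, fun γ A hγ hA => key γ A ((hasTransport_iff hcov).2 ⟨hγ, hA⟩)⟩, ?_⟩
  · intro q
    obtain ⟨A, rfl⟩ := QuotientGroup.mk_surjective q
    obtain ⟨γ, hA⟩ := A.2
    exact ⟨_, key γ A hA⟩
  · rintro Ψ ⟨-, hΨ⟩
    ext q
    have h1 := hΨ (c q) (T q) (hT q).piecewiseSmooth fun v => ((hT q).parallelTransport hcov v).symm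
    rw [hc] at h1
    exact h1

end HolonomyGroup

/-! ### Local charts of groups whose elements are joined to the identity by smooth curves -/

section LocalChart

variable {𝔸 : Type} [NormedRing 𝔸] [NormedAlgebra ℝ 𝔸]
  {P : Type} [NormedAddCommGroup P] [NormedSpace ℝ P]

/-- `f` is a smooth map with values in the subgroup `K`. -/
def SmoothInto (K : Subgroup 𝔸ˣ) (f : P → 𝔸ˣ) : Prop :=
  ContDiff ℝ ∞ (fun x => (f x : 𝔸)) ∧ ∀ x, f x ∈ K

variable {K : Subgroup 𝔸ˣ}

theorem smoothInto_const {g : 𝔸ˣ} (hg : g ∈ K) : SmoothInto K (fun _ : P => g) :=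
  ⟨contDiff_const, fun _ => hg⟩

theorem SmoothInto.mul {f g : P → 𝔸ˣ} (hf : SmoothInto K f) (hg : SmoothInto K g) :
    SmoothInto K (fun x => f x * g x) :=
  ⟨by simpa using hf.1.mul hg.1, fun x => K.mul_mem (hf.2 x) (hg.2 x)⟩

theorem SmoothInto.inv [CompleteSpace 𝔸] {f : P → 𝔸ˣ} (hf : SmoothInto K f) :
    SmoothInto K (fun x => (f x)⁻¹) := by
  refine ⟨?_, fun x => K.inv_mem (hf.2 x)⟩
  simp only [← Ring.inverse_unit]
  exact contDiff_iff_contDiffAt.2 fun x => ContDiffAt.comp (g := Ring.inverse)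
    (f := fun x => (f x : 𝔸)) x (contDiffAt_ringInverse ℝ (f x)) hf.1.contDiffAt

theorem SmoothInto.comp {Q : Type} [NormedAddCommGroup Q] [NormedSpace ℝ Q] {f : P → 𝔸ˣ}
    (hf : SmoothInto K f) {g : Q → P} (hg : ContDiff ℝ ∞ g) : SmoothInto K (fun x => f (g x)) :=
  ⟨hf.1.comp hg, fun x => hf.2 (g x)⟩

/-- The initial velocities of the smooth curves in `K` starting at the identity. -/
def velocities (K : Subgroup 𝔸ˣ) : Submodule ℝ 𝔸 where
  carrier := {X | ∃ c : ℝ → 𝔸ˣ, SmoothInto K c ∧ c 0 = 1 ∧ HasDerivAt (fun s => (c s : 𝔸)) X 0}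
  zero_mem' := ⟨fun _ => 1, smoothInto_const K.one_mem, rfl, hasDerivAt_const _ _⟩
  -- Products of curves through 1 add their velocities, and linear changes of time multiply them by
  -- scalars.
  add_mem' := by
    rintro X Y ⟨c, hc, hc0, hcX⟩ ⟨c', hc', hc0', hcX'⟩
    exact ⟨_, hc.mul hc', by simp [hc0, hc0'], by simpa [hc0, hc0'] using! hcX.mul hcX'⟩
  smul_mem' := by
    rintro a X ⟨c, hc, hc0, hcX⟩
    refine ⟨fun s => c (a * s), hc.comp (contDiff_const.mul contDiff_id), by simp [hc0], ?_⟩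
    have h1 : HasDerivAt (fun s => a * s) a 0 := by simpa using (hasDerivAt_id (0 : ℝ)).const_mul a
    exact HasDerivAt.scomp (0 : ℝ) (h := fun s => a * s) (by simpa using hcX) h1

/-- Right translation by f(x)⁻¹ moves the curve s ↦ f(x + sv) to the identity without leaving K. -/
theorem SmoothInto.fderiv_mul_inv_mem {f : P → 𝔸ˣ} (hf : SmoothInto K f) (x v : P) :
    fderiv ℝ (fun x => (f x : 𝔸)) x v * ↑(f x)⁻¹ ∈ velocities K := by
  refine ⟨fun s => f (x + s • v) * (f x)⁻¹, (hf.comp (g := fun s : ℝ => x + s • v)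
    (by fun_prop)).mul (smoothInto_const (K.inv_mem (hf.2 x))), by simp, ?_⟩
  have h1 : HasDerivAt (fun s : ℝ => x + s • v) v 0 := hasDerivAt_ray x v 0
  have h2 := ((hf.1.differentiable (by simp)) (x + (0 : ℝ) • v)).hasFDerivAt.comp_hasDerivAt 0 h1
  simpa using h2.mul_const (↑(f x)⁻¹ : 𝔸)

/-- Multiply curves with velocities `X i`, each evaluated at `ℓ i`. All factors are 1 at the origin,
so the differential of the product there is the sum. -/
theorem exists_smoothInto_hasFDerivAt {n : ℕ} (ℓ : Fin n → P →L[ℝ] ℝ) (X : Fin n → 𝔸)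
    (hX : ∀ i, X i ∈ velocities K) : ∃ f : P → 𝔸ˣ, SmoothInto K f ∧ f 0 = 1 ∧
      HasFDerivAt (fun x => (f x : 𝔸)) (∑ i, (ℓ i).smulRight (X i)) 0 := by
  induction n with
  | zero => exact ⟨fun _ => 1, smoothInto_const K.one_mem, rfl, by simpa using hasFDerivAt_const _ _⟩
  | succ n ih =>
    obtain ⟨f, hf, hf0, hfX⟩ := ih (fun i => ℓ i.castSucc) (fun i => X i.castSucc) fun i => hX _
    obtain ⟨c, hc, hc0, hcX⟩ := hX (Fin.last n)
    refine ⟨fun x => f x * c (ℓ (Fin.last n) x), hf.mul (hc.comp (ℓ (Fin.last n)).contDiff),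
      by simp [hf0, hc0], ?_⟩
    have h1 : HasFDerivAt (fun x => (c (ℓ (Fin.last n) x) : 𝔸))
        ((ℓ (Fin.last n)).smulRight (X (Fin.last n))) 0 := by
      have hcX' : HasDerivAt (fun s => (c s : 𝔸)) (X (Fin.last n)) (ℓ (Fin.last n) 0) := by
        simpa using hcX
      convert! hcX'.hasFDerivAt.comp (0 : P) (ℓ (Fin.last n)).hasFDerivAt using 1
    have h2 := hfX.mul' h1
    simp only [hf0, hc0, map_zero, Units.val_one, one_smul, MulOpposite.op_one] at h2
    rw [Fin.sum_univ_castSucc, add_comm]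
    exact h2

/-- A smooth parametrization `ψ` of a neighbourhood of the identity of `K` (for the Lie group
topology), with a smooth left inverse `τ`. -/
structure GroupChart (K : Subgroup 𝔸ˣ) (d : ℕ) where
  ψ : EuclideanSpace ℝ (Fin d) → 𝔸ˣ
  smooth : SmoothInto K ψ
  ψ_zero : ψ 0 = 1
  τ : 𝔸 → EuclideanSpace ℝ (Fin d)
  W : Set 𝔸
  D : Set (EuclideanSpace ℝ (Fin d))
  isOpen_W : IsOpen W
  isOpen_D : IsOpen D
  zero_mem : 0 ∈ D
  contDiffOn_τ : ContDiffOn ℝ ∞ τ W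
  mem_W : ∀ t ∈ D, (ψ t : 𝔸) ∈ W
  τ_ψ : ∀ t ∈ D, τ (ψ t) = t
  -- A smooth map into K that meets the slice ψ(D) stays in it nearby. This property makes the
  -- topology defined by ψ compatible with the group operations.
  absorb : ∀ {P : Type} [NormedAddCommGroup P] [NormedSpace ℝ P] {f : P → 𝔸ˣ},
    SmoothInto K f → ∀ {x}, f x ∈ ψ '' D → ∀ᶠ y in 𝓝 x, f y ∈ ψ '' D

/-- Write 𝔨 for the space of velocities. In the coordinates a = ψ(t)(1 + m), with m in a complement
of 𝔨, the tangent space at a of the slice m = const is contained in 𝔨a and has the same dimension,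
so it equals 𝔨a. Every smooth curve in K is tangent to these spaces, hence stays in a slice. -/
theorem exists_groupChart [FiniteDimensional ℝ 𝔸] [CompleteSpace 𝔸] (K : Subgroup 𝔸ˣ) :
    Nonempty (GroupChart K (Module.finrank ℝ (velocities K))) := by
  set d := Module.finrank ℝ (velocities K) with hd
  let b : Module.Basis (Fin d) ℝ (velocities K) := Module.finBasis ℝ (velocities K)
  obtain ⟨ψ, hψ, hψ0, hψd⟩ := exists_smoothInto_hasFDerivAt
    (fun i => (EuclideanSpace.proj i : EuclideanSpace ℝ (Fin d) →L[ℝ] ℝ))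
    (fun i => (b i : 𝔸)) (fun i => (b i).2)
  obtain ⟨𝔪, h𝔪⟩ := (velocities K).exists_isCompl
  let Ψ : EuclideanSpace ℝ (Fin d) × 𝔪 → 𝔸 := fun z => ψ z.1 * (1 + (z.2 : 𝔸))
  have hsnd : ContDiff ℝ ∞ fun z : EuclideanSpace ℝ (Fin d) × 𝔪 => (1 + (z.2 : 𝔸)) :=
    contDiff_const.add (𝔪.subtypeL.contDiff.comp contDiff_snd)
  have hΨ : ContDiff ℝ ∞ Ψ := (hψ.1.comp contDiff_fst).mul hsnd
  have hΨd : ∀ (z v : EuclideanSpace ℝ (Fin d) × 𝔪), fderiv ℝ Ψ z v =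
      fderiv ℝ (fun t => (ψ t : 𝔸)) z.1 v.1 * (1 + (z.2 : 𝔸)) + ψ z.1 * (v.2 : 𝔸) := by
    intro z v
    have h1 := ((hψ.1.differentiable (by simp)) z.1).hasFDerivAt.comp z
      (hasFDerivAt_fst (𝕜 := ℝ) (E := EuclideanSpace ℝ (Fin d)) (F := 𝔪) (p := z))
    have h2 : HasFDerivAt (fun z : EuclideanSpace ℝ (Fin d) × 𝔪 => (1 + (z.2 : 𝔸)))
        (𝔪.subtypeL.comp (ContinuousLinearMap.snd ℝ _ _)) z :=
      ((𝔪.subtypeL.hasFDerivAt (x := z.2)).comp z hasFDerivAt_snd).const_add 1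
    have h3 := (h1.mul' h2).fderiv
    change fderiv ℝ Ψ z = _ at h3
    rw [h3]
    simp [add_comm]
  let Λ₀ : (EuclideanSpace ℝ (Fin d) × 𝔪) ≃L[ℝ] 𝔸 :=
    ((((WithLp.linearEquiv 2 ℝ (Fin d → ℝ)).trans b.equivFun.symm).prodCongr
      (LinearEquiv.refl ℝ 𝔪)).trans
        (Submodule.prodEquivOfIsCompl (velocities K) 𝔪 h𝔪)).toContinuousLinearEquiv
  have hΛ₀ : HasFDerivAt Ψ (Λ₀ : EuclideanSpace ℝ (Fin d) × 𝔪 →L[ℝ] 𝔸) 0 := by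
    have h1 : (Λ₀ : EuclideanSpace ℝ (Fin d) × 𝔪 →L[ℝ] 𝔸) = fderiv ℝ Ψ 0 := by
      refine ContinuousLinearMap.ext fun v => ?_
      rw [hΨd]
      simp [Λ₀, hψd.fderiv, hψ0, Module.Basis.equivFun_symm_apply, sum_apply]
    rw [h1]
    exact ((hΨ.differentiable (by simp)) 0).hasFDerivAt
  let e₀ := hΨ.contDiffAt.toOpenPartialHomeomorph Ψ hΛ₀ (by simp)
  -- The inverse function theorem controls the differential at the origin; the domain is cut down to
  -- the open set where it stays invertible, so that it can be used at every point.
  have hO : IsOpen {z | ∃ Λ : (EuclideanSpace ℝ (Fin d) × 𝔪) ≃L[ℝ] 𝔸,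
      (Λ : EuclideanSpace ℝ (Fin d) × 𝔪 →L[ℝ] 𝔸) = fderiv ℝ Ψ z} :=
    (ContinuousLinearEquiv.isOpen (𝕜 := ℝ) (E := EuclideanSpace ℝ (Fin d) × 𝔪) (F := 𝔸)).preimage
      (hΨ.continuous_fderiv (by simp))
  let e := e₀.restrOpen _ hO
  have he : ∀ z, e z = Ψ z := fun z => rfl
  have hes : ∀ z ∈ e.source, ∃ Λ : (EuclideanSpace ℝ (Fin d) × 𝔪) ≃L[ℝ] 𝔸,
      HasFDerivAt Ψ (Λ : EuclideanSpace ℝ (Fin d) × 𝔪 →L[ℝ] 𝔸) z := by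
    intro z hz
    obtain ⟨Λ, hΛ⟩ := hz.2
    exact ⟨Λ, hΛ ▸ ((hΨ.differentiable (by simp)) z).hasFDerivAt⟩
  have he0 : (0 : EuclideanSpace ℝ (Fin d) × 𝔪) ∈ e.source :=
    ⟨hΨ.contDiffAt.mem_toOpenPartialHomeomorph_source hΛ₀ (by simp), Λ₀, hΛ₀.fderiv.symm⟩
  have hsymm : ContDiffOn ℝ ∞ e.symm e.target := by
    intro a ha
    obtain ⟨Λ, hΛ⟩ := hes _ (e.map_target ha)
    exact (e.contDiffAt_symm ha hΛ hΨ.contDiffAt).contDiffWithinAt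
  -- The transverse coordinate m is constant along smooth curves in K.
  have hconst : ∀ c : ℝ → 𝔸ˣ, SmoothInto K c → (∀ s ∈ Icc (0 : ℝ) 1, (c s : 𝔸) ∈ e.target) →
      (e.symm (c 1)).2 = (e.symm (c 0)).2 := by
    intro c hc hcW
    have hder : ∀ s ∈ Icc (0 : ℝ) 1, HasDerivAt (fun s => (e.symm (c s)).2) 0 s := by
      intro s hs
      obtain ⟨Λ, hΛ⟩ := hes _ (e.map_target (hcW s hs))
      have hcs := ((hc.1.differentiable (by simp)) s).hasFDerivAt.hasDerivAt
      set c' := fderiv ℝ (fun s => (c s : 𝔸)) s 1 with hc'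
      set z := e.symm (c s) with hz
      have hes' : HasFDerivAt e.symm (Λ.symm : 𝔸 →L[ℝ] EuclideanSpace ℝ (Fin d) × 𝔪) (c s : 𝔸) :=
        e.hasFDerivAt_symm (hcW s hs) hΛ
      have h1 := hes'.comp_hasDerivAt s hcs
      have hzc : (ψ z.1 : 𝔸) * (1 + (z.2 : 𝔸)) = c s := e.right_inv (hcW s hs)
      -- Right-translated tangent vectors of ψ are velocities. R is injective since dΨ is
      -- invertible, and onto by equality of dimensions; so the velocity of c at s is tangent to the
      -- slice.
      let R : EuclideanSpace ℝ (Fin d) →ₗ[ℝ] velocities K :=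
        { toFun := fun v => ⟨_, hψ.fderiv_mul_inv_mem z.1 v⟩
          map_add' := fun v w => Subtype.ext (by simp [add_mul])
          map_smul' := fun a v => Subtype.ext (by simp) }
      have hRi : Function.Injective R := by
        refine (injective_iff_map_eq_zero R).2 fun v hv => ?_
        have h2 : fderiv ℝ (fun t => (ψ t : 𝔸)) z.1 v = 0 := by
          have h3 : fderiv ℝ (fun t => (ψ t : 𝔸)) z.1 v * ↑(ψ z.1)⁻¹ = 0 := congrArg Subtype.val hv
          simpa [mul_assoc] using congrArg (· * (ψ z.1 : 𝔸)) h3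
        have h3 : Λ (v, 0) = 0 := by
          change (Λ : EuclideanSpace ℝ (Fin d) × 𝔪 →L[ℝ] 𝔸) (v, 0) = 0
          rw [← hΛ.fderiv, hΨd]
          simp [h2]
        exact congrArg Prod.fst (Λ.injective (h3.trans (map_zero Λ).symm))
      have hRs : Function.Surjective R :=
        (LinearMap.injective_iff_surjective_of_finrank_eq_finrank (by simp [hd])).1 hRi
      obtain ⟨v, hv⟩ := hRs ⟨_, hc.fderiv_mul_inv_mem s 1⟩
      have hv' : fderiv ℝ (fun t => (ψ t : 𝔸)) z.1 v * ↑(ψ z.1)⁻¹ = c' * ↑(c s)⁻¹ :=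
        congrArg Subtype.val hv
      have h4 : Λ (v, 0) = c' := by
        change (Λ : EuclideanSpace ℝ (Fin d) × 𝔪 →L[ℝ] 𝔸) (v, 0) = c'
        rw [← hΛ.fderiv, hΨd]
        have h5 : fderiv ℝ (fun t => (ψ t : 𝔸)) z.1 v = c' * ↑(c s)⁻¹ * ψ z.1 := by
          rw [← hv']
          simp [mul_assoc]
        simp only [h5, ZeroMemClass.coe_zero, mul_zero, add_zero]
        rw [mul_assoc, hzc]
        simp [mul_assoc]
      have h6 : Λ.symm c' = (v, 0) := by rw [← h4, Λ.symm_apply_apply]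
      have h7 := hasFDerivAt_snd.comp_hasDerivAt s h1
      simpa [h6] using! h7
    exact constant_of_has_deriv_right_zero
      (fun s hs => (hder s hs).continuousAt.continuousWithinAt)
      (fun s hs => (hder s (Ico_subset_Icc_self hs)).hasDerivWithinAt) 1
      (right_mem_Icc.2 zero_le_one)
  have hψD : ∀ t, ((t, 0) : EuclideanSpace ℝ (Fin d) × 𝔪) ∈ e.source → e (t, 0) = ψ t := by
    intro t _
    rw [he]
    simp [Ψ]
  exact ⟨{
    ψ := ψ
    smooth := hψ
    ψ_zero := hψ0
    τ := fun x => (e.symm x).1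
    W := e.target
    D := {t | ((t, 0) : EuclideanSpace ℝ (Fin d) × 𝔪) ∈ e.source}
    isOpen_W := e.open_target
    isOpen_D := e.open_source.preimage (by fun_prop)
    zero_mem := he0
    contDiffOn_τ := contDiff_fst.comp_contDiffOn hsymm
    mem_W := fun t ht => hψD t ht ▸ e.map_source ht
    τ_ψ := fun t ht => by rw [← hψD t ht, e.left_inv ht]
    absorb := by
      rintro P _ _ f hf x ⟨t, ht, htx⟩
      have hx : (f x : 𝔸) ∈ e.target := by
        rw [← htx, ← hψD t ht]
        exact e.map_source ht
      obtain ⟨ε, hε, hεW⟩ := Metric.mem_nhds_iff.1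
        (hf.1.continuous.continuousAt.preimage_mem_nhds (e.open_target.mem_nhds hx))
      filter_upwards [Metric.ball_mem_nhds x hε] with y hy
      -- The segment from x to y is mapped to a smooth curve in K, along which m keeps its value 0
      -- from x.
      have h1 := hconst (fun s => f (x + s • (y - x)))
        (hf.comp (g := fun s : ℝ => x + s • (y - x)) (by fun_prop)) fun s hs =>
        hεW ((convex_ball x ε).add_smul_sub_mem (Metric.mem_ball_self hε) hy hs)
      simp only [one_smul, add_sub_cancel, zero_smul, add_zero] at h1
      rw [← htx, ← hψD t ht, e.left_inv ht] at h1
      have h2 : (f y : 𝔸) ∈ e.target := hεW hy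
      have h3 : ((e.symm (f y)).1, 0) = e.symm (f y) := Prod.ext rfl h1.symm
      refine ⟨(e.symm (f y)).1, ?_, Units.ext ?_⟩
      · rw [mem_ofPred_eq, h3]
        exact e.map_target h2
      · rw [← hψD _ (by rw [h3]; exact e.map_target h2), h3, e.right_inv h2] }⟩

end LocalChart

/-! ### The Lie group structure defined by a local chart -/

section LieGroupStructure

variable {𝔸 : Type} [NormedRing 𝔸] [NormedAlgebra ℝ 𝔸] [CompleteSpace 𝔸]
  {P : Type} [NormedAddCommGroup P] [NormedSpace ℝ P] {K₀ K : Subgroup 𝔸ˣ} {d : ℕ}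

theorem GroupChart.continuousAt_τ (h : GroupChart K₀ d) {a : 𝔸} (ha : a ∈ h.W) :
    ContinuousAt h.τ a :=
  h.contDiffOn_τ.continuousOn.continuousAt (h.isOpen_W.mem_nhds ha)

/-- `absorb` keeps f in the slice, and the continuous left inverse τ keeps the parameter in the
prescribed neighbourhood. Each axiom of the neighbourhood basis below that involves a group
operation is an instance of this. -/
theorem GroupChart.eventually_mem_image (h : GroupChart K₀ d) {f : P → 𝔸ˣ}
    (hf : SmoothInto K₀ f) {x : P} {t : EuclideanSpace ℝ (Fin d)} (ht : t ∈ h.D) (hx : f x = h.ψ t)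
    {U : Set (EuclideanSpace ℝ (Fin d))} (hU : U ∈ 𝓝 t) :
    ∀ᶠ y in 𝓝 x, f y ∈ h.ψ '' (U ∩ h.D) := by
  have h1 : ContinuousAt (fun y => h.τ (f y)) x := by
    refine ContinuousAt.comp (g := h.τ) (f := fun y => (f y : 𝔸)) ?_ hf.1.continuous.continuousAt
    rw [hx]
    exact h.continuousAt_τ (h.mem_W t ht)
  have h2 : U ∈ 𝓝 (h.τ (f x)) := by rwa [hx, h.τ_ψ t ht]
  filter_upwards [h.absorb hf ⟨t, ht, hx.symm⟩, h1 h2] with y ⟨s, hs, hsy⟩ hy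
  refine ⟨s, ⟨?_, hs⟩, hsy⟩
  rw [mem_preimage, ← hsy, h.τ_ψ s hs] at hy
  exact hy

variable (K₀ K d) in
/-- A local chart of the subgroup `K₀`, together with a group `K` of which `K₀` is a normal
subgroup. -/
structure LieData extends GroupChart K₀ d where
  le : K₀ ≤ K
  conj : ∀ {g a : 𝔸ˣ}, g ∈ K → a ∈ K₀ → g * a * g⁻¹ ∈ K₀

namespace LieData

/-- The group `K`, to be endowed with its Lie group structure. -/
def Carrier (_ : LieData K₀ K d) : Type := K

variable (h : LieData K₀ K d)

instance : Group h.Carrier := inferInstanceAs (Group K)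

/-- The inclusion of the Lie group. -/
def incl : h.Carrier →* 𝔸ˣ := K.subtype

theorem incl_injective : Function.Injective h.incl := Subtype.val_injective

/-- The parametrization of a neighbourhood of the identity. -/
def param (t : EuclideanSpace ℝ (Fin d)) : h.Carrier := ⟨h.ψ t, h.le (h.smooth.2 t)⟩

theorem incl_param (t : EuclideanSpace ℝ (Fin d)) : h.incl (h.param t) = h.ψ t := rfl

theorem mem_param_image {g : h.Carrier} {U : Set (EuclideanSpace ℝ (Fin d))} :
    g ∈ h.param '' U ↔ h.incl g ∈ h.ψ '' U :=
  ⟨fun ⟨t, ht, htg⟩ => ⟨t, ht, htg ▸ rfl⟩, fun ⟨t, ht, htg⟩ => ⟨t, ht, h.incl_injective htg⟩⟩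

theorem inter_mem_nhds {U : Set (EuclideanSpace ℝ (Fin d))} (hU : U ∈ 𝓝 0) :
    U ∩ h.D ∈ 𝓝 (0 : EuclideanSpace ℝ (Fin d)) :=
  Filter.inter_mem hU (h.isOpen_D.mem_nhds h.zero_mem)

/-- The neighbourhoods of the identity. -/
instance basis : GroupFilterBasis h.Carrier where
  sets := {S | ∃ U ∈ 𝓝 (0 : EuclideanSpace ℝ (Fin d)), h.param '' (U ∩ h.D) = S}
  nonempty := ⟨_, univ, Filter.univ_mem, rfl⟩
  inter_sets := by
    rintro _ _ ⟨U, hU, rfl⟩ ⟨U', hU', rfl⟩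
    refine ⟨_, ⟨U ∩ U', Filter.inter_mem hU hU', rfl⟩, subset_inter ?_ ?_⟩
    · exact image_mono (inter_subset_inter_left _ inter_subset_left)
    · exact image_mono (inter_subset_inter_left _ inter_subset_right)
  one' := by
    rintro _ ⟨U, hU, rfl⟩
    exact ⟨0, mem_of_mem_nhds (h.inter_mem_nhds hU), h.incl_injective h.ψ_zero⟩
  mul' := by
    rintro _ ⟨U, hU, rfl⟩
    have h1 := h.eventually_mem_image (x := (0, 0))
      ((h.smooth.comp contDiff_fst).mul (h.smooth.comp contDiff_snd)) h.zero_mem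
      (by simp [h.ψ_zero]) hU
    rw [nhds_prod_eq] at h1
    obtain ⟨V, hV, h1⟩ := Filter.eventually_prod_self_iff'.1 h1
    refine ⟨_, ⟨V, hV, rfl⟩, ?_⟩
    rintro _ ⟨_, ⟨s, hs, rfl⟩, _, ⟨t, ht, rfl⟩, rfl⟩
    exact h.mem_param_image.2 (h1 s hs.1 t ht.1)
  inv' := by
    rintro _ ⟨U, hU, rfl⟩
    refine ⟨_, ⟨_, h.eventually_mem_image h.smooth.inv h.zero_mem (by simp [h.ψ_zero]) hU, rfl⟩, ?_⟩
    rintro _ ⟨s, hs, rfl⟩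
    exact h.mem_param_image.2 hs.1
  conj' := by
    rintro g _ ⟨U, hU, rfl⟩
    have h1 : SmoothInto K₀ fun t => h.incl g * h.ψ t * (h.incl g)⁻¹ :=
      ⟨by simpa using (contDiff_const.mul h.smooth.1).mul contDiff_const,
        fun t => h.conj g.2 (h.smooth.2 t)⟩
    refine ⟨_, ⟨_, h.eventually_mem_image h1 h.zero_mem (by simp [h.ψ_zero]) hU, rfl⟩, ?_⟩
    rintro _ ⟨s, hs, rfl⟩
    exact h.mem_param_image.2 hs.1

instance : TopologicalSpace h.Carrier := h.basis.topology

instance : IsTopologicalGroup h.Carrier := h.basis.isTopologicalGroup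

theorem nhds_eq (g : h.Carrier) : 𝓝 g = Filter.map (fun t => g * h.param t) (𝓝 0) := by
  ext S
  rw [(h.basis.nhds_hasBasis g).mem_iff]
  constructor
  · rintro ⟨_, ⟨U, hU, rfl⟩, hS⟩
    rw [Filter.mem_map]
    filter_upwards [h.inter_mem_nhds hU] with t ht using hS ⟨_, ⟨t, ht, rfl⟩, rfl⟩
  · intro hS
    refine ⟨_, ⟨_, hS, rfl⟩, ?_⟩
    rintro _ ⟨_, ⟨t, ht, rfl⟩, rfl⟩
    exact ht.1

theorem continuous_val : Continuous fun g => (h.incl g : 𝔸) := by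
  refine continuous_iff_continuousAt.2 fun g => ?_
  rw [ContinuousAt, h.nhds_eq, Filter.tendsto_map'_iff]
  have h1 : Continuous fun t => (h.incl g : 𝔸) * h.ψ t := continuous_const.mul h.smooth.1.continuous
  simpa [h.ψ_zero] using! h1.tendsto 0

/-- After translation by f(x)⁻¹ the map takes the value 1 at x and stays in the slice nearby. Thus
smooth curves in K₀ are continuous for the group topology, not only for that of the ambient algebra.
-/
theorem continuous_of_smoothInto {f : P → h.Carrier} (hf : SmoothInto K₀ fun x => h.incl (f x)) :
    Continuous f := by
  refine continuous_iff_continuousAt.2 fun x S hS => ?_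
  rw [h.nhds_eq, Filter.mem_map] at hS
  rw [Filter.mem_map]
  filter_upwards [h.eventually_mem_image (x := x)
    ((smoothInto_const (K₀.inv_mem (hf.2 x))).mul hf) h.zero_mem (by simp [h.ψ_zero]) hS] with y ⟨t, ht, hty⟩
  have h1 : h.param t = (f x)⁻¹ * f y := h.incl_injective hty
  simpa [h1] using ht.1

theorem continuous_param : Continuous h.param := h.continuous_of_smoothInto h.smooth

theorem isOpen_image_param {U : Set (EuclideanSpace ℝ (Fin d))} (hU : IsOpen U) (hUD : U ⊆ h.D)
    (g : h.Carrier) : IsOpen ((fun t => g * h.param t) '' U) := by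
  refine isOpen_iff_mem_nhds.2 ?_
  rintro _ ⟨t, ht, rfl⟩
  rw [h.nhds_eq, Filter.mem_map]
  filter_upwards [h.eventually_mem_image ((smoothInto_const (h.smooth.2 t)).mul h.smooth)
    (hUD ht) (by simp [h.ψ_zero]) (hU.mem_nhds ht)] with s ⟨r, hr, hrs⟩
  have h1 : h.param r = h.param t * h.param s := h.incl_injective hrs
  exact ⟨r, hr.1, by simp [h1, mul_assoc]⟩

/-- The chart at `g`, inverse to `t ↦ g * ψ t`. -/
def chart (g : h.Carrier) : OpenPartialHomeomorph h.Carrier (EuclideanSpace ℝ (Fin d)) where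
  toFun x := h.τ (h.incl (g⁻¹ * x))
  invFun t := g * h.param t
  source := (fun t => g * h.param t) '' h.D
  target := h.D
  map_source' := by
    rintro _ ⟨t, ht, rfl⟩
    simpa [h.incl_param, h.τ_ψ t ht] using ht
  map_target' t ht := ⟨t, ht, rfl⟩
  left_inv' := by
    rintro _ ⟨t, ht, rfl⟩
    simp [h.incl_param, h.τ_ψ t ht]
  right_inv' t ht := by simp [h.incl_param, h.τ_ψ t ht]
  open_source := h.isOpen_image_param h.isOpen_D subset_rfl g
  open_target := h.isOpen_D
  continuousOn_toFun := by
    refine h.contDiffOn_τ.continuousOn.comp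
      (h.continuous_val.comp (continuous_const_mul g⁻¹)).continuousOn ?_
    rintro _ ⟨t, ht, rfl⟩
    simpa [h.incl_param] using h.mem_W t ht
  continuousOn_invFun := (h.continuous_param.const_mul g).continuousOn

theorem mem_chart_source (g : h.Carrier) : g ∈ (h.chart g).source :=
  ⟨0, h.zero_mem, by simp [show h.param 0 = 1 from h.incl_injective h.ψ_zero]⟩

instance : ChartedSpace (EuclideanSpace ℝ (Fin d)) h.Carrier where
  atlas := range h.chart
  chartAt := h.chart
  mem_chart_source := h.mem_chart_source
  chart_mem_atlas := mem_range_self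

theorem val_mem_W {g x : h.Carrier} (hx : x ∈ (h.chart g).source) :
    (h.incl (g⁻¹ * x) : 𝔸) ∈ h.W := by
  obtain ⟨t, ht, rfl⟩ := hx
  simpa [h.incl_param] using h.mem_W t ht

/-- The transition maps are t ↦ τ(g'⁻¹ g ψ(t)), composed of maps that are smooth for the ambient
algebra. -/
instance : IsManifold 𝓘(ℝ, EuclideanSpace ℝ (Fin d)) ∞ h.Carrier := by
  refine isManifold_of_contDiffOn _ _ _ ?_
  rintro _ _ ⟨g, rfl⟩ ⟨g', rfl⟩
  have h1 : ContDiff ℝ ∞ fun t => (h.incl (g'⁻¹ * (g * h.param t)) : 𝔸) := by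
    simpa [h.incl_param] using contDiff_const.mul (contDiff_const.mul h.smooth.1)
  refine h.contDiffOn_τ.comp h1.contDiffOn fun t ht => h.val_mem_W ?_
  simp only [mfld_simps] at ht
  exact ht.2

theorem extChartAt_eq (g : h.Carrier) :
    (extChartAt 𝓘(ℝ, EuclideanSpace ℝ (Fin d)) g : h.Carrier → EuclideanSpace ℝ (Fin d)) =
      fun x => h.τ (((h.incl g)⁻¹ : 𝔸ˣ) * (h.incl x : 𝔸)) := by
  ext1 x
  change h.τ (h.incl (g⁻¹ * x)) = _
  simp

theorem contDiffAt_chart (g : h.Carrier) :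
    ContDiffAt ℝ ∞ (fun a : 𝔸 => h.τ (((h.incl g)⁻¹ : 𝔸ˣ) * a)) (h.incl g : 𝔸) := by
  refine ContDiffAt.comp (g := h.τ) (f := fun a : 𝔸 => ((h.incl g)⁻¹ : 𝔸ˣ) * a) _
    (h.contDiffOn_τ.contDiffAt (h.isOpen_W.mem_nhds ?_))
    (contDiff_const.mul contDiff_id).contDiffAt
  simpa using h.val_mem_W (h.mem_chart_source g)

theorem contMDiff_val : ContMDiff 𝓘(ℝ, EuclideanSpace ℝ (Fin d)) 𝓘(ℝ, 𝔸) ∞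
    fun g => (h.incl g : 𝔸) := by
  intro g
  have h1 : ContDiff ℝ ∞ fun t => (h.incl g : 𝔸) * h.ψ t := contDiff_const.mul h.smooth.1
  refine (h1.contMDiff.contMDiffAt.comp g contMDiffAt_extChartAt).congr_of_eventuallyEq ?_
  filter_upwards [(h.chart g).open_source.mem_nhds (h.mem_chart_source g)] with x hx
  have h2 := congrArg (fun y => (h.incl y : 𝔸)) ((h.chart g).left_inv hx)
  simpa [h.incl_param] using! h2.symm

section Target

variable {E' H' N : Type*} [NormedAddCommGroup E'] [NormedSpace ℝ E'] [TopologicalSpace H']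
  {I' : ModelWithCorners ℝ E' H'} [TopologicalSpace N] [ChartedSpace H' N]

/-- The charts are restrictions of functions that are smooth on open subsets of 𝔸. Once continuity
for the group topology is known, smoothness can therefore be tested in 𝔸; this reduces the Lie group
axioms to smoothness of the operations of 𝔸. -/
theorem contMDiff_of_val {f : N → h.Carrier} (hf : Continuous f)
    (hfv : ContMDiff I' 𝓘(ℝ, 𝔸) ∞ fun x => (h.incl (f x) : 𝔸)) :
    ContMDiff I' 𝓘(ℝ, EuclideanSpace ℝ (Fin d)) ∞ f := by
  intro x
  refine contMDiffAt_iff_target.2 ⟨hf.continuousAt, ?_⟩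
  rw [h.extChartAt_eq]
  exact ContMDiffAt.comp (g := fun a : 𝔸 => h.τ (((h.incl (f x))⁻¹ : 𝔸ˣ) * a))
    (f := fun x => (h.incl (f x) : 𝔸)) x (h.contDiffAt_chart (f x)).contMDiffAt (hfv x)

end Target

instance : LieGroup 𝓘(ℝ, EuclideanSpace ℝ (Fin d)) ∞ h.Carrier where
  contMDiff_mul := by
    refine h.contMDiff_of_val continuous_mul ?_
    have h1 : ContDiff ℝ ∞ fun z : 𝔸 × 𝔸 => z.1 * z.2 := contDiff_mul
    simpa using! h1.contMDiff.comp
      ((h.contMDiff_val.comp contMDiff_fst).prodMk_space (h.contMDiff_val.comp contMDiff_snd))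
  contMDiff_inv := by
    refine h.contMDiff_of_val continuous_inv fun g => ?_
    simp only [map_inv, ← Ring.inverse_unit]
    exact ContMDiffAt.comp (g := Ring.inverse) (f := fun g => (h.incl g : 𝔸)) g
      (contDiffAt_ringInverse ℝ (h.incl g)).contMDiffAt (h.contMDiff_val g)

instance : T2Space h.Carrier :=
  T2Space.of_injective_continuous (Units.val_injective.comp h.incl_injective) h.continuous_val

theorem contMDiff_incl : ContMDiff 𝓘(ℝ, EuclideanSpace ℝ (Fin d)) 𝓘(ℝ, 𝔸) ∞ h.incl :=
  ContMDiff.of_comp_isOpenEmbedding Units.isOpenEmbedding_val h.contMDiff_val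

/-- The chart at `g` factors through the inclusion, and its derivative at `g` is invertible. -/
theorem mfderiv_incl_injective (g : h.Carrier) :
    Function.Injective (mfderiv 𝓘(ℝ, EuclideanSpace ℝ (Fin d)) 𝓘(ℝ, 𝔸) h.incl g) := by
  have h1 := (h.contDiffAt_chart g).differentiableAt (by simp)
  have h2 : MDifferentiableAt 𝓘(ℝ, 𝔸) 𝓘(ℝ, EuclideanSpace ℝ (Fin d))
      (fun u : 𝔸ˣ => h.τ (((h.incl g)⁻¹ : 𝔸ˣ) * (u : 𝔸))) (h.incl g) :=
    h1.mdifferentiableAt.comp _ ((Units.contMDiff_val (n := 1)).mdifferentiableAt one_ne_zero)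
  have h3 := mfderiv_comp g h2 (h.contMDiff_incl.mdifferentiableAt (by simp))
  have h4 := (isInvertible_mfderiv_extChartAt (I := 𝓘(ℝ, EuclideanSpace ℝ (Fin d)))
    (mem_extChartAt_source g)).injective
  rw [h.extChartAt_eq] at h4
  change Function.Injective (mfderiv 𝓘(ℝ, EuclideanSpace ℝ (Fin d))
    𝓘(ℝ, EuclideanSpace ℝ (Fin d)) ((fun u : 𝔸ˣ => h.τ (((h.incl g)⁻¹ : 𝔸ˣ) * (u : 𝔸))) ∘ h.incl) g) at h4
  rw [h3] at h4
  exact Function.Injective.of_comp h4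

end LieData

end LieGroupStructure

/-! ### Identity component and countability -/

theorem countable_closure {G : Type*} [Group G] {s : Set G} (hs : s.Countable) :
    (Subgroup.closure s : Set G).Countable := by
  have := hs.to_subtype
  have h1 := FreeGroup.range_lift_eq_closure (f := ((↑) : s → G))
  rw [Subtype.range_coe] at h1
  rw [← h1]
  exact countable_range _

namespace LieData

variable {𝔸 : Type} [NormedRing 𝔸] [NormedAlgebra ℝ 𝔸] [CompleteSpace 𝔸]
  {K₀ K : Subgroup 𝔸ˣ} {d : ℕ} (h : LieData K₀ K d)

theorem isOpen_subgroup {H : Subgroup h.Carrier} (hH : h.param '' h.D ⊆ H) :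
    IsOpen (H : Set h.Carrier) := by
  refine H.isOpen_of_mem_nhds (g := 1) ?_
  rw [h.nhds_eq, Filter.mem_map]
  filter_upwards [h.isOpen_D.mem_nhds h.zero_mem] with t ht
  simpa using hH ⟨t, ht, rfl⟩

/-- K₀ contains the parametrized neighbourhood of 1, so it is an open subgroup and hence clopen;
conversely its elements are joined to 1 by smooth curves in K₀, which are continuous here. -/
theorem connectedComponent_one
    (hjoin : ∀ g ∈ K₀, ∃ c : ℝ → 𝔸ˣ, SmoothInto K₀ c ∧ c 0 = 1 ∧ c 1 = g) :
    connectedComponent (1 : h.Carrier) = (K₀.comap h.incl : Set h.Carrier) := by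
  refine Subset.antisymm ?_ fun g hg => ?_
  · have h1 := h.isOpen_subgroup (H := K₀.comap h.incl) (by
      rintro _ ⟨t, -, rfl⟩
      exact h.smooth.2 t)
    exact IsClopen.connectedComponent_subset ⟨Subgroup.isClosed_of_isOpen _ h1, h1⟩ (one_mem _)
  · obtain ⟨c, hc, hc0, hc1⟩ := hjoin _ hg
    let f : ℝ → h.Carrier := fun s => ⟨c s, h.le (hc.2 s)⟩
    have h1 : Continuous f := h.continuous_of_smoothInto hc
    have hf0 : f 0 = 1 := h.incl_injective hc0
    have hf1 : f 1 = g := h.incl_injective hc1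
    exact (isPreconnected_range h1).subset_connectedComponent ⟨0, hf0⟩ ⟨1, hf1⟩

/-- The subgroup C generated by parameters from a countable dense set is countable. Its closure
contains a neighbourhood of 1, so it is open and contains the identity component K₀; hence the
translates of the chart domain by C cover K₀, and coset representatives extend the cover to K. -/
theorem secondCountableTopology
    (hjoin : ∀ g ∈ K₀, ∃ c : ℝ → 𝔸ˣ, SmoothInto K₀ c ∧ c 0 = 1 ∧ c 1 = g)
    (hS : ∃ S : Set 𝔸ˣ, S.Countable ∧ ∀ g ∈ K, ∃ b ∈ S, b ∈ K ∧ b⁻¹ * g ∈ K₀) :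
    SecondCountableTopology h.Carrier := by
  obtain ⟨S, hS, hSK⟩ := hS
  obtain ⟨Q, hQ, hQd⟩ := TopologicalSpace.exists_countable_dense (EuclideanSpace ℝ (Fin d))
  let C := Subgroup.closure (h.param '' (h.D ∩ Q))
  have hC : (C : Set h.Carrier).Countable :=
    countable_closure ((hQ.mono inter_subset_right).image _)
  have hDC : h.param '' h.D ⊆ C.topologicalClosure :=
    ((image_mono (hQd.open_subset_closure_inter h.isOpen_D)).trans
      (image_closure_subset_closure_image h.continuous_param)).trans
        (closure_mono Subgroup.subset_closure)
  have hopen := h.isOpen_subgroup hDC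
  have hK₀ : ∀ g : h.Carrier, h.incl g ∈ K₀ → ∃ γ ∈ C, γ⁻¹ * g ∈ h.param '' h.D := by
    intro g hg
    have h1 : g ∈ C.topologicalClosure := by
      refine IsClopen.connectedComponent_subset
        ⟨C.isClosed_topologicalClosure, hopen⟩ (one_mem _) ?_
      rw [h.connectedComponent_one hjoin]
      exact hg
    have h2 : IsOpen (h.param '' h.D) := by
      simpa using h.isOpen_image_param h.isOpen_D subset_rfl 1
    obtain ⟨γ, hγ, hγC⟩ := mem_closure_iff.1 h1 ((fun γ => γ⁻¹ * g) ⁻¹' (h.param '' h.D))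
      (h2.preimage (by fun_prop)) ⟨0, h.zero_mem, h.incl_injective (by simpa using! h.ψ_zero)⟩
    exact ⟨γ, hγC, hγ⟩
  refine ChartedSpace.secondCountable_of_countable_cover (EuclideanSpace ℝ (Fin d))
    (s := image2 (· * ·) (h.incl ⁻¹' S) C) (eq_univ_of_forall fun g => ?_)
    ((hS.preimage h.incl_injective).image2 hC _)
  obtain ⟨b, hbS, hbK, hb⟩ := hSK (h.incl g) g.2
  let b' : h.Carrier := ⟨b, hbK⟩
  obtain ⟨γ, hγ, t, ht, hγt⟩ := hK₀ (b'⁻¹ * g) hb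
  refine mem_iUnion₂.2 ⟨b' * γ, ⟨b', hbS, γ, hγ, rfl⟩, t, ht, ?_⟩
  simp only [hγt]
  group

theorem isLieSubgroupVia
    (hjoin : ∀ g ∈ K₀, ∃ c : ℝ → 𝔸ˣ, SmoothInto K₀ c ∧ c 0 = 1 ∧ c 1 = g)
    (hS : ∃ S : Set 𝔸ˣ, S.Countable ∧ ∀ g ∈ K, ∃ b ∈ S, b ∈ K ∧ b⁻¹ * g ∈ K₀) :
    IsLieSubgroupVia 𝓘(ℝ, 𝔸) d h.incl K where
  lieGroup := inferInstance
  t2 := inferInstance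
  secondCountable := h.secondCountableTopology hjoin hS
  injective := h.incl_injective
  smooth := h.contMDiff_incl
  immersion := h.mfderiv_incl_injective
  range_eq := K.range_subtype

end LieData

/-! ### Lie subgroup structures on subgroups of matrix groups -/

section

variable {𝔸 : Type} [NormedRing 𝔸] [NormedAlgebra ℝ 𝔸] [CompleteSpace 𝔸] [FiniteDimensional ℝ 𝔸]
  {K₀ K : Subgroup 𝔸ˣ}

theorem isLieSubgroupWithIdentityComponent (hle : K₀ ≤ K)
    (hconj : ∀ {g a : 𝔸ˣ}, g ∈ K → a ∈ K₀ → g * a * g⁻¹ ∈ K₀)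
    (hjoin : ∀ g ∈ K₀, ∃ c : ℝ → 𝔸ˣ, SmoothInto K₀ c ∧ c 0 = 1 ∧ c 1 = g)
    (hS : ∃ S : Set 𝔸ˣ, S.Countable ∧ ∀ g ∈ K, ∃ b ∈ S, b ∈ K ∧ b⁻¹ * g ∈ K₀) :
    IsLieSubgroupWithIdentityComponent 𝓘(ℝ, 𝔸) K K₀ := by
  obtain ⟨h⟩ := exists_groupChart K₀
  let h' : LieData K₀ K _ := ⟨h, hle, hconj⟩
  refine ⟨_, h'.Carrier, inferInstance, inferInstance, inferInstance, h'.incl,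
    h'.isLieSubgroupVia hjoin hS, ?_⟩
  rw [h'.connectedComponent_one hjoin]
  refine image_preimage_eq_of_subset fun g hg => ⟨⟨g, hle hg⟩, rfl⟩

theorem isConnectedLieSubgroup
    (hjoin : ∀ g ∈ K₀, ∃ c : ℝ → 𝔸ˣ, SmoothInto K₀ c ∧ c 0 = 1 ∧ c 1 = g) :
    IsConnectedLieSubgroup 𝓘(ℝ, 𝔸) K₀ := by
  obtain ⟨h⟩ := exists_groupChart K₀
  let h' : LieData K₀ K₀ _ :=
    ⟨h, le_rfl, fun hg ha => K₀.mul_mem (K₀.mul_mem hg ha) (K₀.inv_mem hg)⟩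
  -- For K = K₀ there is a single coset, represented by 1.
  refine ⟨_, h'.Carrier, inferInstance, inferInstance, inferInstance, h'.incl,
    h'.isLieSubgroupVia hjoin ⟨{1}, countable_singleton 1, fun g hg =>
      ⟨1, rfl, K₀.one_mem, by simpa using hg⟩⟩, ?_⟩
  refine connectedSpace_iff_connectedComponent.2 ⟨1, ?_⟩
  rw [h'.connectedComponent_one hjoin]
  exact eq_univ_of_forall fun g => g.2

theorem exists_smoothInto_of_mem_smoothComponent {F : Type} [NormedAddCommGroup F]
    [NormedSpace ℝ F] {W : Type*} [AddCommGroup W] [Module ℝ W] [TopologicalSpace W]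
    {L : Subgroup (W ≃L[ℝ] W)} (hL : L ≤ smoothComponent F L) (φ : W ≃L[ℝ] F)
    {g : (F →L[ℝ] F)ˣ} (hg : g ∈ L.map (conjGL φ)) :
    ∃ c : ℝ → (F →L[ℝ] F)ˣ, SmoothInto (L.map (conjGL φ)) c ∧ c 0 = 1 ∧ c 1 = g := by
  obtain ⟨A, hA, rfl⟩ := hg
  obtain ⟨c, hc, hc0, hc1, hcL⟩ := hL hA φ
  choose B hB hBc using hcL
  exact ⟨fun s => conjGL φ (B s), ⟨by simpa only [← hBc] using hc, fun s => ⟨_, hB s, rfl⟩⟩,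
    Units.ext ((hBc 0).symm.trans hc0), Units.ext ((hBc 1).symm.trans hc1)⟩

theorem isLieSubgroup_map_conjGL {F : Type} [NormedAddCommGroup F] [NormedSpace ℝ F]
    [FiniteDimensional ℝ F] {W : Type*} [AddCommGroup W] [Module ℝ W] [TopologicalSpace W]
    {L₀ L : Subgroup (W ≃L[ℝ] W)} (φ : W ≃L[ℝ] F) (hle : L₀ ≤ L)
    (hconj : ∀ {A B : W ≃L[ℝ] W}, A ∈ L → B ∈ L₀ → A * B * A⁻¹ ∈ L₀)
    (hjoin : L₀ ≤ smoothComponent F L₀)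
    (hS : ∃ S : Set (W ≃L[ℝ] W), S.Countable ∧ ∀ A ∈ L, ∃ B ∈ S, B ∈ L ∧ B⁻¹ * A ∈ L₀) :
    IsConnectedLieSubgroup 𝓘(ℝ, F →L[ℝ] F) (L₀.map (conjGL φ)) ∧
      IsLieSubgroupWithIdentityComponent 𝓘(ℝ, F →L[ℝ] F) (L.map (conjGL φ))
        (L₀.map (conjGL φ)) := by
  have : CompleteSpace F := FiniteDimensional.complete ℝ F
  have hj := fun g (hg : g ∈ L₀.map (conjGL φ)) =>
    exists_smoothInto_of_mem_smoothComponent hjoin φ hg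
  refine ⟨isConnectedLieSubgroup hj,
    isLieSubgroupWithIdentityComponent (Subgroup.map_mono hle) ?_ hj ?_⟩
  · rintro _ _ ⟨A, hA, rfl⟩ ⟨B, hB, rfl⟩
    exact ⟨A * B * A⁻¹, hconj hA hB, by simp⟩
  · obtain ⟨S, hS, hSL⟩ := hS
    refine ⟨conjGL φ '' S, hS.image _, ?_⟩
    rintro _ ⟨A, hA, rfl⟩
    obtain ⟨B, hBS, hB, hBA⟩ := hSL A hA
    exact ⟨_, ⟨B, hBS, rfl⟩, ⟨B, hB, rfl⟩, B⁻¹ * A, hBA, by simp⟩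

end

end FlatTransport

end

/-! ### The main theorem -/

theorem mainTheorem10 {n k : ℕ}
    {M : Type*} [TopologicalSpace M] [T2Space M] [SecondCountableTopology M]
    [ChartedSpace (EuclideanSpace ℝ (Fin n)) M]
    [IsManifold 𝓘(ℝ, EuclideanSpace ℝ (Fin n)) ∞ M]
    {V : M → Type*} [TopologicalSpace (TotalSpace (EuclideanSpace ℝ (Fin k)) V)]
    [∀ x, AddCommGroup (V x)] [∀ x, Module ℝ (V x)] [∀ x, TopologicalSpace (V x)]
    [∀ x, IsTopologicalAddGroup (V x)] [∀ x, ContinuousSMul ℝ (V x)]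
    [FiberBundle (EuclideanSpace ℝ (Fin k)) V] [VectorBundle ℝ (EuclideanSpace ℝ (Fin k)) V]
    [ContMDiffVectorBundle ∞ (EuclideanSpace ℝ (Fin k)) V 𝓘(ℝ, EuclideanSpace ℝ (Fin n))]
    (cov : CovariantDerivative 𝓘(ℝ, EuclideanSpace ℝ (Fin n)) (EuclideanSpace ℝ (Fin k)) V)
    (hcov : CovariantDerivative.ContMDiffCovariantDerivative cov ∞) :
    -- parallel transport along piecewise smooth paths is a well defined linear isomorphism
    (∀ (x y : M) (γ : Path x y), FlatTransport.PiecewiseSmooth (EuclideanSpace ℝ (Fin n)) γ →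
      ∃ A : V x ≃L[ℝ] V y, ∀ v, A v = FlatTransport.parallelTransport cov γ v ∧
        ∀ w, FlatTransport.IsParallelTransport cov γ v w ↔ w = A v) ∧
    -- for a flat connection it is invariant under homotopies with fixed end points
    (FlatTransport.IsFlat cov → ∀ (x y : M) (γ₀ γ₁ : Path x y),
      FlatTransport.PiecewiseSmooth (EuclideanSpace ℝ (Fin n)) γ₀ →
      FlatTransport.PiecewiseSmooth (EuclideanSpace ℝ (Fin n)) γ₁ → γ₀.Homotopic γ₁ →
      FlatTransport.parallelTransport cov γ₀ = FlatTransport.parallelTransport cov γ₁) ∧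
    -- a connection is flat iff it has trivial transport along all null-homotopic loops
    (FlatTransport.IsFlat cov ↔ ∀ (x : M) (γ : Path x x),
      FlatTransport.PiecewiseSmooth (EuclideanSpace ℝ (Fin n)) γ → γ.Homotopic (Path.refl x) →
      FlatTransport.parallelTransport cov γ = id) ∧
    ∀ x : M,
      -- the transports along (null-homotopic) loops at `x` form groups
      (FlatTransport.holonomyGroup cov x : Set (V x ≃L[ℝ] V x)) =
        FlatTransport.holonomySet cov x ∧
      (FlatTransport.restrictedHolonomyGroup cov x : Set (V x ≃L[ℝ] V x)) =
        FlatTransport.restrictedHolonomySet cov x ∧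
      -- they are Lie subgroups of `GL(k, ℝ)`, the second one being connected and the identity
      -- component of the first one
      (∀ φ : V x ≃L[ℝ] EuclideanSpace ℝ (Fin k),
        FlatTransport.IsConnectedLieSubgroup
          𝓘(ℝ, EuclideanSpace ℝ (Fin k) →L[ℝ] EuclideanSpace ℝ (Fin k))
          ((FlatTransport.restrictedHolonomyGroup cov x).map (FlatTransport.conjGL φ)) ∧
        FlatTransport.IsLieSubgroupWithIdentityComponent
          𝓘(ℝ, EuclideanSpace ℝ (Fin k) →L[ℝ] EuclideanSpace ℝ (Fin k))
          ((FlatTransport.holonomyGroup cov x).map (FlatTransport.conjGL φ))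
          ((FlatTransport.restrictedHolonomyGroup cov x).map (FlatTransport.conjGL φ))) ∧
      -- the second one is a normal subgroup of the first one, and `[γ] ↦ [P_γ]` is a surjective
      -- homomorphism from the fundamental group onto the quotient
      FlatTransport.restrictedHolonomyGroup cov x ≤ FlatTransport.holonomyGroup cov x ∧
      ∃ _ : ((FlatTransport.restrictedHolonomyGroup cov x).subgroupOf
          (FlatTransport.holonomyGroup cov x)).Normal,
        ∃! Φ : FundamentalGroup M x →* (FlatTransport.holonomyGroup cov x ⧸
            (FlatTransport.restrictedHolonomyGroup cov x).subgroupOf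
              (FlatTransport.holonomyGroup cov x)),
          Function.Surjective Φ ∧
          ∀ (γ : Path x x) (A : FlatTransport.holonomyGroup cov x),
            FlatTransport.PiecewiseSmooth (EuclideanSpace ℝ (Fin n)) γ →
            (∀ v, (A : V x ≃L[ℝ] V x) v = FlatTransport.parallelTransport cov γ v) →
            Φ (FundamentalGroup.fromPath (Path.Homotopic.Quotient.mk γ)) = QuotientGroup.mk A := by
  refine ⟨fun x y γ hγ => ?_, fun hflat x y γ₀ γ₁ h₀ h₁ h =>
    hflat.parallelTransport_eq_of_homotopic hcov h₀ h₁ h,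
    ⟨fun hflat x γ hγ h => hflat.parallelTransport_eq_id hcov hγ h,
      fun H => FlatTransport.isFlat_of_parallelTransport_eq_id hcov H⟩, fun x => ?_⟩
  · obtain ⟨A, hA⟩ := FlatTransport.exists_hasTransport hcov hγ
    exact ⟨A, fun v => ⟨(hA.parallelTransport hcov v).symm, fun w => hA.iff hcov⟩⟩
  · refine ⟨?_, ?_, fun φ => ?_, ?_, FlatTransport.exists_fundamentalGroup_hom hcov x⟩
    · rw [FlatTransport.holonomyGroup_eq hcov, FlatTransport.coe_holSubgroup]
    · rw [FlatTransport.restrictedHolonomyGroup_eq hcov, FlatTransport.coe_restrictedHolSubgroup]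
    · rw [FlatTransport.holonomyGroup_eq hcov, FlatTransport.restrictedHolonomyGroup_eq hcov]
      exact FlatTransport.isLieSubgroup_map_conjGL φ
        (FlatTransport.restrictedHolSubgroup_le hcov x)
        (FlatTransport.conj_mem_restrictedHolSubgroup hcov)
        (FlatTransport.restrictedHolSubgroup_le_smoothComponent hcov x)
        (FlatTransport.exists_countable_cosets hcov x)
    · rw [FlatTransport.holonomyGroup_eq hcov, FlatTransport.restrictedHolonomyGroup_eq hcov]
      exact FlatTransport.restrictedHolSubgroup_le hcov x
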